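/- For $a\in(0,1)$ and $C>0$ let $$h(z)=C\,\frac{z^2-1}{z}\sqrt{\frac{(z+a)(1+az)}{z}},\qquad a<|z|<1/a,$$ with the principal branch of the root (it is analytic in this annulus and positive at $z=1$), let $h(z)=\sum_{j\in\mathbb Z}c_jz^j$ be its Laurent series, put $f(z)=\sum_{j\ge1}c_jz^j$, and let $$\Omega=\Omega_{a,C}=\Big\{x\in\mathbb R^4:\ x_1+i\sqrt{x_2^2+x_3^2+x_4^2}\in f(\mathbb D)\Big\},$$ where $\mathbb D$ is the open unit disk. For every $\varepsilon>0$ there is $\alpha\in(0,1)$ such that for all $a\in(0,\alpha)$ and all $C>0$: 1. $f$ is analytic in $|z|<1/a$, $h(z)=f(z)-f(1/z)$ for $a<|z|<1/a$, and $f$ is injective on $\overline{\mathbb D}$. 2. $\Omega$ is a quadrature domain: it is open, connected and bounded, and for all integrable harmonic functions $u$ in $\Omega$ the integral $\int_\Omega u\,dV$ is a fixed finite real linear combination of values of partial derivatives of $u$ at finitely many points of $\Omega$. More precisely, $0\in\Omega$ and there are $a_0,a_1>0$ with $$\int_\Omega u\,dV=a_0\,u(0)+a_1\,\frac{\partial u}{\partial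 x_1}(0)$$ for all such $u$; here $a_1$ is small in comparison with $a_0$: $a_1<\varepsilon\, C\,a_0$ and $a_1^4<\varepsilon\,a_0^5$. 3. $\Omega$ is not algebraic: $\partial\Omega$ is not contained in the zero set of any nonzero real polynomial in $x_1,\dots,x_4$. 4. $\partial\Omega$ is given explicitly through complete elliptic integrals. With $$K=\int_0^{\pi/2}\!\frac{dt}{\sqrt{1-a^2\sin^2t}},\quad E=\int_0^{\pi/2}\!\sqrt{1-a^2\sin^2t}\,dt,\quad \Pi(\nu)=\int_0^{\pi/2}\!\frac{dt}{(1-\nu\sin^2t)\sqrt{1-a^2\sin^2t}}$$ (of the first, second and third kind) and $$\gamma(w)=\frac{2C}{\pi}\Big[\tfrac{(1+a^2)E-(1-a^2)K}{3a}+\big(2E-(1-a^2)K\big)w+\tfrac{w^2-1}{w^2}\Big((1+aw)(w+a)\,\Pi(-aw)-a(1+aw)K-wE\Big)\Big],$$ $\partial\Omega$ is the set of all $x\in\mathbb R^4$ with $x_1+i\sqrt{x_2^2+x_3^2+x_4^2}\in\{\gamma(w):|w|=1\}$. -/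

import Mathlib

namespace NonalgQD

noncomputable section

/-! ### Quadrature domains for harmonic functions -/

/-- The partial derivative of `u` in the `i`-th coordinate direction. -/
def partialDeriv {n : ℕ} (i : Fin n) (u : EuclideanSpace ℝ (Fin n) → ℝ) :
    EuclideanSpace ℝ (Fin n) → ℝ :=
  fun x => fderiv ℝ u x (EuclideanSpace.single i 1)

/-- The partial derivative `∂_α u` for a multi-index `α`: differentiate `α i` times in the `i`-th
coordinate direction, for every `i`. -/
def multiPartial {n : ℕ} (α : Fin n → ℕ) (u : EuclideanSpace ℝ (Fin n) → ℝ) :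
    EuclideanSpace ℝ (Fin n) → ℝ :=
  (List.finRange n).foldr (fun i v => (partialDeriv i)^[α i] v) u

/-- `∫_Ω u dV = L u` for all harmonic functions `u` in `Ω` that are integrable over `Ω`. -/
def HasQuadratureIdentity {n : ℕ} (Ω : Set (EuclideanSpace ℝ (Fin n)))
    (L : (EuclideanSpace ℝ (Fin n) → ℝ) → ℝ) : Prop :=
  ∀ u : EuclideanSpace ℝ (Fin n) → ℝ,
    InnerProductSpace.HarmonicOnNhd u Ω → MeasureTheory.IntegrableOn u Ω →
      ∫ x in Ω, u x = L u

/-- A bounded domain which admits a quadrature formula for harmonic functions: a finite real linear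
combination of values of partial derivatives at finitely many points of the domain. -/
def IsQuadratureDomain {n : ℕ} (Ω : Set (EuclideanSpace ℝ (Fin n))) : Prop :=
  IsOpen Ω ∧ IsConnected Ω ∧ Bornology.IsBounded Ω ∧
    ∃ (S : Finset (EuclideanSpace ℝ (Fin n))) (A : Finset (Fin n → ℕ))
      (c : EuclideanSpace ℝ (Fin n) → (Fin n → ℕ) → ℝ),
      (∀ x ∈ S, x ∈ Ω) ∧
      HasQuadratureIdentity Ω (fun u => ∑ x ∈ S, ∑ α ∈ A, c x α * multiPartial α u x)

/-- The boundary of `Ω` is contained in the zero set of a nonzero polynomial. -/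
def IsAlgebraicDomain {n : ℕ} (Ω : Set (EuclideanSpace ℝ (Fin n))) : Prop :=
  ∃ P : MvPolynomial (Fin n) ℝ, P ≠ 0 ∧
    ∀ x ∈ frontier Ω, MvPolynomial.eval (fun i => x i) P = 0

/-- The subset of `ℝ⁴` generated by rotating a planar set (symmetric in the real axis) about the
`x₁`-axis: the points `x` with `x₁ + i √(x₂² + x₃² + x₄²) ∈ D`. -/
def rotate (D : Set ℂ) : Set (EuclideanSpace ℝ (Fin 4)) :=
  {x | (⟨x 0, Real.sqrt (x 1 ^ 2 + x 2 ^ 2 + x 3 ^ 2)⟩ : ℂ) ∈ D}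

/-! ### The conformal map -/

/-- `h(z) = C (z² - 1)/z √((z + a)(1 + a z)/z)`. The radicand is `|1 + a z|² > 0` on `|z| = 1`, and
the principal branch of the root is analytic in `a < |z| < 1/a` and positive at `z = 1`. -/
def h (a C : ℝ) (z : ℂ) : ℂ :=
  C * ((z ^ 2 - 1) / z) * ((z + a) / z * (1 + a * z)) ^ (1 / 2 : ℂ)

/-- The Laurent coefficient of index `j` of `h`, on the unit circle. -/
def laurentCoeff (a C : ℝ) (j : ℤ) : ℂ :=
  (2 * Real.pi * Complex.I)⁻¹ * ∮ z in C(0, 1), z ^ (-j - 1) * h a C z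

/-- The part `f(z) = ∑_{j ≥ 1} c_j z^j` of the Laurent series of `h` with positive powers. -/
def f (a C : ℝ) (z : ℂ) : ℂ :=
  ∑' j : ℕ, laurentCoeff a C (j + 1) * z ^ (j + 1)

/-- The domain in `ℝ⁴` obtained by rotating the image of the unit disk under `f`. -/
def Omega (a C : ℝ) : Set (EuclideanSpace ℝ (Fin 4)) :=
  rotate (f a C '' Metric.ball 0 1)

/-! ### Complete elliptic integrals (of modulus `k`, `0 < k < 1`) -/

/-- The complete elliptic integral of the first kind. -/
def ellipticK (k : ℝ) : ℝ :=
  ∫ t in (0 : ℝ)..(Real.pi / 2), 1 / Real.sqrt (1 - k ^ 2 * Real.sin t ^ 2)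

/-- The complete elliptic integral of the second kind. -/
def ellipticE (k : ℝ) : ℝ :=
  ∫ t in (0 : ℝ)..(Real.pi / 2), Real.sqrt (1 - k ^ 2 * Real.sin t ^ 2)

/-- The complete elliptic integral of the third kind with (complex) characteristic `ν`. -/
def ellipticPi (ν : ℂ) (k : ℝ) : ℂ :=
  ∫ t in (0 : ℝ)..(Real.pi / 2),
    1 / ((1 - ν * (Real.sin t : ℂ) ^ 2) * (Real.sqrt (1 - k ^ 2 * Real.sin t ^ 2) : ℂ))

/-- The parametrization by `|w| = 1` of the profile curve through complete elliptic integrals; `w`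
enters the elliptic integrals only as the characteristic `-a w` of the third one. -/
def profile (a C : ℝ) (w : ℂ) : ℂ :=
  2 * C / Real.pi *
    (((1 + a ^ 2) * ellipticE a - (1 - a ^ 2) * ellipticK a) / (3 * a)
      + (2 * ellipticE a - (1 - a ^ 2) * ellipticK a) * w
      + (w ^ 2 - 1) / w ^ 2 *
        ((1 + a * w) * (w + a) * ellipticPi (-(a * w)) a
          - a * (1 + a * w) * ellipticK a - w * ellipticE a))

end

end NonalgQD

/-!
The radical in `h` is `√(1 + a z) √(1 + a / z)`. Multiplying the two binomial series gives its
Laurent series, symmetric under `z ↦ 1 / z`; hence the coefficients of `h` are odd in the index, and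
`h z = f z - f (1 / z)` (`h_eq_f_sub_f_inv`). They are integrals of Wallis type, and summing
under the integral sign expresses `f` on the unit circle by complete elliptic integrals
(`profile_eq_f`). The coefficient `c_j` is `O(a ^ (j - 1))` while `c_1` is close to `C`, so for
small `a` the linear term dominates: `f` is injective on the closed disk, `Im f` has the sign of
`Im z`, and the image of the disk is a domain symmetric in the real axis, whose rotation `Ω` has the
rotated image of the unit circle as its boundary (`frontier_Omega`).

*Not algebraic.* In each half-plane bounded by the axis of rotation the boundary is the curve with
coordinates `f - h / 2` and `h / 2i`, over the upper half of the unit circle, because there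
`f (1 / z)` is the conjugate of `f z`. A polynomial that vanishes on it gives a relation between `f`
and `h` in the annulus. The function `f` is single-valued near `-a`, where `h²` has a simple zero;
so the relation survives `h ↦ -h` (`branch_neg`), and the substitution `z ↦ 1 / z` changes
`(f, h)` into `(f - h, -h)` (`branch_inv`). Together they shift `f` by integer multiples of `h`
with `h` itself kept, so that the polynomial vanishes on lines parallel to the axis, and is zero.

*Quadrature identity.* Let `u` be harmonic in `Ω`, and let `v z` be `Im z` times the integral of `u`
over the unit sphere of directions at the point `z` of the profile plane. The dimension four is what
makes `v` harmonic in the plane (`harmonicOnNhd_orbitPotential`); this is derived by differentiating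
along rotations, since the sum of the squares of their generators is the spherical Laplacian.
Cylindrical coordinates (`integral_Omega_eq`) and the conformal map turn `2 ∫ u` over `Ω` into
`∫ Im f |f'|² (v ∘ f)` over the disk, and `v ∘ f` is the real part of an analytic function `F`.
As `h` is `f - conj f` on the unit circle, Green's formula gives
`8 ∫ Im f |f'|² G = ∮ G f' h² dz` for `G` analytic beyond the closed disk
(`setIntegral_pullbackWeight_mul`). Now `z³ h²` is a polynomial, so if `G 0 = 0` only `G' 0` and
`G'' 0` enter the residue at the origin. This applies to the dilates of `F`; the limit is
taken in `setIntegral_pullbackWeight_mul_re`, where the integrability of `u` is used. The imaginary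
parts of `F'` on the real axis are normal derivatives of `v ∘ f` and give the values of `u` on the
axis (`im_deriv_eq`).

The weight of `u 0` is of order `C⁴` and that of `∂u/∂x₁ 0` is of order `a C⁵`, whence the smallness
for small `a`.
-/

namespace NonalgQD

noncomputable section

open MeasureTheory Complex

/-! ### The binomial series of the square root and elliptic integrals -/

/-- Termwise integration over an interval of a series of continuous functions with summable
constant majorants. -/
lemma hasSum_intervalIntegral_of_le {ι E : Type*} [Countable ι] [NormedAddCommGroup E]
    [NormedSpace ℝ E] [CompleteSpace E] {F : ι → ℝ → E} {g : ℝ → E} {B : ι → ℝ} (u v : ℝ)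
    (hF : ∀ i, Continuous (F i)) (hB : ∀ i t, ‖F i t‖ ≤ B i) (hs : Summable B)
    (hg : ∀ t, HasSum (fun i => F i t) (g t)) :
    HasSum (fun i => ∫ t in u..v, F i t) (∫ t in u..v, g t) := by
  refine intervalIntegral.hasSum_integral_of_dominated_convergence (fun i _ => B i)
    (fun i => (hF i).aestronglyMeasurable) (fun i => .of_forall fun t _ => hB i t)
    (.of_forall fun t _ => hs) (by simp) (.of_forall fun t _ => hg t)

/-- The coefficients `(1/2 choose n)` of the binomial series of `√(1 + x)`. -/
def sqrtCoeff (n : ℕ) : ℝ := Ring.choose (1 / 2 : ℝ) n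

lemma sqrtCoeff_zero : sqrtCoeff 0 = 1 := by simp [sqrtCoeff]

lemma sqrtCoeff_succ (n : ℕ) : sqrtCoeff (n + 1) = (1 / 2 - n) / (n + 1) * sqrtCoeff n := by
  have h : (n + 1).factorial * sqrtCoeff (n + 1) = n.factorial * sqrtCoeff n * (1 / 2 - n) := by
    have h1 := Ring.descPochhammer_eq_factorial_smul_choose (1 / 2 : ℝ) (n + 1)
    have h0 := Ring.descPochhammer_eq_factorial_smul_choose (1 / 2 : ℝ) n
    rw [descPochhammer_succ_right, Polynomial.smeval_mul, h0] at h1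
    simp only [nsmul_eq_mul, Polynomial.smeval_sub, Polynomial.smeval_X, Polynomial.smeval_natCast,
      pow_one, pow_zero, mul_one] at h1
    exact h1.symm
  have hn : ((n : ℝ) + 1) ≠ 0 := by positivity
  have hf : (n.factorial : ℝ) ≠ 0 := by positivity
  rw [Nat.factorial_succ] at h
  push_cast at h
  field_simp
  apply mul_left_cancel₀ hf
  linear_combination 2 * h

lemma abs_sqrtCoeff_le_one (n : ℕ) : |sqrtCoeff n| ≤ 1 := by
  induction n with
  | zero => simp [sqrtCoeff_zero]
  | succ n ih =>
    rw [sqrtCoeff_succ, abs_mul]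
    refine mul_le_one₀ ?_ (abs_nonneg _) ih
    rw [abs_div, div_le_one (by positivity), abs_of_pos (by positivity : (0 : ℝ) < n + 1), abs_le]
    constructor <;> linarith [(Nat.cast_nonneg n : (0 : ℝ) ≤ n)]

lemma hasSum_sqrtCoeff {x : ℂ} (hx : ‖x‖ < 1) :
    HasSum (fun n => (sqrtCoeff n : ℂ) * x ^ n) ((1 + x) ^ (1 / 2 : ℂ)) := by
  have h := (Complex.one_add_cpow_hasFPowerSeriesOnBall_zero (a := (1 / 2 : ℂ))).hasSum
    (y := x) (by simpa [Metric.mem_eball, edist_eq_enorm_sub, ← ofReal_norm] using hx)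
  simp only [zero_add, binomialSeries_apply] at h
  convert! h using 2 with n
  simp [sqrtCoeff, Complex.ofReal_choose]

lemma hasSum_sqrtCoeff_real {x : ℝ} (hx : |x| < 1) :
    HasSum (fun n => sqrtCoeff n * x ^ n) (Real.sqrt (1 + x)) := by
  have h := (Real.one_add_rpow_hasFPowerSeriesOnBall_zero (a := (1 / 2 : ℝ))).hasSum
    (y := x) (by simpa [Metric.mem_eball, edist_eq_enorm_sub, ← ofReal_norm] using hx)
  simp only [zero_add, binomialSeries_apply] at h
  rw [Real.sqrt_eq_rpow]
  convert! h using 2 with n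
  simp [sqrtCoeff]

/-- Wallis-type integral formula for the binomial coefficients. -/
lemma integral_cos_sq_mul_sin_pow (n : ℕ) :
    ∫ t in (0 : ℝ)..(Real.pi / 2), Real.cos t ^ 2 * Real.sin t ^ (2 * n) =
      Real.pi / 2 * (-1) ^ n * sqrtCoeff (n + 1) := by
  have key : ∀ m : ℕ, ∫ t in (0 : ℝ)..(Real.pi / 2), Real.cos t ^ 2 * Real.sin t ^ m =
      (∫ t in (0 : ℝ)..(Real.pi / 2), Real.sin t ^ m) / (m + 2) := by
    intro m
    have h1 : ∀ t : ℝ, Real.cos t ^ 2 * Real.sin t ^ m =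
        Real.sin t ^ m - Real.sin t ^ (m + 2) := by
      intro t; rw [Real.cos_sq']; ring
    simp_rw [h1]
    rw [intervalIntegral.integral_sub (Continuous.intervalIntegrable (by fun_prop) _ _)
      (Continuous.intervalIntegrable (by fun_prop) _ _), integral_sin_pow]
    simp
    field_simp
    ring
  rw [key]
  induction n with
  | zero =>
    rw [sqrtCoeff_succ, sqrtCoeff_zero]; simp; ring
  | succ n ih =>
    rw [sqrtCoeff_succ, show 2 * (n + 1) = 2 * n + 2 by ring, integral_sin_pow]
    rw [div_eq_iff (by positivity)] at ih
    rw [ih]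
    simp
    field_simp
    ring

/-- The Fourier coefficient of index `±k` of `√(1 + a z) √(1 + a / z)` on the unit circle. -/
def symbolCoeff (a : ℝ) (k : ℕ) : ℝ := ∑' n, sqrtCoeff n * sqrtCoeff (n + k) * a ^ (2 * n + k)

section

variable {a : ℝ}

lemma abs_symbolTerm_le (ha : 0 ≤ a) (n k : ℕ) :
    |sqrtCoeff n * sqrtCoeff (n + k) * a ^ (2 * n + k)| ≤ a ^ k * (a ^ 2) ^ n := by
  rw [abs_mul, abs_mul, abs_of_nonneg (pow_nonneg ha _), pow_add, pow_mul, mul_comm (a ^ k)]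
  refine mul_le_of_le_one_left (by positivity) ?_
  exact mul_le_one₀ (abs_sqrtCoeff_le_one _) (abs_nonneg _) (abs_sqrtCoeff_le_one _)

lemma hasSum_symbolCoeff (ha : 0 ≤ a) (ha1 : a < 1) (k : ℕ) :
    HasSum (fun n => sqrtCoeff n * sqrtCoeff (n + k) * a ^ (2 * n + k)) (symbolCoeff a k) :=
  (Summable.of_norm_bounded ((summable_geometric_of_lt_one (by positivity)
    (by nlinarith : a ^ 2 < 1)).mul_left (a ^ k)) fun n =>
      (Real.norm_eq_abs _).trans_le (abs_symbolTerm_le ha n k)).hasSum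

lemma abs_symbolCoeff_le (ha : 0 ≤ a) (ha1 : a ≤ 1 / 2) (k : ℕ) :
    |symbolCoeff a k| ≤ 2 * a ^ k := by
  have h2 : a ^ 2 < 1 := by nlinarith
  have h := tsum_of_norm_bounded ((hasSum_geometric_of_lt_one (by positivity) h2).mul_left (a ^ k))
    fun n => (Real.norm_eq_abs _).trans_le (abs_symbolTerm_le ha n k)
  refine h.trans ?_
  rw [mul_comm]
  gcongr
  rw [inv_le_comm₀ (by linarith) (by norm_num)]
  nlinarith

lemma one_le_symbolCoeff_zero (ha : 0 ≤ a) (ha1 : a < 1) : 1 ≤ symbolCoeff a 0 := by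
  have h := le_hasSum (hasSum_symbolCoeff ha ha1 0) 0 fun n _ => by
    rw [add_zero, add_zero, pow_mul]
    have := mul_self_nonneg (sqrtCoeff n)
    positivity
  simpa [sqrtCoeff_zero] using h

lemma sq_mul_sin_sq_lt_one (ha : 0 ≤ a) (ha1 : a < 1) (t : ℝ) : a ^ 2 * Real.sin t ^ 2 < 1 := by
  have h2 : a ^ 2 < 1 := by nlinarith
  nlinarith [Real.sin_sq_le_one t, sq_nonneg (Real.sin t), sq_nonneg a]

lemma modulus_pos (ha : 0 ≤ a) (ha1 : a < 1) (t : ℝ) :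
    0 < Real.sqrt (1 - a ^ 2 * Real.sin t ^ 2) :=
  Real.sqrt_pos.2 (by linarith [sq_mul_sin_sq_lt_one ha ha1 t])

lemma hasDerivAt_modulus (ha : 0 ≤ a) (ha1 : a < 1) (t : ℝ) :
    HasDerivAt (fun t => Real.sqrt (1 - a ^ 2 * Real.sin t ^ 2))
      (-(a ^ 2 * Real.sin t * Real.cos t) / Real.sqrt (1 - a ^ 2 * Real.sin t ^ 2)) t := by
  have h := (((Real.hasDerivAt_sin t).fun_pow 2).const_mul (a ^ 2)).const_sub 1
  have h2 := h.sqrt (by linarith [sq_mul_sin_sq_lt_one ha ha1 t])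
  convert h2 using 1
  have := (modulus_pos ha ha1 t).ne'
  field_simp
  ring

lemma symbolCoeff_succ_eq_integral (ha : 0 ≤ a) (ha1 : a < 1) (k : ℕ) :
    symbolCoeff a (k + 1) = 2 / Real.pi * ∫ t in (0 : ℝ)..(Real.pi / 2),
      (-1) ^ k * a ^ (k + 1) * Real.cos t ^ 2 * Real.sin t ^ (2 * k) *
        Real.sqrt (1 - a ^ 2 * Real.sin t ^ 2) := by
  have hs : ∀ t, HasSum (fun n => (-1) ^ k * a ^ (k + 1) * Real.cos t ^ 2 * Real.sin t ^ (2 * k) *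
      (sqrtCoeff n * (-(a ^ 2 * Real.sin t ^ 2)) ^ n))
      ((-1) ^ k * a ^ (k + 1) * Real.cos t ^ 2 * Real.sin t ^ (2 * k) *
        Real.sqrt (1 - a ^ 2 * Real.sin t ^ 2)) := fun t => by
    refine HasSum.mul_left _ ?_
    rw [sub_eq_add_neg]
    apply hasSum_sqrtCoeff_real
    rw [abs_neg, abs_of_nonneg (by positivity)]
    exact sq_mul_sin_sq_lt_one ha ha1 t
  have h := hasSum_intervalIntegral_of_le 0 (Real.pi / 2) (B := fun n => (a ^ 2) ^ n)
    (fun n => by fun_prop) (fun n t => ?_)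
    (summable_geometric_of_lt_one (by positivity) (by nlinarith : a ^ 2 < 1)) hs
  · refine (hasSum_symbolCoeff ha ha1 (k + 1)).unique ?_
    convert! h.mul_left (2 / Real.pi) using 2 with n
    have : ∀ t : ℝ, (-1) ^ k * a ^ (k + 1) * Real.cos t ^ 2 * Real.sin t ^ (2 * k) *
        (sqrtCoeff n * (-(a ^ 2 * Real.sin t ^ 2)) ^ n) =
        ((-1) ^ k * a ^ (k + 1) * sqrtCoeff n * (-1) ^ n * a ^ (2 * n)) *
          (Real.cos t ^ 2 * Real.sin t ^ (2 * (n + k))) := by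
      intro t; rw [neg_pow (a ^ 2 * _), mul_pow, ← pow_mul, ← pow_mul]; ring
    simp_rw [this]
    rw [intervalIntegral.integral_const_mul, integral_cos_sq_mul_sin_pow,
      show n + k + 1 = n + (k + 1) by ring]
    have h1 : ((-1 : ℝ) ^ k) * (-1) ^ k = 1 := by rw [← mul_pow]; simp
    have h2 : ((-1 : ℝ) ^ n) * (-1) ^ n = 1 := by rw [← mul_pow]; simp
    have hpi := Real.pi_ne_zero
    field_simp
    rw [pow_add (-1 : ℝ) n k]
    linear_combination (-(sqrtCoeff n * sqrtCoeff (n + (k + 1)) * a ^ (2 * n + (k + 1)))) *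
      (h1 * (-1) ^ n * (-1) ^ n + h2)
  · rw [Real.norm_eq_abs]
    simp only [abs_mul, abs_pow, abs_neg, abs_one, one_pow, one_mul, sq_abs, abs_of_nonneg ha]
    have e1 := abs_sqrtCoeff_le_one n
    have e2 : Real.cos t ^ 2 ≤ 1 := Real.cos_sq_le_one t
    have e3 : |Real.sin t| ^ (2 * k) ≤ 1 := pow_le_one₀ (abs_nonneg _) (Real.abs_sin_le_one t)
    have e4 : a ^ (k + 1) ≤ 1 := pow_le_one₀ ha ha1.le
    have e5 : (a ^ 2 * Real.sin t ^ 2) ^ n ≤ (a ^ 2) ^ n := by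
      gcongr
      nlinarith [Real.sin_sq_le_one t, sq_nonneg a]
    calc _ ≤ 1 * 1 * 1 * (1 * (a ^ 2) ^ n) := by gcongr
      _ = _ := by ring

lemma ellipticK_integrand_continuous (ha : 0 ≤ a) (ha1 : a < 1) :
    Continuous fun t : ℝ => 1 / Real.sqrt (1 - a ^ 2 * Real.sin t ^ 2) :=
  Continuous.div (by fun_prop) (by fun_prop) fun t => (modulus_pos ha ha1 t).ne'

/-- Reduction of `∫ cos² √(1 - a² sin²)` to complete elliptic integrals: the integrand differs from
the one on the right by a multiple of the derivative of `sin cos √(1 - a² sin²)`. -/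
lemma symbolCoeff_one (ha : 0 < a) (ha1 : a < 1) :
    symbolCoeff a 1 = 2 / Real.pi *
      (((1 + a ^ 2) * ellipticE a - (1 - a ^ 2) * ellipticK a) / (3 * a)) := by
  set Δ : ℝ → ℝ := fun t => Real.sqrt (1 - a ^ 2 * Real.sin t ^ 2) with hΔ
  have hpos : ∀ t, 0 < Δ t := modulus_pos ha.le ha1
  have hsq : ∀ t, Δ t ^ 2 = 1 - a ^ 2 * Real.sin t ^ 2 := fun t =>
    Real.sq_sqrt (by linarith [sq_mul_sin_sq_lt_one ha.le ha1 t])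
  have hcont : Continuous Δ := by fun_prop
  have hd := hasDerivAt_modulus ha.le ha1
  have hG : ∀ t, HasDerivAt (fun t => Real.sin t * Real.cos t * Δ t)
      (3 * (Real.cos t ^ 2 * Δ t) -
        ((1 + a ^ 2) * Δ t - (1 - a ^ 2) * (1 / Δ t)) / a ^ 2) t := by
    intro t
    convert! ((Real.hasDerivAt_sin t).fun_mul (Real.hasDerivAt_cos t)).fun_mul (hd t) using 1
    change _ = _ * Δ t + _ * (_ / Δ t)
    have hp := (hpos t).ne'
    have h1 : Real.cos t ^ 2 = 1 - Real.sin t ^ 2 := Real.cos_sq' t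
    have h2 := hsq t
    field_simp
    ring_nf
    simp only [h1, h2]
    ring_nf
  have hK := ellipticK_integrand_continuous ha.le ha1
  have hint := intervalIntegral.integral_eq_sub_of_hasDerivAt (a := 0) (b := Real.pi / 2)
    (fun t _ => hG t) (Continuous.intervalIntegrable (by fun_prop) _ _)
  rw [intervalIntegral.integral_sub (Continuous.intervalIntegrable (by fun_prop) _ _)
      (Continuous.intervalIntegrable (by fun_prop) _ _), intervalIntegral.integral_const_mul,
      intervalIntegral.integral_div,
      intervalIntegral.integral_sub (Continuous.intervalIntegrable (by fun_prop) _ _)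
      (Continuous.intervalIntegrable (by fun_prop) _ _), intervalIntegral.integral_const_mul,
      intervalIntegral.integral_const_mul] at hint
  simp only [Real.cos_pi_div_two, Real.sin_zero, mul_zero, zero_mul, sub_zero] at hint
  have h0 := symbolCoeff_succ_eq_integral ha.le ha1 0
  simp only [pow_zero, one_mul, zero_add, pow_one, mul_zero, mul_one, mul_assoc] at h0
  rw [intervalIntegral.integral_const_mul] at h0
  rw [h0]
  change _ * (_ * ∫ t in (0 : ℝ)..(Real.pi / 2), Real.cos t ^ 2 * Δ t) = _
  congr 1
  change 3 * (∫ t in (0 : ℝ)..(Real.pi / 2), Real.cos t ^ 2 * Δ t) -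
    ((1 + a ^ 2) * ellipticE a - (1 - a ^ 2) * ellipticK a) / a ^ 2 = 0 at hint
  field_simp at hint ⊢
  linear_combination hint

/-- The series without its first term is `∫ a² cos² / (1 + √(1 - a² sin²))`, which reduces to
complete elliptic integrals by integrating the derivative of
`-a² sin cos / (1 + √(1 - a² sin²))`. -/
lemma symbolCoeff_zero (ha : 0 < a) (ha1 : a < 1) :
    symbolCoeff a 0 = 2 / Real.pi * (2 * ellipticE a - (1 - a ^ 2) * ellipticK a) := by
  set Δ : ℝ → ℝ := fun t => Real.sqrt (1 - a ^ 2 * Real.sin t ^ 2) with hΔ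
  have hpos : ∀ t, 0 < Δ t := modulus_pos ha.le ha1
  have hsq : ∀ t, Δ t ^ 2 = 1 - a ^ 2 * Real.sin t ^ 2 := fun t =>
    Real.sq_sqrt (by linarith [sq_mul_sin_sq_lt_one ha.le ha1 t])
  have hcont : Continuous Δ := by fun_prop
  have hd := hasDerivAt_modulus ha.le ha1
  have hK := ellipticK_integrand_continuous ha.le ha1
  have hG : ∀ t, HasDerivAt (fun t => -a ^ 2 * (Real.sin t * Real.cos t) / (1 + Δ t))
      (a ^ 2 * Real.cos t ^ 2 / (1 + Δ t) - (2 * Δ t - 1 - (1 - a ^ 2) * (1 / Δ t))) t := by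
    intro t
    have hp := hpos t
    convert! (((Real.hasDerivAt_sin t).fun_mul (Real.hasDerivAt_cos t)).const_mul (-a ^ 2)).fun_div
      ((hd t).const_add 1) (by change 1 + Δ t ≠ 0; positivity) using 1
    change _ = (_ * (1 + Δ t) - _ * (_ / Δ t)) / (1 + Δ t) ^ 2
    have h1 : Real.cos t ^ 2 = 1 - Real.sin t ^ 2 := Real.cos_sq' t
    have h2 := hsq t
    field_simp
    ring_nf
    have h3 : Δ t ^ 3 = (1 - a ^ 2 * Real.sin t ^ 2) * Δ t := by rw [← h2]; ring
    have h4 : Δ t ^ 4 = (1 - a ^ 2 * Real.sin t ^ 2) ^ 2 := by rw [← h2]; ring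
    simp only [h1, h2, h3, h4]
    ring_nf
  have hint := intervalIntegral.integral_eq_sub_of_hasDerivAt (a := 0) (b := Real.pi / 2)
    (fun t _ => hG t) (Continuous.intervalIntegrable (by
      have : Continuous fun t => a ^ 2 * Real.cos t ^ 2 / (1 + Δ t) :=
        Continuous.div (by fun_prop) (by fun_prop) fun t => by have := hpos t; positivity
      fun_prop) _ _)
  have hcq : Continuous fun t => a ^ 2 * Real.cos t ^ 2 / (1 + Δ t) :=
    Continuous.div (by fun_prop) (by fun_prop) fun t => by have := hpos t; positivity
  rw [intervalIntegral.integral_sub (hcq.intervalIntegrable _ _)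
      (Continuous.intervalIntegrable (by fun_prop) _ _),
      intervalIntegral.integral_sub (Continuous.intervalIntegrable (by fun_prop) _ _)
      (Continuous.intervalIntegrable (by fun_prop) _ _),
      intervalIntegral.integral_sub (Continuous.intervalIntegrable (by fun_prop) _ _)
      (Continuous.intervalIntegrable (by fun_prop) _ _), intervalIntegral.integral_const_mul,
      intervalIntegral.integral_const_mul] at hint
  simp only [Real.cos_pi_div_two, Real.sin_zero, mul_zero, zero_mul, sub_zero, zero_div,
    intervalIntegral.integral_const, smul_eq_mul, mul_one] at hint
  change _ - (2 * ellipticE a - _ - (1 - a ^ 2) * ellipticK a) = 0 at hint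
  -- termwise integration of the binomial series, shifted by one
  have hs : ∀ t, HasSum (fun n => a ^ 2 * Real.cos t ^ 2 * (sqrtCoeff (n + 1) *
      (-(a ^ 2 * Real.sin t ^ 2)) ^ n)) (a ^ 2 * Real.cos t ^ 2 / (1 + Δ t)) := fun t => by
    have hp := hpos t
    have h2 := hsq t
    rw [div_eq_mul_inv]
    refine HasSum.mul_left _ ?_
    by_cases h0 : Real.sin t = 0
    · have h1 : Δ t = 1 := by simp [hΔ, h0]
      convert! hasSum_ite_eq 0 (1 / 2 : ℝ) using 1
      · ext n
        rcases n with _ | n <;> simp [h0, sqrtCoeff_succ, sqrtCoeff_zero]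
      · rw [h1]; norm_num
    · have h := hasSum_sqrtCoeff_real (x := -(a ^ 2 * Real.sin t ^ 2)) (by
        rw [abs_neg, abs_of_nonneg (by positivity)]
        exact sq_mul_sin_sq_lt_one ha.le ha1 t)
      rw [← sub_eq_add_neg] at h
      have h3 := ((hasSum_nat_add_iff' 1).2 h).div_const (-(a ^ 2 * Real.sin t ^ 2))
      convert! h3 using 1
      · ext n
        field_simp
        ring
      · change _ = (Δ t - _) / _
        simp [sqrtCoeff_zero]
        field_simp
        linear_combination h2
  have h := hasSum_intervalIntegral_of_le 0 (Real.pi / 2) (B := fun n => (a ^ 2) ^ n)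
    (fun n => by fun_prop) (fun n t => ?_)
    (summable_geometric_of_lt_one (by positivity) (by nlinarith : a ^ 2 < 1)) hs
  · have h' := ((hasSum_nat_add_iff' 1).2 (hasSum_symbolCoeff ha.le ha1 0)).unique (by
      convert! h.mul_left (2 / Real.pi) using 2 with n
      have : ∀ t : ℝ, a ^ 2 * Real.cos t ^ 2 *
          (sqrtCoeff (n + 1) * (-(a ^ 2 * Real.sin t ^ 2)) ^ n) =
          (a ^ 2 * sqrtCoeff (n + 1) * (-1) ^ n * a ^ (2 * n)) *
            (Real.cos t ^ 2 * Real.sin t ^ (2 * n)) := by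
        intro t; rw [neg_pow (a ^ 2 * _), mul_pow, ← pow_mul, ← pow_mul]; ring
      simp_rw [this]
      rw [intervalIntegral.integral_const_mul, integral_cos_sq_mul_sin_pow]
      have h2 : ((-1 : ℝ) ^ n) * (-1) ^ n = 1 := by rw [← mul_pow]; simp
      have hpi := Real.pi_ne_zero
      field_simp
      linear_combination (-(sqrtCoeff (n + 1) ^ 2 * a ^ (2 * (n + 1)))) * h2)
    simp only [Finset.range_one, Finset.sum_singleton, sqrtCoeff_zero, mul_zero, add_zero,
      pow_zero, mul_one] at h'
    rw [sub_eq_iff_eq_add] at h'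
    rw [h', sub_eq_zero.1 hint]
    have hpi := Real.pi_ne_zero
    field_simp
    ring
  · rw [Real.norm_eq_abs]
    simp only [abs_mul, abs_pow, abs_neg, sq_abs, abs_of_nonneg ha.le]
    have e1 := abs_sqrtCoeff_le_one (n + 1)
    have e2 : Real.cos t ^ 2 ≤ 1 := Real.cos_sq_le_one t
    have e4 : a ^ 2 ≤ 1 := pow_le_one₀ ha.le ha1.le
    have e5 : (a ^ 2 * Real.sin t ^ 2) ^ n ≤ (a ^ 2) ^ n := by
      gcongr
      nlinarith [Real.sin_sq_le_one t, sq_nonneg a]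
    calc _ ≤ 1 * 1 * (1 * (a ^ 2) ^ n) := by gcongr
      _ = _ := by ring

end

/-! ### The Laurent splitting of `h` -/

/-- The Taylor coefficients of `f`: differences of Fourier coefficients of the symbol
`√(1 + a z) √(1 + a / z)`, coming from the factor `z - 1 / z` of `h`. -/
def mapCoeff (a C : ℝ) : ℕ → ℝ
  | 0 => 0
  | j + 1 => C * (symbolCoeff a j - symbolCoeff a (j + 2))

/-- The part of positive powers in the Laurent series of the symbol `√(1 + a z) √(1 + a / z)`. -/
def symbolTail (a : ℝ) (z : ℂ) : ℂ := ∑' k : ℕ, (symbolCoeff a (k + 1) : ℂ) * z ^ (k + 1)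

section

variable {a : ℝ}

lemma mul_norm_lt_one (ha : 0 < a) {z : ℂ} (hz : ‖z‖ < a⁻¹) : a * ‖z‖ < 1 := by
  calc a * ‖z‖ < a * a⁻¹ := by gcongr
    _ = 1 := mul_inv_cancel₀ ha.ne'

lemma hasSum_symbolTail (ha : 0 < a) (ha1 : a ≤ 1 / 2) {z : ℂ} (hz : ‖z‖ < a⁻¹) :
    HasSum (fun k : ℕ => (symbolCoeff a (k + 1) : ℂ) * z ^ (k + 1)) (symbolTail a z) := by
  refine (Summable.of_norm_bounded (g := fun k => 2 * (a * ‖z‖) * (a * ‖z‖) ^ k)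
    ((summable_geometric_of_lt_one (by positivity) (mul_norm_lt_one ha hz)).mul_left _)
    fun k => ?_).hasSum
  rw [norm_mul, norm_pow, Complex.norm_real, Real.norm_eq_abs]
  calc _ ≤ 2 * a ^ (k + 1) * ‖z‖ ^ (k + 1) := by gcongr; exact abs_symbolCoeff_le ha.le ha1 _
    _ = _ := by rw [mul_assoc, ← mul_pow]; ring

/-- `(m, n) ↦ (m - n, min m n)`: a pair of exponents is determined by the exponent of the product
`z ^ m * z⁻¹ ^ n` and a summation index for the Fourier coefficient. -/
def natProdEquivIntProdNat : ℕ × ℕ ≃ ℤ × ℕ where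
  toFun p := ((p.1 : ℤ) - p.2, min p.1 p.2)
  invFun q := (q.2 + q.1.toNat, q.2 + (-q.1).toNat)
  left_inv p := by
    ext
    · simp
      omega
    · simp
      omega
  right_inv q := by
    ext
    · simp
    · simp
      omega

/-- The Laurent series of the radical in `h`. For `a < |z| < 1/a` both `1 + a z` and `1 + a / z` lie
in the right half-plane, so the principal root of their product is the product of the principal
roots, and the two binomial series may be multiplied. -/
lemma symbol_eq (ha : 0 < a) (ha1 : a ≤ 1 / 2) {z : ℂ} (hz : a < ‖z‖) (hz' : ‖z‖ < a⁻¹) :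
    ((z + a) / z * (1 + a * z)) ^ (1 / 2 : ℂ) =
      symbolCoeff a 0 + symbolTail a z + symbolTail a z⁻¹ := by
  have hz0 : z ≠ 0 := by rintro rfl; simp at hz; linarith
  have hzi : ‖z⁻¹‖ < a⁻¹ := by rw [norm_inv]; gcongr
  have n1 : ‖(a : ℂ) * z‖ < 1 := by
    simpa [abs_of_pos ha] using mul_norm_lt_one ha hz'
  have n2 : ‖(a : ℂ) * z⁻¹‖ < 1 := by
    simpa [abs_of_pos ha] using mul_norm_lt_one ha hzi
  have hre : ∀ w : ℂ, ‖w‖ < 1 → 0 < (1 + w).re := fun w hw => by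
    have := neg_abs_le w.re
    have := abs_re_le_norm w
    simp; linarith
  have e1 : ((z + a) / z * (1 + a * z)) ^ (1 / 2 : ℂ) =
      (1 + a * z) ^ (1 / 2 : ℂ) * (1 + a * z⁻¹) ^ (1 / 2 : ℂ) := by
    rw [show (z + a) / z * (1 + a * z) = (1 + a * z) * (1 + a * z⁻¹) by field_simp]
    -- both arguments are less than `π / 2` in modulus, so the principal logarithms add up
    have a1 := Complex.abs_arg_lt_pi_div_two_iff.2 (Or.inl (hre _ n1))
    have a2 := Complex.abs_arg_lt_pi_div_two_iff.2 (Or.inl (hre _ n2))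
    rw [abs_lt] at a1 a2
    have b1 : (1 + a * z : ℂ) ≠ 0 := fun h => by have := hre _ n1; rw [h] at this; simp at this
    have b2 : (1 + a * z⁻¹ : ℂ) ≠ 0 := fun h => by have := hre _ n2; rw [h] at this; simp at this
    rw [cpow_def_of_ne_zero (mul_ne_zero b1 b2), cpow_def_of_ne_zero b1, cpow_def_of_ne_zero b2,
      Complex.log_mul b1 b2 ⟨by linarith, by linarith⟩, add_mul, Complex.exp_add]
  rw [e1]
  have hs := (hasSum_sqrtCoeff n1).mul (hasSum_sqrtCoeff n2) (by
    refine Summable.of_norm_bounded (g := fun p : ℕ × ℕ => ‖(a : ℂ) * z‖ ^ p.1 *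
      ‖(a : ℂ) * z⁻¹‖ ^ p.2) ?_ fun p => ?_
    · exact (summable_geometric_of_lt_one (norm_nonneg _) n1).mul_of_nonneg
        (summable_geometric_of_lt_one (norm_nonneg _) n2) (fun n => by positivity)
        (fun n => by positivity)
    · have h1 := abs_sqrtCoeff_le_one p.1
      have h2 := abs_sqrtCoeff_le_one p.2
      rw [norm_mul, norm_mul, norm_mul, norm_pow, norm_pow, Complex.norm_real, Complex.norm_real,
        Real.norm_eq_abs, Real.norm_eq_abs]
      calc _ ≤ 1 * ‖(a : ℂ) * z‖ ^ p.1 * (1 * ‖(a : ℂ) * z⁻¹‖ ^ p.2) := by gcongr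
        _ = _ := by ring)
  rw [← natProdEquivIntProdNat.symm.hasSum_iff] at hs
  have hk : ∀ k : ℤ, HasSum (fun n : ℕ => (((fun p : ℕ × ℕ => (sqrtCoeff p.1 : ℂ) *
      ((a : ℂ) * z) ^ p.1 * ((sqrtCoeff p.2 : ℂ) * ((a : ℂ) * z⁻¹) ^ p.2)) ∘
      natProdEquivIntProdNat.symm) (k, n))) ((symbolCoeff a k.natAbs : ℂ) * z ^ k) := by
    intro k
    have h := Complex.hasSum_ofReal.2 (hasSum_symbolCoeff ha.le (by linarith) k.natAbs)
    convert! h.mul_right (z ^ k) using 2 with n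
    rcases Int.eq_nat_or_neg k with ⟨m, rfl | rfl⟩
    · simp [natProdEquivIntProdNat]
      rw [mul_pow, mul_pow, inv_pow, pow_add z]
      field_simp
      ring
    · simp [natProdEquivIntProdNat]
      rw [mul_pow, mul_pow, inv_pow, pow_add z]
      field_simp
      ring
  have hs2 := (hs.prod_fiberwise hk)
  have h1 := hasSum_symbolTail ha ha1 hz'
  have h2 := hasSum_symbolTail ha ha1 hzi
  have h3 := HasSum.of_nat_of_neg_add_one (f := fun k : ℤ => (symbolCoeff a k.natAbs : ℂ) * z ^ k)
    (m := symbolCoeff a 0 + symbolTail a z) (m' := symbolTail a z⁻¹) (by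
      rw [← hasSum_nat_add_iff' 1]
      convert! h1 using 1
      simp) (by
      convert! h2 using 2 with n
      rw [inv_pow, ← zpow_natCast, ← zpow_neg]
      congr 2)
  exact hs2.unique h3

end

section

variable {a C : ℝ}

lemma abs_mapCoeff_succ_le (ha : 0 ≤ a) (ha1 : a ≤ 1 / 2) (hC : 0 ≤ C) (j : ℕ) :
    |mapCoeff a C (j + 1)| ≤ 4 * C * a ^ j := by
  rw [mapCoeff, abs_mul, abs_of_nonneg hC]
  have h1 := abs_symbolCoeff_le ha ha1 j
  have h2 := abs_symbolCoeff_le ha ha1 (j + 2)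
  have h3 : a ^ (j + 2) ≤ a ^ j := pow_le_pow_of_le_one ha (by linarith) (by omega)
  calc _ ≤ C * (2 * a ^ j + 2 * a ^ j) := by
        gcongr; exact (abs_sub _ _).trans (by linarith)
    _ = _ := by ring

lemma summable_mapCoeff_mul_pow (ha : 0 < a) (ha1 : a ≤ 1 / 2) (hC : 0 ≤ C) {r : ℝ} (hr : 0 ≤ r)
    (hr' : a * r < 1) : Summable fun j : ℕ => |mapCoeff a C j| * r ^ j := by
  rw [← summable_nat_add_iff 1]
  refine Summable.of_nonneg_of_le (fun j => by positivity) (fun j => ?_)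
    ((summable_geometric_of_lt_one (by positivity) hr').mul_left (4 * C * r))
  calc _ ≤ 4 * C * a ^ j * r ^ (j + 1) := by gcongr; exact abs_mapCoeff_succ_le ha.le ha1 hC j
    _ = _ := by rw [mul_pow]; ring

lemma summable_abs_mapCoeff (ha : 0 < a) (ha1 : a ≤ 1 / 2) (hC : 0 ≤ C) :
    Summable fun j : ℕ => |mapCoeff a C j| := by
  simpa using summable_mapCoeff_mul_pow ha ha1 hC zero_le_one (by linarith)

/-- The sum of the Taylor series of `f` in terms of the symbol. -/
lemma hasSum_mapCoeff (ha : 0 < a) (ha1 : a ≤ 1 / 2) {z : ℂ} (hz0 : z ≠ 0)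
    (hz : ‖z‖ < a⁻¹) : HasSum (fun j : ℕ => (mapCoeff a C j : ℂ) * z ^ j)
      (C * (symbolCoeff a 1 + symbolCoeff a 0 * z + (z - z⁻¹) * symbolTail a z)) := by
  have h := hasSum_symbolTail ha ha1 hz
  have h1 : HasSum (fun k : ℕ => (symbolCoeff a k : ℂ) * z ^ k)
      (symbolCoeff a 0 + symbolTail a z) := by
    rw [← hasSum_nat_add_iff' 1]
    simpa using h
  have h2 := (hasSum_nat_add_iff' 1).2 h
  rw [← hasSum_nat_add_iff' 1]
  convert! ((h1.mul_right z).sub (h2.mul_right z⁻¹)).mul_left (C : ℂ) using 1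
  · ext n
    simp only [mapCoeff]
    push_cast
    rw [show n + 1 + 1 = n + 2 from rfl, pow_succ z (n + 1), pow_succ z n]
    field_simp
  · simp only [Finset.range_one, Finset.sum_singleton, mapCoeff, ofReal_zero,
      sub_zero, pow_zero, mul_one, zero_add, pow_one]
    field_simp
    ring

lemma h_eq_tsum_sub (ha : 0 < a) (ha1 : a ≤ 1 / 2) {z : ℂ} (hz : a < ‖z‖)
    (hz' : ‖z‖ < a⁻¹) : h a C z =
      ∑' j : ℕ, (mapCoeff a C j : ℂ) * z ^ j - ∑' j : ℕ, (mapCoeff a C j : ℂ) * z⁻¹ ^ j := by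
  have hz0 : z ≠ 0 := by rintro rfl; simp at hz; linarith
  have hzi : ‖z⁻¹‖ < a⁻¹ := by rw [norm_inv]; gcongr
  rw [(hasSum_mapCoeff ha ha1 hz0 hz').tsum_eq,
    (hasSum_mapCoeff ha ha1 (inv_ne_zero hz0) hzi).tsum_eq, h, symbol_eq ha ha1 hz hz']
  field_simp
  ring

lemma circleIntegral_zpow (n : ℤ) :
    (∮ z in C(0, 1), z ^ n) = if n = -1 then 2 * Real.pi * I else 0 := by
  split_ifs with h
  · subst h
    simpa using circleIntegral.integral_sub_center_inv 0 one_ne_zero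
  · simpa using circleIntegral.integral_sub_zpow_of_ne h 0 0 1

/-- The contour integrals defining the Laurent coefficients, evaluated termwise on the absolutely
convergent series of `h`. -/
lemma laurentCoeff_eq (ha : 0 < a) (ha1 : a ≤ 1 / 2) (hC : 0 ≤ C) (j : ℕ) :
    laurentCoeff a C (j + 1) = mapCoeff a C (j + 1) := by
  have hai : (1 : ℝ) < a⁻¹ := (one_lt_inv₀ ha).2 (by linarith)
  have hkey : HasSum (fun m : ℕ => ∮ z in C(0, 1), z ^ (-((j : ℤ) + 1) - 1) *
      ((mapCoeff a C m : ℂ) * z ^ m - (mapCoeff a C m : ℂ) * z⁻¹ ^ m))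
      (∮ z in C(0, 1), z ^ (-((j : ℤ) + 1) - 1) * h a C z) := by
    unfold circleIntegral
    have hn : ∀ θ, ‖circleMap 0 1 θ‖ = 1 := fun θ => by simp
    have hne : ∀ θ, circleMap 0 1 θ ≠ 0 := fun θ => circleMap_ne_center one_ne_zero
    refine hasSum_intervalIntegral_of_le (B := fun m => 2 * |mapCoeff a C m|) _ _ (fun m => ?_)
      (fun m θ => ?_) ((summable_abs_mapCoeff ha ha1 hC).mul_left 2) (fun θ => ?_)
    · simp only [deriv_circleMap, smul_eq_mul]
      have h1 : Continuous (fun θ => circleMap 0 1 θ ^ (-((j : ℤ) + 1) - 1)) :=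
        Continuous.zpow₀ (by fun_prop) _ fun θ => Or.inl (hne θ)
      have h2 : Continuous (fun θ => (circleMap 0 1 θ)⁻¹) :=
        Continuous.inv₀ (by fun_prop) hne
      fun_prop
    · rw [deriv_circleMap, norm_smul, norm_mul, norm_mul, norm_zpow, hn, norm_I, one_zpow,
        one_mul, one_mul, one_mul]
      refine (norm_sub_le _ _).trans ?_
      simp only [norm_mul, norm_pow, norm_inv, hn, Complex.norm_real, Real.norm_eq_abs]
      simp; linarith
    · refine HasSum.const_smul _ (HasSum.mul_left _ ?_)
      rw [h_eq_tsum_sub ha ha1 (by rw [hn]; linarith) (by rwa [hn])]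
      have hs : ∀ w : ℂ, w ≠ 0 → ‖w‖ < a⁻¹ → HasSum (fun m : ℕ => (mapCoeff a C m : ℂ) * w ^ m)
          (∑' m : ℕ, (mapCoeff a C m : ℂ) * w ^ m) := fun w h0 hw =>
        (hasSum_mapCoeff ha ha1 h0 hw).summable.hasSum
      exact (hs _ (hne θ) (by rwa [hn])).sub (hs _ (inv_ne_zero (hne θ)) (by
        rw [norm_inv, hn]; simpa using hai))
  have hterm : ∀ m : ℕ, (∮ z in C(0, 1), z ^ (-((j : ℤ) + 1) - 1) *
      ((mapCoeff a C m : ℂ) * z ^ m - (mapCoeff a C m : ℂ) * z⁻¹ ^ m)) =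
      if m = j + 1 then 2 * Real.pi * I * (mapCoeff a C (j + 1) : ℂ) else 0 := by
    intro m
    have : (∮ z in C(0, 1), z ^ (-((j : ℤ) + 1) - 1) *
      ((mapCoeff a C m : ℂ) * z ^ m - (mapCoeff a C m : ℂ) * z⁻¹ ^ m)) =
      ∮ z in C(0, 1), ((mapCoeff a C m : ℂ) * z ^ ((m : ℤ) - j - 2) -
        (mapCoeff a C m : ℂ) * z ^ (-(m : ℤ) - j - 2)) := by
      refine circleIntegral.integral_congr zero_le_one fun z hz => ?_
      have hz0 : z ≠ 0 := by rintro rfl; simp at hz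
      rw [show (m : ℤ) - j - 2 = (-((j : ℤ) + 1) - 1) + m by ring,
        show -(m : ℤ) - j - 2 = (-((j : ℤ) + 1) - 1) + -m by ring, zpow_add₀ hz0,
        zpow_add₀ hz0, zpow_neg, zpow_natCast, inv_pow]
      ring
    have hci : ∀ n : ℤ, CircleIntegrable (fun z : ℂ => (mapCoeff a C m : ℂ) * z ^ n) 0 1 := by
      intro n
      refine ContinuousOn.circleIntegrable zero_le_one ?_
      refine continuousOn_const.mul (ContinuousOn.zpow₀ continuousOn_id _ fun z hz => ?_)
      left; rintro rfl; simp at hz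
    rw [this, circleIntegral.integral_sub (hci _) (hci _), circleIntegral.integral_const_mul,
      circleIntegral.integral_const_mul, circleIntegral_zpow, circleIntegral_zpow]
    rw [if_neg (show ¬(-(m : ℤ) - j - 2 = -1) by omega)]
    by_cases hm : m = j + 1
    · subst hm
      rw [if_pos (by push_cast; ring), if_pos rfl]; ring
    · rw [if_neg (by omega), if_neg hm]; ring
  rw [laurentCoeff, ← hkey.tsum_eq]
  simp_rw [hterm]
  rw [tsum_ite_eq]
  have := Real.pi_ne_zero
  field_simp

lemma f_eq_tsum (ha : 0 < a) (ha1 : a ≤ 1 / 2) (hC : 0 ≤ C) {z : ℂ} (hz : ‖z‖ < a⁻¹) :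
    f a C z = ∑' j : ℕ, (mapCoeff a C j : ℂ) * z ^ j := by
  have hs : Summable fun j : ℕ => (mapCoeff a C j : ℂ) * z ^ j := by
    refine Summable.of_norm ?_
    simpa using summable_mapCoeff_mul_pow ha ha1 hC (norm_nonneg z) (mul_norm_lt_one ha hz)
  rw [hs.tsum_eq_zero_add, f]
  simp [laurentCoeff_eq ha ha1 hC, mapCoeff]

lemma hasSum_f (ha : 0 < a) (ha1 : a ≤ 1 / 2) (hC : 0 ≤ C) {z : ℂ} (hz : ‖z‖ < a⁻¹) :
    HasSum (fun j : ℕ => (mapCoeff a C j : ℂ) * z ^ j) (f a C z) := by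
  rw [f_eq_tsum ha ha1 hC hz]
  refine (Summable.of_norm ?_).hasSum
  simpa using summable_mapCoeff_mul_pow ha ha1 hC (norm_nonneg z) (mul_norm_lt_one ha hz)

lemma h_eq_f_sub_f_inv (ha : 0 < a) (ha1 : a ≤ 1 / 2) (hC : 0 ≤ C) {z : ℂ} (hz : a < ‖z‖)
    (hz' : ‖z‖ < a⁻¹) : h a C z = f a C z - f a C z⁻¹ := by
  have hzi : ‖z⁻¹‖ < a⁻¹ := by rw [norm_inv]; gcongr
  rw [h_eq_tsum_sub ha ha1 hz hz', f_eq_tsum ha ha1 hC hz', f_eq_tsum ha ha1 hC hzi]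

/-- The Taylor series of `f'`. -/
def fDeriv (a C : ℝ) (z : ℂ) : ℂ := ∑' j : ℕ, ((j + 1) * mapCoeff a C (j + 1) : ℂ) * z ^ j

lemma summable_succ_mul_mapCoeff (ha : 0 < a) (ha1 : a ≤ 1 / 2) (hC : 0 ≤ C) {r : ℝ} (hr : 0 ≤ r)
    (hr' : a * r < 1) : Summable fun j : ℕ => (j + 1) * |mapCoeff a C (j + 1)| * r ^ j := by
  have h1 := (summable_pow_mul_geometric_of_norm_lt_one 1 (r := a * r)
    (by rwa [Real.norm_of_nonneg (by positivity)])).add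
    (summable_geometric_of_lt_one (by positivity) hr')
  refine Summable.of_nonneg_of_le (fun j => by positivity) (fun j => ?_) (h1.mul_left (4 * C))
  calc _ ≤ (j + 1) * (4 * C * a ^ j) * r ^ j := by
        gcongr; exact abs_mapCoeff_succ_le ha.le ha1 hC j
    _ = _ := by rw [mul_pow]; ring

lemma hasSum_fDeriv (ha : 0 < a) (ha1 : a ≤ 1 / 2) (hC : 0 ≤ C) {z : ℂ} (hz : ‖z‖ < a⁻¹) :
    HasSum (fun j : ℕ => ((j + 1) * mapCoeff a C (j + 1) : ℂ) * z ^ j) (fDeriv a C z) := by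
  refine (Summable.of_norm ?_).hasSum
  convert! summable_succ_mul_mapCoeff ha ha1 hC (norm_nonneg z) (mul_norm_lt_one ha hz) using 2
    with j
  rw [norm_mul, norm_mul, norm_pow, Complex.norm_real, Real.norm_eq_abs,
    show (j : ℂ) + 1 = ((j + 1 : ℕ) : ℂ) by push_cast; rfl, Complex.norm_natCast]
  push_cast; rfl

lemma hasDerivAt_f (ha : 0 < a) (ha1 : a ≤ 1 / 2) (hC : 0 ≤ C) {z : ℂ} (hz : ‖z‖ < a⁻¹) :
    HasDerivAt (f a C) (fDeriv a C z) z := by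
  obtain ⟨r, hzr, hr⟩ := exists_between hz
  have hr0 : 0 ≤ r := (norm_nonneg z).trans hzr.le
  have har : a * r < 1 := by
    have := mul_norm_lt_one ha (z := (r : ℂ)) (by simpa [abs_of_nonneg hr0] using hr)
    simpa [abs_of_nonneg hr0] using this
  have h := hasDerivAt_tsum_of_isPreconnected (t := Metric.ball (0 : ℂ) r)
    (g := fun (j : ℕ) z => (mapCoeff a C (j + 1) : ℂ) * z ^ (j + 1))
    (g' := fun (j : ℕ) z => ((j + 1) * mapCoeff a C (j + 1) : ℂ) * z ^ j) (y₀ := z) (y := z)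
    (summable_succ_mul_mapCoeff ha ha1 hC hr0 har) Metric.isOpen_ball
    (convex_ball _ _).isPreconnected (fun j y _ => ?_) (fun j y hy => ?_) (by simpa using hzr)
    ?_ (by simpa using hzr)
  · refine h.congr_of_eventuallyEq ?_
    filter_upwards [Metric.isOpen_ball.mem_nhds (show z ∈ Metric.ball (0 : ℂ) r by simpa)] with w hw
    have hw' : ‖w‖ < a⁻¹ := (by simpa using hw : ‖w‖ < r).trans hr
    rw [f_eq_tsum ha ha1 hC hw', (hasSum_f ha ha1 hC hw').summable.tsum_eq_zero_add]
    simp [mapCoeff]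
  · convert! (hasDerivAt_pow (j + 1) y).const_mul (mapCoeff a C (j + 1) : ℂ) using 1
    push_cast
    ring
  · rw [norm_mul, norm_mul, norm_pow, Complex.norm_real, Real.norm_eq_abs,
      show (j : ℂ) + 1 = ((j + 1 : ℕ) : ℂ) by push_cast; rfl, Complex.norm_natCast]
    push_cast
    gcongr
    simpa using (Metric.mem_ball.1 hy).le
  · exact ((hasSum_nat_add_iff' 1).2 (hasSum_f ha ha1 hC hz)).summable

lemma f_analyticOnNhd (ha : 0 < a) (ha1 : a ≤ 1 / 2) (hC : 0 ≤ C) :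
    AnalyticOnNhd ℂ (f a C) (Metric.ball 0 a⁻¹) :=
  DifferentiableOn.analyticOnNhd (fun _ hz => (hasDerivAt_f ha ha1 hC
    (by simpa using hz)).differentiableAt.differentiableWithinAt) Metric.isOpen_ball

/-- The boundary values of `f` through elliptic integrals: the kernel `1 / (1 + a w sin²)` sums
the series `symbolTail`, and a partial fraction decomposition in `sin²` isolates `Π`. -/
lemma profile_eq_f (ha : 0 < a) (ha1 : a ≤ 1 / 2) (hC : 0 ≤ C) {w : ℂ} (hw : ‖w‖ = 1) :
    profile a C w = f a C w := by
  have hw0 : w ≠ 0 := by rintro rfl; simp at hw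
  have hai : (1 : ℝ) < a⁻¹ := (one_lt_inv₀ ha).2 (by linarith)
  have ha1' : a < 1 := by linarith
  rw [(hasSum_f ha ha1 hC (by rwa [hw])).unique (hasSum_mapCoeff ha ha1 hw0 (by rwa [hw]))]
  set Δ : ℝ → ℝ := fun t => Real.sqrt (1 - a ^ 2 * Real.sin t ^ 2) with hΔ
  have hpos : ∀ t, 0 < Δ t := modulus_pos ha.le ha1'
  have hsq : ∀ t, Δ t ^ 2 = 1 - a ^ 2 * Real.sin t ^ 2 := fun t =>
    Real.sq_sqrt (by linarith [sq_mul_sin_sq_lt_one ha.le ha1' t])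
  have hcont : Continuous Δ := by fun_prop
  have hcontC : Continuous fun t => (Δ t : ℂ) := by fun_prop
  have hn : ∀ t : ℝ, ‖-((a : ℂ) * w * (Real.sin t : ℂ) ^ 2)‖ ≤ a := fun t => by
    rw [norm_neg, norm_mul, norm_mul, hw, norm_pow, Complex.norm_real, Complex.norm_real,
      Real.norm_eq_abs, Real.norm_eq_abs, sq_abs, abs_of_pos ha]
    nlinarith [Real.sin_sq_le_one t]
  have hne : ∀ t : ℝ, 1 + (a : ℂ) * w * (Real.sin t : ℂ) ^ 2 ≠ 0 := fun t h => by
    have h1 := hn t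
    rw [show -((a : ℂ) * w * (Real.sin t : ℂ) ^ 2) = 1 by linear_combination -h] at h1
    simp at h1; linarith
  have hcP : Continuous fun t : ℝ =>
      1 / ((1 + (a : ℂ) * w * (Real.sin t : ℂ) ^ 2) * (Δ t : ℂ)) := by
    refine Continuous.div (by fun_prop) (by fun_prop) fun t => mul_ne_zero (hne t) ?_
    exact_mod_cast (hpos t).ne'
  have hcK : Continuous fun t : ℝ => ((1 / Δ t : ℝ) : ℂ) :=
    Complex.continuous_ofReal.comp (ellipticK_integrand_continuous ha.le ha1')
  -- the integral representation of the tail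
  have hs : ∀ t : ℝ, HasSum (fun k : ℕ => ((a : ℂ) * w * (Real.cos t : ℂ) ^ 2 * (Δ t : ℂ)) *
      (-((a : ℂ) * w * (Real.sin t : ℂ) ^ 2)) ^ k)
      (((1 + a * w) * (w + a) / w) * (1 / ((1 + (a : ℂ) * w * (Real.sin t : ℂ) ^ 2) * (Δ t : ℂ)))
        - a * (1 + a * w) / w * ((1 / Δ t : ℝ) : ℂ) - (Δ t : ℂ)) := fun t => by
    have h := (hasSum_geometric_of_norm_lt_one ((hn t).trans_lt ha1')).mul_left
      ((a : ℂ) * w * (Real.cos t : ℂ) ^ 2 * (Δ t : ℂ))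
    convert! h using 1
    have h1 : (Real.cos t : ℂ) ^ 2 = 1 - (Real.sin t : ℂ) ^ 2 := by
      exact_mod_cast congrArg (Complex.ofReal) (Real.cos_sq' t)
    have h2 : (Δ t : ℂ) ^ 2 = 1 - (a : ℂ) ^ 2 * (Real.sin t : ℂ) ^ 2 := by
      exact_mod_cast congrArg (Complex.ofReal) (hsq t)
    have h3 : (Δ t : ℂ) ≠ 0 := by exact_mod_cast (hpos t).ne'
    have h4 := hne t
    rw [h1, sub_neg_eq_add]
    rw [Complex.ofReal_div, Complex.ofReal_one]
    field_simp
    rw [h2]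
    ring
  have h := hasSum_intervalIntegral_of_le 0 (Real.pi / 2) (B := fun n => a * a ^ n)
    (fun n => by fun_prop) (fun n t => ?_)
    ((summable_geometric_of_lt_one ha.le ha1').mul_left a) hs
  · have htail : symbolTail a w = 2 / Real.pi * _ :=
      (hasSum_symbolTail ha ha1 (by rwa [hw])).unique (by
        convert! h.mul_left (2 / Real.pi : ℂ) using 2 with k
        rw [symbolCoeff_succ_eq_integral ha.le ha1']
        push_cast
        rw [mul_assoc, ← intervalIntegral.integral_ofReal, ← intervalIntegral.integral_mul_const]
        congr 1
        refine intervalIntegral.integral_congr fun t _ => ?_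
        rw [neg_pow ((a : ℂ) * w * _), mul_pow, mul_pow, ← pow_mul]
        push_cast
        ring)
    rw [intervalIntegral.integral_sub (Continuous.intervalIntegrable (by fun_prop) _ _)
      (Continuous.intervalIntegrable (by fun_prop) _ _),
      intervalIntegral.integral_sub (Continuous.intervalIntegrable (by fun_prop) _ _)
      (Continuous.intervalIntegrable (by fun_prop) _ _), intervalIntegral.integral_const_mul,
      intervalIntegral.integral_const_mul, intervalIntegral.integral_ofReal,
      intervalIntegral.integral_ofReal] at htail
    have hPi : (∫ t in (0 : ℝ)..(Real.pi / 2),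
        1 / ((1 + (a : ℂ) * w * (Real.sin t : ℂ) ^ 2) * (Δ t : ℂ))) = ellipticPi (-(a * w)) a := by
      refine intervalIntegral.integral_congr fun t _ => ?_
      simp only [neg_mul, sub_neg_eq_add, hΔ]
    rw [hPi] at htail
    change symbolTail a w = 2 / Real.pi * ((1 + a * w) * (w + a) / w * ellipticPi (-(a * w)) a -
      a * (1 + a * w) / w * (ellipticK a : ℂ) - (ellipticE a : ℂ)) at htail
    rw [htail, symbolCoeff_one ha ha1', symbolCoeff_zero ha ha1', profile]
    have hpi : (Real.pi : ℂ) ≠ 0 := by exact_mod_cast Real.pi_ne_zero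
    have hac : (a : ℂ) ≠ 0 := by exact_mod_cast ha.ne'
    push_cast
    field_simp
  · rw [norm_mul, norm_pow]
    refine mul_le_mul ?_ (pow_le_pow_left₀ (norm_nonneg _) (hn t) n) (by positivity) ha.le
    rw [norm_mul, norm_mul, norm_mul, hw, norm_pow, Complex.norm_real, Complex.norm_real,
      Complex.norm_real, Real.norm_eq_abs, Real.norm_eq_abs, Real.norm_eq_abs, sq_abs,
      abs_of_pos ha, abs_of_pos (hpos t)]
    have e2 : Real.cos t ^ 2 ≤ 1 := Real.cos_sq_le_one t
    have e3 : Δ t ≤ 1 := Real.sqrt_le_one.2 (by nlinarith [sq_nonneg (a * Real.sin t)])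
    calc _ ≤ a * 1 * 1 * 1 := by gcongr
      _ = a := by ring

end

/-! ### The planar domain and its body of revolution -/

section

variable {a C : ℝ}

lemma mapCoeff_one_ge (ha : 0 < a) (ha1 : a ≤ 1 / 100) (hC : 0 < C) :
    9 / 10 * C ≤ mapCoeff a C 1 := by
  have h1 := one_le_symbolCoeff_zero ha.le (by linarith)
  have h2 := (abs_le.1 (abs_symbolCoeff_le ha.le (by linarith) 2)).2
  rw [mapCoeff, zero_add, mul_comm]
  gcongr
  nlinarith

lemma mapCoeff_one_pos (ha : 0 < a) (ha1 : a ≤ 1 / 100) (hC : 0 < C) : 0 < mapCoeff a C 1 :=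
  lt_of_lt_of_le (by positivity) (mapCoeff_one_ge ha ha1 hC)

lemma summable_mapCoeff_tail (ha : 0 < a) (ha1 : a ≤ 1 / 100) (hC : 0 < C) :
    Summable fun j : ℕ => ((j : ℝ) + 2) * |mapCoeff a C (j + 2)| := by
  have h := (summable_nat_add_iff 1).2
    (summable_succ_mul_mapCoeff ha (by linarith) hC.le zero_le_one (by linarith))
  convert! h using 2 with j
  push_cast
  ring_nf

/-- For small `a` the linear term of the Taylor series of `f` dominates the others. -/
lemma tsum_mapCoeff_tail_le (ha : 0 < a) (ha1 : a ≤ 1 / 100) (hC : 0 < C) :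
    ∑' j : ℕ, ((j : ℝ) + 2) * |mapCoeff a C (j + 2)| ≤ mapCoeff a C 1 / 2 := by
  have hs : Summable fun j : ℕ => 8 * C * a * (2 * a) ^ j :=
    (summable_geometric_of_lt_one (by positivity) (by linarith)).mul_left _
  calc _ ≤ ∑' j : ℕ, 8 * C * a * (2 * a) ^ j := by
        refine (summable_mapCoeff_tail ha ha1 hC).tsum_le_tsum (fun j => ?_) hs
        have h1 : ((j : ℝ) + 2) ≤ 2 * 2 ^ j := by
          have : j + 2 ≤ 2 * 2 ^ j := by
            have := Nat.lt_two_pow_self (n := j)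
            rcases Nat.eq_zero_or_pos j with rfl | hj
            · simp
            · omega
          exact_mod_cast this
        calc _ ≤ (2 * 2 ^ j) * (4 * C * a ^ (j + 1)) := by
              gcongr; exact abs_mapCoeff_succ_le ha.le (by linarith) hC.le (j + 1)
          _ = _ := by rw [mul_pow]; ring
    _ = 8 * C * a * (1 - 2 * a)⁻¹ := by
        rw [tsum_mul_left, tsum_geometric_of_lt_one (by positivity) (by linarith)]
    _ ≤ _ := by
        have h1 := mapCoeff_one_ge ha ha1 hC
        rw [← div_eq_mul_inv, div_le_iff₀ (by linarith)]
        nlinarith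

lemma norm_pow_sub_pow_le {z w : ℂ} (hz : ‖z‖ ≤ 1) (hw : ‖w‖ ≤ 1) (n : ℕ) :
    ‖z ^ n - w ^ n‖ ≤ n * ‖z - w‖ := by
  induction n with
  | zero => simp
  | succ n ih =>
    rw [show z ^ (n + 1) - w ^ (n + 1) = z * (z ^ n - w ^ n) + (z - w) * w ^ n by ring]
    refine (norm_add_le _ _).trans ?_
    rw [norm_mul, norm_mul, norm_pow]
    have h1 : ‖w‖ ^ n ≤ 1 := pow_le_one₀ (norm_nonneg _) hw
    push_cast
    nlinarith [norm_nonneg (z - w), norm_nonneg (z ^ n - w ^ n), norm_nonneg z]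

lemma lt_inv_of_le_one (ha : 0 < a) (ha1 : a ≤ 1 / 100) {r : ℝ} (hr : r ≤ 1) : r < a⁻¹ :=
  hr.trans_lt ((one_lt_inv₀ ha).2 (by linarith))

/-- In the closed unit disk the difference quotients of `f` stay in the disk of radius `c₁ / 2`
about `c₁`; injectivity, and the sign of `Im f`, follow. -/
lemma norm_f_sub_f_sub_le (ha : 0 < a) (ha1 : a ≤ 1 / 100) (hC : 0 < C) {z w : ℂ}
    (hz : ‖z‖ ≤ 1) (hw : ‖w‖ ≤ 1) :
    ‖f a C z - f a C w - mapCoeff a C 1 * (z - w)‖ ≤ mapCoeff a C 1 / 2 * ‖z - w‖ := by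
  have h1 := (hasSum_nat_add_iff' 2).2 ((hasSum_f ha (by linarith) hC.le
    (lt_inv_of_le_one ha ha1 hz)).sub
    (hasSum_f ha (by linarith) hC.le (lt_inv_of_le_one ha ha1 hw)))
  simp only [Finset.sum_range_succ, Finset.range_zero, Finset.sum_empty, pow_zero, sub_self,
    zero_add, pow_one, mul_zero, ← mul_sub] at h1
  rw [← h1.tsum_eq]
  refine (tsum_of_norm_bounded ((summable_mapCoeff_tail ha ha1 hC).hasSum.mul_right ‖z - w‖)
    fun j => ?_).trans (by gcongr; exact tsum_mapCoeff_tail_le ha ha1 hC)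
  rw [norm_mul, Complex.norm_real, Real.norm_eq_abs]
  have := norm_pow_sub_pow_le hz hw (j + 2)
  push_cast at this
  calc _ ≤ |mapCoeff a C (j + 2)| * ((j + 2) * ‖z - w‖) := by gcongr
    _ = _ := by ring

lemma f_injOn (ha : 0 < a) (ha1 : a ≤ 1 / 100) (hC : 0 < C) :
    Set.InjOn (f a C) (Metric.closedBall 0 1) := by
  intro z hz w hw h
  have h1 := norm_f_sub_f_sub_le ha ha1 hC (by simpa using hz : ‖z‖ ≤ 1) (by simpa using hw)
  have hc := mapCoeff_one_pos ha ha1 hC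
  rw [h, sub_self, zero_sub, norm_neg, norm_mul, Complex.norm_real, Real.norm_eq_abs,
    abs_of_pos hc] at h1
  have : ‖z - w‖ ≤ 0 := by nlinarith [norm_nonneg (z - w)]
  exact sub_eq_zero.1 (norm_le_zero_iff.1 this)

lemma f_conj (ha : 0 < a) (ha1 : a ≤ 1 / 2) (hC : 0 ≤ C) {z : ℂ} (hz : ‖z‖ < a⁻¹) :
    f a C (starRingEnd ℂ z) = starRingEnd ℂ (f a C z) := by
  have h1 := hasSum_f ha ha1 hC (z := starRingEnd ℂ z) (by simpa using hz)
  have h2 := (hasSum_f ha ha1 hC hz).map (starRingEnd ℂ) Complex.continuous_conj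
  refine h1.unique ?_
  convert! h2 using 2 with j
  simp

lemma abs_im_f_sub_le (ha : 0 < a) (ha1 : a ≤ 1 / 100) (hC : 0 < C) {z : ℂ} (hz : ‖z‖ ≤ 1) :
    |(f a C z).im - mapCoeff a C 1 * z.im| ≤ mapCoeff a C 1 / 2 * |z.im| := by
  have h := norm_f_sub_f_sub_le ha ha1 hC hz (w := starRingEnd ℂ z) (by simpa using hz)
  rw [f_conj ha (by linarith) hC.le (lt_inv_of_le_one ha ha1 hz), Complex.sub_conj,
    Complex.sub_conj, show ((2 * (f a C z).im : ℝ) : ℂ) * I -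
      mapCoeff a C 1 * (((2 * z.im : ℝ) : ℂ) * I) =
      ((2 * ((f a C z).im - mapCoeff a C 1 * z.im) : ℝ) : ℂ) * I by push_cast; ring] at h
  simp only [norm_mul, Complex.norm_real, Real.norm_eq_abs, norm_I, abs_two] at h
  linarith

lemma norm_fDeriv_sub_le (ha : 0 < a) (ha1 : a ≤ 1 / 100) (hC : 0 < C) {z : ℂ} (hz : ‖z‖ ≤ 1) :
    ‖fDeriv a C z - mapCoeff a C 1‖ ≤ mapCoeff a C 1 / 2 := by
  have h1 := (hasSum_nat_add_iff' 1).2 (hasSum_fDeriv ha (by linarith) hC.le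
    (lt_inv_of_le_one ha ha1 hz))
  simp only [Finset.range_one, Finset.sum_singleton, Nat.cast_zero, zero_add, one_mul, pow_zero,
    mul_one] at h1
  rw [← h1.tsum_eq]
  refine (tsum_of_norm_bounded (summable_mapCoeff_tail ha ha1 hC).hasSum
    fun j => ?_).trans (tsum_mapCoeff_tail_le ha ha1 hC)
  rw [norm_mul, norm_mul, norm_pow, Complex.norm_real, Real.norm_eq_abs,
    show ((j + 1 : ℕ) : ℂ) + 1 = ((j + 2 : ℕ) : ℂ) by push_cast; ring, Complex.norm_natCast]
  push_cast
  exact mul_le_of_le_one_right (by positivity) (pow_le_one₀ (norm_nonneg _) hz)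

lemma fDeriv_ne_zero (ha : 0 < a) (ha1 : a ≤ 1 / 100) (hC : 0 < C) {z : ℂ} (hz : ‖z‖ ≤ 1) :
    fDeriv a C z ≠ 0 := fun h => by
  have h1 := norm_fDeriv_sub_le ha ha1 hC hz
  have hc := mapCoeff_one_pos ha ha1 hC
  rw [h, zero_sub, norm_neg, Complex.norm_real, Real.norm_eq_abs, abs_of_pos hc] at h1
  linarith

lemma f_zero (ha : 0 < a) (ha1 : a ≤ 1 / 2) (hC : 0 ≤ C) : f a C 0 = 0 := by
  rw [f_eq_tsum ha ha1 hC (by simpa), tsum_eq_single 0 (by intro j hj; simp [hj])]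
  simp [mapCoeff]

lemma im_f_nonneg_iff (ha : 0 < a) (ha1 : a ≤ 1 / 100) (hC : 0 < C) {z : ℂ} (hz : ‖z‖ ≤ 1) :
    0 ≤ (f a C z).im ↔ 0 ≤ z.im := by
  have h := abs_le.1 (abs_im_f_sub_le ha ha1 hC hz)
  have hc := mapCoeff_one_pos ha ha1 hC
  constructor
  · intro h1
    by_contra! h2
    rw [abs_of_neg h2] at h
    nlinarith
  · intro h1
    rw [abs_of_nonneg h1] at h
    nlinarith

lemma im_f_pos_iff (ha : 0 < a) (ha1 : a ≤ 1 / 100) (hC : 0 < C) {z : ℂ} (hz : ‖z‖ ≤ 1) :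
    0 < (f a C z).im ↔ 0 < z.im := by
  have h := im_f_nonneg_iff ha ha1 hC (z := starRingEnd ℂ z) (by simpa using hz)
  rw [f_conj ha (by linarith) hC.le (lt_inv_of_le_one ha ha1 hz)] at h
  simp only [Complex.conj_im, Left.nonneg_neg_iff] at h
  rw [← not_le, h, not_le]

lemma f_continuousOn (ha : 0 < a) (ha1 : a ≤ 1 / 100) (hC : 0 < C) :
    ContinuousOn (f a C) (Metric.closedBall 0 1) := fun _ hz =>
  (hasDerivAt_f ha (by linarith) hC.le
    (lt_inv_of_le_one ha ha1 (by simpa using hz))).continuousAt.continuousWithinAt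

/-- The image of the unit disk under `f`. -/
def planarDomain (a C : ℝ) : Set ℂ := f a C '' Metric.ball 0 1

lemma isOpen_planarDomain (ha : 0 < a) (ha1 : a ≤ 1 / 100) (hC : 0 < C) :
    IsOpen (planarDomain a C) := by
  rw [isOpen_iff_mem_nhds]
  rintro _ ⟨z, hz, rfl⟩
  have hz1 : ‖z‖ ≤ 1 := (by simpa using hz : ‖z‖ < 1).le
  have hza := lt_inv_of_le_one ha ha1 hz1
  have h1 := ((f_analyticOnNhd ha (by linarith) hC.le) z (by simpa using hza)).hasStrictDerivAt
  rw [(hasDerivAt_f ha (by linarith) hC.le hza).deriv] at h1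
  rw [← h1.map_nhds_eq (fDeriv_ne_zero ha ha1 hC hz1)]
  exact Filter.image_mem_map (Metric.isOpen_ball.mem_nhds hz)

lemma conj_mem_planarDomain (ha : 0 < a) (ha1 : a ≤ 1 / 100) (hC : 0 < C) {w : ℂ}
    (hw : w ∈ planarDomain a C) : starRingEnd ℂ w ∈ planarDomain a C := by
  obtain ⟨z, hz, rfl⟩ := hw
  have hz1 : ‖z‖ < 1 := by simpa using hz
  exact ⟨starRingEnd ℂ z, by simpa using hz1,
    f_conj ha (by linarith) hC.le (lt_inv_of_le_one ha ha1 hz1.le)⟩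

end

/-! #### Cylindrical coordinates in `ℝ⁴` -/

/-- The projection of `ℝ⁴` to the closed upper half-plane along the orbits of the rotations about
the `x₁`-axis. -/
def toPlane (x : EuclideanSpace ℝ (Fin 4)) : ℂ :=
  ⟨x 0, Real.sqrt (x 1 ^ 2 + x 2 ^ 2 + x 3 ^ 2)⟩

/-- The embedding of `ℝ³` into `ℝ⁴` as the orthogonal complement of the `x₁`-axis. -/
def spaceEmb : EuclideanSpace ℝ (Fin 3) →L[ℝ] EuclideanSpace ℝ (Fin 4) :=
  LinearMap.toContinuousLinearMap
    { toFun := fun σ => !₂[0, σ 0, σ 1, σ 2]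
      map_add' := fun x y => by ext i; fin_cases i <;> simp
      map_smul' := fun c x => by ext i; fin_cases i <;> simp }

/-- The isometric embedding of the plane `ℂ` as the plane spanned by the `x₁`-axis and the
direction `σ` (for a unit vector `σ` of `ℝ³`). -/
def revolve (σ : EuclideanSpace ℝ (Fin 3)) : ℂ →L[ℝ] EuclideanSpace ℝ (Fin 4) :=
  reCLM.smulRight (EuclideanSpace.single 0 1) + imCLM.smulRight (spaceEmb σ)

lemma revolve_apply (σ : EuclideanSpace ℝ (Fin 3)) (z : ℂ) :
    revolve σ z = z.re • EuclideanSpace.single 0 1 + z.im • spaceEmb σ := rfl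

lemma spaceEmb_apply (σ : EuclideanSpace ℝ (Fin 3)) : spaceEmb σ = !₂[0, σ 0, σ 1, σ 2] := rfl

lemma mem_rotate {D : Set ℂ} {x : EuclideanSpace ℝ (Fin 4)} : x ∈ rotate D ↔ toPlane x ∈ D :=
  Iff.rfl

lemma continuous_toPlane : Continuous toPlane := by
  have h : toPlane = fun x => ((x 0 : ℝ) : ℂ) +
      ((Real.sqrt (x 1 ^ 2 + x 2 ^ 2 + x 3 ^ 2) : ℝ) : ℂ) * I := by
    ext x; exact Complex.mk_eq_add_mul_I _ _
  rw [h]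
  fun_prop

lemma toPlane_revolve {σ : EuclideanSpace ℝ (Fin 3)} (hσ : ‖σ‖ = 1) (z : ℂ) :
    toPlane (revolve σ z) = ⟨z.re, |z.im|⟩ := by
  have h : σ 0 ^ 2 + σ 1 ^ 2 + σ 2 ^ 2 = 1 := by
    have := EuclideanSpace.real_norm_sq_eq σ
    rw [hσ, Fin.sum_univ_three] at this
    linarith
  have h2 : (z.im * σ 0) ^ 2 + (z.im * σ 1) ^ 2 + (z.im * σ 2) ^ 2 = z.im ^ 2 := by
    linear_combination z.im ^ 2 * h
  simp [toPlane, revolve_apply, spaceEmb_apply, h2, Real.sqrt_sq_eq_abs]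

lemma exists_eq_revolve_toPlane (x : EuclideanSpace ℝ (Fin 4)) :
    ∃ σ : EuclideanSpace ℝ (Fin 3), ‖σ‖ = 1 ∧ x = revolve σ (toPlane x) := by
  set ρ := Real.sqrt (x 1 ^ 2 + x 2 ^ 2 + x 3 ^ 2) with hρ
  have hsq : ρ ^ 2 = x 1 ^ 2 + x 2 ^ 2 + x 3 ^ 2 := Real.sq_sqrt (by positivity)
  by_cases h0 : ρ = 0
  · refine ⟨EuclideanSpace.single 0 1, by simp, ?_⟩
    rw [h0] at hsq
    have h1 : x 1 = 0 := by nlinarith [sq_nonneg (x 1), sq_nonneg (x 2), sq_nonneg (x 3)]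
    have h2 : x 2 = 0 := by nlinarith [sq_nonneg (x 1), sq_nonneg (x 2), sq_nonneg (x 3)]
    have h3 : x 3 = 0 := by nlinarith [sq_nonneg (x 1), sq_nonneg (x 2), sq_nonneg (x 3)]
    ext i
    fin_cases i <;> simp [revolve_apply, spaceEmb_apply, toPlane, h1, h2, h3]
  · refine ⟨!₂[x 1 / ρ, x 2 / ρ, x 3 / ρ], ?_, ?_⟩
    · rw [← sq_eq_sq₀ (norm_nonneg _) zero_le_one, EuclideanSpace.real_norm_sq_eq,
        Fin.sum_univ_three]
      simp
      field_simp
      exact hsq.symm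
    · ext i
      fin_cases i <;> simp [revolve_apply, spaceEmb_apply, toPlane] <;> rw [← hρ] <;> field_simp

lemma norm_toPlane (x : EuclideanSpace ℝ (Fin 4)) : ‖toPlane x‖ = ‖x‖ := by
  rw [← sq_eq_sq₀ (norm_nonneg _) (norm_nonneg _), EuclideanSpace.real_norm_sq_eq,
    Complex.sq_norm, Complex.normSq_apply]
  simp only [toPlane, Fin.sum_univ_four, Real.mul_self_sqrt (show
    (0 : ℝ) ≤ x 1 ^ 2 + x 2 ^ 2 + x 3 ^ 2 by positivity)]
  ring

section

variable {a C : ℝ}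

lemma Omega_eq_preimage (a C : ℝ) : Omega a C = toPlane ⁻¹' planarDomain a C := rfl

lemma isOpen_Omega (ha : 0 < a) (ha1 : a ≤ 1 / 100) (hC : 0 < C) : IsOpen (Omega a C) :=
  (isOpen_planarDomain ha ha1 hC).preimage continuous_toPlane

lemma zero_mem_Omega (ha : 0 < a) (ha1 : a ≤ 1 / 100) (hC : 0 < C) :
    (0 : EuclideanSpace ℝ (Fin 4)) ∈ Omega a C := by
  have h : toPlane 0 = 0 := by simp [toPlane]; rfl
  rw [Omega_eq_preimage, Set.mem_preimage, h]
  exact ⟨0, by simp, f_zero ha (by linarith) hC.le⟩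

lemma revolve_mem_Omega (ha : 0 < a) (ha1 : a ≤ 1 / 100) (hC : 0 < C)
    {σ : EuclideanSpace ℝ (Fin 3)} (hσ : ‖σ‖ = 1) {w : ℂ} :
    revolve σ w ∈ Omega a C ↔ w ∈ planarDomain a C := by
  rw [Omega_eq_preimage, Set.mem_preimage, toPlane_revolve hσ]
  rcases le_total 0 w.im with h | h
  · rw [abs_of_nonneg h]
  · rw [abs_of_nonpos h]
    exact ⟨fun h => by
        convert! conj_mem_planarDomain ha ha1 hC h using 1
        apply Complex.ext <;> simp,
      fun h => conj_mem_planarDomain ha ha1 hC h⟩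

lemma isBounded_Omega (ha : 0 < a) (ha1 : a ≤ 1 / 100) (hC : 0 < C) :
    Bornology.IsBounded (Omega a C) := by
  have hb : Bornology.IsBounded (f a C '' Metric.closedBall 0 1) :=
    ((isCompact_closedBall (0 : ℂ) 1).image_of_continuousOn (f_continuousOn ha ha1 hC)).isBounded
  obtain ⟨R, hR⟩ := hb.exists_norm_le
  refine (isBounded_iff_forall_norm_le).2 ⟨R, fun x hx => ?_⟩
  rw [← norm_toPlane]
  exact hR _ (Set.image_mono Metric.ball_subset_closedBall hx)

lemma toPlane_revolve_f (ha : 0 < a) (ha1 : a ≤ 1 / 100) (hC : 0 < C)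
    {σ : EuclideanSpace ℝ (Fin 3)} (hσ : ‖σ‖ = 1) {z : ℂ} (hz : ‖z‖ ≤ 1) (hz' : 0 ≤ z.im) :
    toPlane (revolve σ (f a C z)) = f a C z := by
  rw [toPlane_revolve hσ, abs_of_nonneg ((im_f_nonneg_iff ha ha1 hC hz).2 hz')]

lemma isConnected_Omega (ha : 0 < a) (ha1 : a ≤ 1 / 100) (hC : 0 < C) :
    IsConnected (Omega a C) := by
  refine ⟨⟨0, zero_mem_Omega ha ha1 hC⟩, ?_⟩
  -- `Ω` is the union of the rotated copies of the image of a half-disk, which all contain `0`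
  have hU : Omega a C = ⋃ σ : {σ : EuclideanSpace ℝ (Fin 3) // ‖σ‖ = 1},
      (fun z => revolve σ (f a C z)) '' (Metric.ball 0 1 ∩ {z : ℂ | 0 ≤ z.im}) := by
    ext x
    simp only [Set.mem_iUnion]
    constructor
    · rintro ⟨z, hz, hzx⟩
      obtain ⟨σ, hσ, hx⟩ := exists_eq_revolve_toPlane x
      refine ⟨⟨σ, hσ⟩, z, ⟨hz, ?_⟩, ?_⟩
      · have h1 : ‖z‖ ≤ 1 := (by simpa using hz : ‖z‖ < 1).le
        rw [Set.mem_ofPred_eq, ← im_f_nonneg_iff ha ha1 hC h1, hzx]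
        exact Real.sqrt_nonneg _
      · simp only [hzx]; exact hx.symm
    · rintro ⟨⟨σ, hσ⟩, z, ⟨hz, hz'⟩, rfl⟩
      exact (revolve_mem_Omega ha ha1 hC hσ).2 ⟨z, hz, rfl⟩
  rw [hU]
  refine isPreconnected_iUnion ⟨0, ?_⟩ ?_
  · simp only [Set.mem_iInter]
    intro σ
    exact ⟨0, by simp, by simp [f_zero ha (by linarith) hC.le]⟩
  · intro σ
    refine IsPreconnected.image ?_ _ ?_
    · exact ((convex_ball _ _).inter (convex_halfSpace_im_ge 0)).isPreconnected
    · exact (revolve σ).continuous.comp_continuousOn ((f_continuousOn ha ha1 hC).mono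
        (Set.inter_subset_left.trans Metric.ball_subset_closedBall))

lemma frontier_Omega (ha : 0 < a) (ha1 : a ≤ 1 / 100) (hC : 0 < C) :
    frontier (Omega a C) = rotate (f a C '' Metric.sphere 0 1) := by
  rw [(isOpen_Omega ha ha1 hC).frontier_eq]
  ext x
  rw [mem_rotate]
  constructor
  · rintro ⟨h1, h2⟩
    have h3 : closure (Omega a C) ⊆ toPlane ⁻¹' (f a C '' Metric.closedBall 0 1) := by
      refine closure_minimal ?_ (IsClosed.preimage continuous_toPlane ?_)
      · exact Set.preimage_mono (Set.image_mono Metric.ball_subset_closedBall)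
      · exact ((isCompact_closedBall (0 : ℂ) 1).image_of_continuousOn
          (f_continuousOn ha ha1 hC)).isClosed
    obtain ⟨z, hz, hzx⟩ := h3 h1
    refine ⟨z, ?_, hzx⟩
    rw [mem_sphere_zero_iff_norm]
    refine le_antisymm (by simpa using hz) ?_
    by_contra! hlt
    exact h2 ⟨z, by simpa using hlt, hzx⟩
  · rintro ⟨z, hz, hzx⟩
    have hz1 : ‖z‖ = 1 := by simpa using hz
    have hzc : z ∈ Metric.closedBall (0 : ℂ) 1 := by simp [hz1]
    constructor
    · obtain ⟨σ, hσ, hx⟩ := exists_eq_revolve_toPlane x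
      have hcl : z ∈ closure (Metric.ball (0 : ℂ) 1) := by
        rwa [closure_ball _ one_ne_zero]
      have hcw : ContinuousWithinAt (fun z => revolve σ (f a C z)) (Metric.ball 0 1) z :=
        ((revolve σ).continuous.comp_continuousOn (f_continuousOn ha ha1 hC) z hzc).mono
          Metric.ball_subset_closedBall
      have := hcw.mem_closure_image hcl
      rw [hzx, ← hx] at this
      refine closure_mono ?_ this
      rintro _ ⟨w, hw, rfl⟩
      exact (revolve_mem_Omega ha ha1 hC hσ).2 ⟨w, hw, rfl⟩
    · rintro ⟨w, hw, hwx⟩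
      have h1 : ‖w‖ < 1 := by simpa using hw
      have := f_injOn ha ha1 hC (by simpa using h1.le) hzc (hwx.trans hzx.symm)
      rw [this] at h1
      linarith

lemma frontier_Omega_eq_profile (ha : 0 < a) (ha1 : a ≤ 1 / 100) (hC : 0 < C) :
    frontier (Omega a C) = rotate (profile a C '' Metric.sphere 0 1) := by
  rw [frontier_Omega ha ha1 hC, Set.image_congr fun w hw =>
    (profile_eq_f ha (by linarith) hC.le (by simpa using hw)).symm]

end

attribute [irreducible] revolve spaceEmb

/-! ### The boundary is not algebraic -/

lemma pow_three_mul_h_sq (a C : ℝ) {z : ℂ} (hz : z ≠ 0) :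
    z ^ 3 * h a C z ^ 2 = C ^ 2 * (z ^ 2 - 1) ^ 2 * (z + a) * (1 + a * z) := by
  have h1 : (((z + a) / z * (1 + a * z)) ^ (1 / 2 : ℂ)) ^ 2 = (z + a) / z * (1 + a * z) := by
    simp
  rw [h, mul_pow, h1]
  field_simp

/-- An annulus is the image under `exp` of a vertical strip. -/
lemma isPreconnected_annulus {s : Set ℝ} (hs : Convex ℝ s) (hpos : ∀ r ∈ s, 0 < r) :
    IsPreconnected {z : ℂ | ‖z‖ ∈ s} := by
  have hconv : IsPreconnected (Real.exp ⁻¹' s) := by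
    have h1 : Real.exp ⁻¹' s = Real.log '' s := by
      ext x
      constructor
      · exact fun h => ⟨_, h, Real.log_exp x⟩
      · rintro ⟨r, hr, rfl⟩
        rw [Set.mem_preimage, Real.exp_log (hpos r hr)]; exact hr
    rw [h1]
    refine hs.isPreconnected.image _ (Real.continuousOn_log.mono fun r hr => ?_)
    exact (hpos r hr).ne'
  have h2 : {z : ℂ | ‖z‖ ∈ s} =
      (fun p : ℝ × ℝ => Complex.exp (p.1 + p.2 * I)) '' ((Real.exp ⁻¹' s) ×ˢ Set.univ) := by
    ext z
    constructor
    · intro hz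
      have hz0 : z ≠ 0 := by
        rintro rfl; have := hpos _ hz; simp at this
      refine ⟨(Real.log ‖z‖, z.arg), ⟨?_, trivial⟩, ?_⟩
      · rw [Set.mem_preimage, Real.exp_log (hpos _ hz)]; exact hz
      · exact (Complex.exp_log hz0 : Complex.exp (Complex.log z) = z)
    · rintro ⟨p, ⟨hp, -⟩, rfl⟩
      change ‖Complex.exp _‖ ∈ s
      rw [Complex.norm_exp]
      simpa using hp
  rw [h2]
  exact (hconv.prod isPreconnected_univ).image _ (by fun_prop)

/-- The annulus in which `h` is analytic. -/
def annulus (a : ℝ) : Set ℂ := {z | ‖z‖ ∈ Set.Ioo a a⁻¹}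

/-- The punctured disk, in which `f` and `h²` are analytic. -/
def puncturedDisk (a : ℝ) : Set ℂ := {z | ‖z‖ ∈ Set.Ioo 0 a⁻¹}

lemma isOpen_annulus (a : ℝ) : IsOpen (annulus a) := isOpen_Ioo.preimage continuous_norm

section

variable {a C : ℝ}

lemma isPreconnected_puncturedDisk (a : ℝ) : IsPreconnected (puncturedDisk a) :=
  isPreconnected_annulus (convex_Ioo _ _) fun _ h => h.1

lemma ne_zero_of_mem_annulus (ha : 0 < a) {z : ℂ} (hz : z ∈ annulus a) : z ≠ 0 := by
  rintro rfl
  have h := hz.1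
  rw [norm_zero] at h
  linarith

lemma inv_mem_annulus (ha : 0 < a) {z : ℂ} (hz : z ∈ annulus a) : z⁻¹ ∈ annulus a := by
  have h1 : 0 < ‖z‖ := ha.trans hz.1
  have h2 := hz.2
  constructor
  · rw [norm_inv]; exact (lt_inv_comm₀ h1 ha).1 hz.2
  · rw [norm_inv]; exact (inv_lt_inv₀ h1 ha).2 hz.1

lemma mem_annulus_of_norm_eq_one (ha : 0 < a) (ha1 : a ≤ 1 / 2) {z : ℂ} (hz : ‖z‖ = 1) :
    z ∈ annulus a := by
  constructor
  · linarith
  · rw [hz]; exact (one_lt_inv₀ ha).2 (by linarith)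

/-- `h` is not the quotient of two functions analytic in the punctured disk, because `h²` has a
simple zero at `-a`. -/
lemma eqOn_zero_of_add_mul_h (ha : 0 < a) (ha1 : a ≤ 1 / 2) (hC : 0 < C) {A B : ℂ → ℂ}
    (hA : AnalyticOnNhd ℂ A (puncturedDisk a)) (hB : AnalyticOnNhd ℂ B (puncturedDisk a))
    (hAB : ∀ z ∈ annulus a, A z + B z * h a C z = 0) :
    Set.EqOn A 0 (puncturedDisk a) ∧ Set.EqOn B 0 (puncturedDisk a) := by
  set K : ℂ → ℂ := fun z => C ^ 2 * (z ^ 2 - 1) ^ 2 * (1 + a * z) with hK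
  have hai : (1 : ℝ) < a⁻¹ := (one_lt_inv₀ ha).2 (by linarith)
  have hsub : annulus a ⊆ puncturedDisk a := fun z hz => ⟨ha.trans hz.1, hz.2⟩
  have h1 : (1 : ℂ) ∈ annulus a := mem_annulus_of_norm_eq_one ha ha1 norm_one
  have hid : AnalyticOnNhd ℂ (fun z : ℂ => z) (puncturedDisk a) := fun z _ => analyticAt_id
  have hKan : AnalyticOnNhd ℂ K (puncturedDisk a) := fun z _ => by fun_prop
  have hzero : Set.EqOn (fun z => A z ^ 2 * z ^ 3 - B z ^ 2 * ((z - (-a : ℂ)) ^ 1 * K z)) 0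
      (puncturedDisk a) := by
    refine AnalyticOnNhd.eqOn_zero_of_preconnected_of_eventuallyEq_zero
      (((hA.pow 2).mul (hid.pow 3)).sub ((hB.pow 2).mul
        (((hid.sub analyticOnNhd_const).pow 1).mul hKan)))
      (isPreconnected_puncturedDisk a) (hsub h1) ?_
    filter_upwards [(isOpen_annulus a).mem_nhds h1] with z hz
    have e1 := pow_three_mul_h_sq a C (ne_zero_of_mem_annulus ha hz)
    have e2 : A z = -(B z * h a C z) := eq_neg_of_add_eq_zero_left (hAB z hz)
    simp only [Pi.zero_apply, e2, hK]
    linear_combination B z ^ 2 * e1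
  have hp : (-a : ℂ) ∈ puncturedDisk a := by
    have : ‖(-a : ℂ)‖ = a := by simp [abs_of_pos ha]
    constructor
    · rwa [this]
    · rw [this]; linarith
  -- parity of the orders at `-a`: this forces both of them to be infinite
  have hord : 2 • analyticOrderAt A (-a) = 2 • analyticOrderAt B (-a) + 1 := by
    have hopen : IsOpen (puncturedDisk a) := isOpen_Ioo.preimage continuous_norm
    have hev : (A ^ 2 * (fun z : ℂ => z ^ 3)) =ᶠ[nhds (-a : ℂ)]
        (B ^ 2 * ((fun z => z - (-a : ℂ)) ^ 1 * K)) := by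
      filter_upwards [hopen.mem_nhds hp] with z hz
      exact sub_eq_zero.1 (hzero hz)
    have hac : (a : ℂ) ≠ 0 := by exact_mod_cast ha.ne'
    have o1 : analyticOrderAt (fun z : ℂ => z ^ 3) (-a : ℂ) = 0 := by
      rw [AnalyticAt.analyticOrderAt_eq_zero (by fun_prop)]
      simpa using ha.ne'
    have o2 : analyticOrderAt K (-a : ℂ) = 0 := by
      rw [AnalyticAt.analyticOrderAt_eq_zero (hKan _ hp)]
      have e1 : ((-a : ℂ) ^ 2 - 1) ≠ 0 := by
        rw [neg_sq, sub_ne_zero]; norm_cast; nlinarith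
      have e2 : (1 + a * (-a : ℂ)) ≠ 0 := by
        rw [mul_neg, ← sub_eq_add_neg, sub_ne_zero]; norm_cast; nlinarith
      have e3 : (C : ℂ) ≠ 0 := by exact_mod_cast hC.ne'
      simp only [hK]
      positivity
    have hlin : AnalyticAt ℂ ((fun z => z - (-a : ℂ)) ^ 1) (-a : ℂ) :=
      (analyticAt_id.sub analyticAt_const).pow 1
    have h3 := analyticOrderAt_congr hev
    rw [analyticOrderAt_mul ((hA _ hp).pow 2) (by fun_prop), analyticOrderAt_pow (hA _ hp), o1,
      analyticOrderAt_mul ((hB _ hp).pow 2) (hlin.mul (hKan _ hp)), analyticOrderAt_pow (hB _ hp),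
      analyticOrderAt_mul hlin (hKan _ hp), o2,
      analyticOrderAt_centeredMonomial] at h3
    simpa using h3
  have hAtop : analyticOrderAt A (-a) = ⊤ ∧ analyticOrderAt B (-a) = ⊤ := by
    generalize analyticOrderAt A (-a) = x at hord
    generalize analyticOrderAt B (-a) = y at hord
    cases x <;> cases y
    · exact ⟨rfl, rfl⟩
    · exfalso
      rw [two_nsmul, two_nsmul] at hord
      norm_cast at hord
    · exfalso
      rw [two_nsmul, two_nsmul] at hord
      norm_cast at hord
    · exfalso
      rw [two_nsmul, two_nsmul] at hord
      norm_cast at hord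
      omega
  exact ⟨hA.eqOn_zero_of_preconnected_of_eventuallyEq_zero (isPreconnected_puncturedDisk a) hp
      (analyticOrderAt_eq_top.1 hAtop.1),
    hB.eqOn_zero_of_preconnected_of_eventuallyEq_zero (isPreconnected_puncturedDisk a) hp
      (analyticOrderAt_eq_top.1 hAtop.2)⟩

/-- A polynomial in functions `α i ± β i * h` has the form `A ± B * h`, as `h²` is single-valued
in the punctured disk. -/
lemma exists_aeval_eq_add_mul_h (ha : 0 < a) (α β : Fin 4 → ℂ → ℂ)
    (hα : ∀ i, AnalyticOnNhd ℂ (α i) (puncturedDisk a))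
    (hβ : ∀ i, AnalyticOnNhd ℂ (β i) (puncturedDisk a)) (P : MvPolynomial (Fin 4) ℝ) :
    ∃ A B : ℂ → ℂ, AnalyticOnNhd ℂ A (puncturedDisk a) ∧ AnalyticOnNhd ℂ B (puncturedDisk a) ∧
      ∀ z ∈ annulus a,
        MvPolynomial.aeval (fun i => α i z + β i z * h a C z) P = A z + B z * h a C z ∧
        MvPolynomial.aeval (fun i => α i z - β i z * h a C z) P = A z - B z * h a C z := by
  induction P using MvPolynomial.induction_on with
  | C r =>
    exact ⟨fun _ => r, fun _ => 0, analyticOnNhd_const, analyticOnNhd_const, fun z _ => by simp⟩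
  | add p q hp hq =>
    obtain ⟨A, B, hA, hB, h1⟩ := hp
    obtain ⟨A', B', hA', hB', h2⟩ := hq
    refine ⟨A + A', B + B', hA.add hA', hB.add hB', fun z hz => ?_⟩
    rw [map_add, map_add, (h1 z hz).1, (h1 z hz).2, (h2 z hz).1, (h2 z hz).2]
    constructor <;> (simp only [Pi.add_apply]; ring)
  | mul_X p i hp =>
    obtain ⟨A, B, hA, hB, h1⟩ := hp
    set H : ℂ → ℂ := fun z => C ^ 2 * (z ^ 2 - 1) ^ 2 * (z + a) * (1 + a * z) / z ^ 3 with hH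
    have hHan : AnalyticOnNhd ℂ H (puncturedDisk a) := fun z hz => by
      have hz0 : z ≠ 0 := norm_pos_iff.1 hz.1
      exact AnalyticAt.div (by fun_prop) (by fun_prop) (pow_ne_zero _ hz0)
    refine ⟨A * α i + B * β i * H, A * β i + B * α i, (hA.mul (hα i)).add
      ((hB.mul (hβ i)).mul hHan), (hA.mul (hβ i)).add (hB.mul (hα i)), fun z hz => ?_⟩
    have hz0 := ne_zero_of_mem_annulus ha hz
    have e : H z = h a C z ^ 2 := by
      rw [hH]
      simp only
      rw [← pow_three_mul_h_sq a C hz0]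
      field_simp
    rw [map_mul, map_mul, (h1 z hz).1, (h1 z hz).2, MvPolynomial.aeval_X, MvPolynomial.aeval_X]
    simp only [Pi.add_apply, Pi.mul_apply, e]
    constructor <;> ring

/-- The point of the complexified profile plane in direction `ω` with coordinates `f + m h` and
`s h`. The boundary curve is `m = -1/2`, `s = -i/2`. -/
def branchPoint (a C : ℝ) (ω : EuclideanSpace ℝ (Fin 3)) (m s : ℂ) (z : ℂ) : Fin 4 → ℂ :=
  ![f a C z + m * h a C z, s * ω 0 * h a C z, s * ω 1 * h a C z, s * ω 2 * h a C z]

/-- A polynomial relation between `f` and `h` persists under the change of sign of `h`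
(analytic continuation around `-a`). -/
lemma branch_neg (ha : 0 < a) (ha1 : a ≤ 1 / 2) (hC : 0 < C) (ω : EuclideanSpace ℝ (Fin 3))
    (P : MvPolynomial (Fin 4) ℝ) {m s : ℂ}
    (hP : ∀ z ∈ annulus a, MvPolynomial.aeval (branchPoint a C ω m s z) P = 0) :
    ∀ z ∈ annulus a, MvPolynomial.aeval (branchPoint a C ω (-m) (-s) z) P = 0 := by
  have hsub : puncturedDisk a ⊆ Metric.ball 0 a⁻¹ := fun z hz => by simpa using hz.2
  obtain ⟨A, B, hA, hB, h1⟩ := exists_aeval_eq_add_mul_h (C := C) ha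
    ![f a C, fun _ => 0, fun _ => 0, fun _ => 0]
    ![fun _ => m, fun _ => s * ω 0, fun _ => s * ω 1, fun _ => s * ω 2]
    (fun i => by
      fin_cases i
      · exact (f_analyticOnNhd ha ha1 hC.le).mono hsub
      all_goals exact analyticOnNhd_const)
    (fun i => by fin_cases i <;> exact analyticOnNhd_const) P
  have hplus : ∀ z, branchPoint a C ω m s z = fun i =>
      (![f a C, fun _ => 0, fun _ => 0, fun _ => 0] : Fin 4 → ℂ → ℂ) i z +
      (![fun _ => m, fun _ => s * ω 0, fun _ => s * ω 1, fun _ => s * ω 2] : Fin 4 → ℂ → ℂ) i z *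
        h a C z := fun z => by
    ext i; fin_cases i <;> simp [branchPoint]
  have hminus : ∀ z, branchPoint a C ω (-m) (-s) z = fun i =>
      (![f a C, fun _ => 0, fun _ => 0, fun _ => 0] : Fin 4 → ℂ → ℂ) i z -
      (![fun _ => m, fun _ => s * ω 0, fun _ => s * ω 1, fun _ => s * ω 2] : Fin 4 → ℂ → ℂ) i z *
        h a C z := fun z => by
    ext i; fin_cases i <;> simp [branchPoint, sub_eq_add_neg]
  have h0 := eqOn_zero_of_add_mul_h ha ha1 hC hA hB fun z hz => by
    rw [← (h1 z hz).1, ← hplus]; exact hP z hz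
  intro z hz
  have hz' : z ∈ puncturedDisk a := ⟨ha.trans hz.1, hz.2⟩
  rw [hminus, (h1 z hz).2, h0.1 hz', h0.2 hz']
  simp

/-- The symmetry `z ↦ 1 / z` of the annulus changes `h` into `-h` and `f` into `f - h`. -/
lemma branch_inv (ha : 0 < a) (ha1 : a ≤ 1 / 2) (hC : 0 < C) (ω : EuclideanSpace ℝ (Fin 3))
    (P : MvPolynomial (Fin 4) ℝ) {m s : ℂ}
    (hP : ∀ z ∈ annulus a, MvPolynomial.aeval (branchPoint a C ω m s z) P = 0) :
    ∀ z ∈ annulus a, MvPolynomial.aeval (branchPoint a C ω (-1 - m) (-s) z) P = 0 := by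
  intro z hz
  have hzi := inv_mem_annulus ha hz
  have e1 := h_eq_f_sub_f_inv ha ha1 hC.le hz.1 hz.2
  have e2 := h_eq_f_sub_f_inv ha ha1 hC.le hzi.1 hzi.2
  rw [inv_inv] at e2
  have : branchPoint a C ω (-1 - m) (-s) z = branchPoint a C ω m s z⁻¹ := by
    ext i
    fin_cases i
    · simp [branchPoint, e1, e2]
      ring
    all_goals
      simp [branchPoint, e1, e2]
      ring
  rw [this]
  exact hP _ hzi

/-- Monodromy: a polynomial relation holds on infinitely many branches. -/
lemma branch_sub_nat (ha : 0 < a) (ha1 : a ≤ 1 / 2) (hC : 0 < C) (ω : EuclideanSpace ℝ (Fin 3))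
    (P : MvPolynomial (Fin 4) ℝ) {m s : ℂ}
    (hP : ∀ z ∈ annulus a, MvPolynomial.aeval (branchPoint a C ω m s z) P = 0) (k : ℕ) :
    ∀ z ∈ annulus a, MvPolynomial.aeval (branchPoint a C ω (m - k) s z) P = 0 := by
  induction k with
  | zero => simpa using hP
  | succ k ih =>
    have h1 := branch_inv ha ha1 hC ω P (branch_neg ha ha1 hC ω P ih)
    rw [neg_neg] at h1
    rwa [show m - ((k + 1 : ℕ) : ℂ) = -1 - -(m - k) by push_cast; ring]

/-- With the last three coordinates fixed, the polynomial in the first one has the infinitely many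
zeros `f z + (m - k) h z`. -/
lemma aeval_eq_zero_of_branch (ha : 0 < a) (ha1 : a ≤ 1 / 2) (hC : 0 < C)
    (ω : EuclideanSpace ℝ (Fin 3)) (P : MvPolynomial (Fin 4) ℝ) {m s : ℂ}
    (hP : ∀ z ∈ annulus a, MvPolynomial.aeval (branchPoint a C ω m s z) P = 0) {z : ℂ}
    (hz : z ∈ annulus a) (hh : h a C z ≠ 0) (x : ℂ) :
    MvPolynomial.aeval (![x, s * ω 0 * h a C z, s * ω 1 * h a C z, s * ω 2 * h a C z] :
      Fin 4 → ℂ) P = 0 := by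
  set p : Polynomial ℂ := MvPolynomial.aeval (![Polynomial.X, Polynomial.C (s * ω 0 * h a C z),
    Polynomial.C (s * ω 1 * h a C z), Polynomial.C (s * ω 2 * h a C z)] :
      Fin 4 → Polynomial ℂ) P with hp
  have heval : ∀ y : ℂ, p.eval y = MvPolynomial.aeval (![y, s * ω 0 * h a C z,
      s * ω 1 * h a C z, s * ω 2 * h a C z] : Fin 4 → ℂ) P := by
    intro y
    have h1 := MvPolynomial.comp_aeval_apply (R := ℝ) (![Polynomial.X,
      Polynomial.C (s * ω 0 * h a C z), Polynomial.C (s * ω 1 * h a C z),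
      Polynomial.C (s * ω 2 * h a C z)] : Fin 4 → Polynomial ℂ)
      ((Polynomial.aeval y : Polynomial ℂ →ₐ[ℂ] ℂ).restrictScalars ℝ) P
    simp only [AlgHom.restrictScalars_apply, Polynomial.coe_aeval_eq_eval] at h1
    rw [hp, h1]
    congr 2
    ext i; fin_cases i <;> simp
  rw [← heval]
  rw [Polynomial.eq_zero_of_infinite_isRoot p, Polynomial.eval_zero]
  refine (Set.infinite_range_of_injective
    (f := fun k : ℕ => f a C z + (m - k) * h a C z) ?_).mono ?_
  · intro k l hkl
    simpa [hh] using hkl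
  · rintro _ ⟨k, rfl⟩
    rw [Set.mem_ofPred_eq, Polynomial.IsRoot, heval]
    exact branch_sub_nat ha ha1 hC ω P hP k z hz

/-- In every direction `ω`, a polynomial vanishing on the boundary vanishes on a whole strip of the
half-plane through `ω`, hence on the half-plane. -/
lemma not_isAlgebraicDomain_Omega (ha : 0 < a) (ha1 : a ≤ 1 / 100) (hC : 0 < C) :
    ¬ IsAlgebraicDomain (Omega a C) := by
  rintro ⟨P, hP0, hP⟩
  have ha2 : a ≤ 1 / 2 := by linarith
  refine hP0 (MvPolynomial.funext fun x => ?_)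
  rw [map_zero]
  obtain ⟨ω, hω, hx⟩ := exists_eq_revolve_toPlane (WithLp.toLp 2 x)
  -- on the unit circle `f (1 / z)` is the conjugate of `f z`
  have hcirc : ∀ z : ℂ, ‖z‖ = 1 → h a C z = 2 * I * (f a C z).im := fun z hz => by
    have hza := mem_annulus_of_norm_eq_one ha ha2 hz
    have hinv : z⁻¹ = starRingEnd ℂ z := by
      rw [Complex.inv_def, Complex.normSq_eq_norm_sq, hz]; simp
    rw [h_eq_f_sub_f_inv ha ha2 hC.le hza.1 hza.2, hinv, f_conj ha ha2 hC.le hza.2,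
      Complex.sub_conj]
    push_cast; ring
  have hreal : ∀ (y : ℂ), MvPolynomial.aeval (fun i => ((revolve ω y i : ℝ) : ℂ)) P =
      ((MvPolynomial.eval (fun i => revolve ω y i) P : ℝ) : ℂ) := fun y => by
    exact MvPolynomial.aeval_algebraMap_apply ℂ (fun i => revolve ω y i) P
  have hbranch : ∀ z : ℂ, ‖z‖ = 1 → 0 ≤ z.im →
      MvPolynomial.aeval (branchPoint a C ω (-1 / 2) (-I / 2) z) P = 0 := by
    intro z hz hz'
    have hfr : revolve ω (f a C z) ∈ frontier (Omega a C) := by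
      rw [frontier_Omega ha ha1 hC, mem_rotate, toPlane_revolve_f ha ha1 hC hω hz.le hz']
      exact ⟨z, by simpa using hz, rfl⟩
    have h1 := hP _ hfr
    have h2 := hreal (f a C z)
    rw [h1, ofReal_zero] at h2
    rw [← h2]
    congr 2
    have h3 := hcirc z hz
    have h4 : f a C z + -1 / 2 * (2 * I * (f a C z).im) = (f a C z).re := by
      linear_combination (-1 : ℂ) * Complex.re_add_im (f a C z)
    have h5 : ∀ r : ℝ, -I / 2 * r * (2 * I * (f a C z).im) = (f a C z).im * r := fun r => by
      linear_combination (-(r : ℂ) * (f a C z).im) * I_mul_I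
    ext i
    fin_cases i <;> simp [branchPoint, h3, h4, h5, revolve_apply, spaceEmb_apply]
  -- from the upper half of the unit circle to the annulus, by the identity theorem at `I`
  have hall : ∀ z ∈ annulus a,
      MvPolynomial.aeval (branchPoint a C ω (-1 / 2) (-I / 2) z) P = 0 := by
    have han : AnalyticOnNhd ℂ (fun z => MvPolynomial.aeval
        (branchPoint a C ω (-1 / 2) (-I / 2) z) P) (annulus a) := by
      have hfan : AnalyticOnNhd ℂ (f a C) (annulus a) :=
        (f_analyticOnNhd ha ha2 hC.le).mono fun z hz => by simpa using hz.2
      have hhan : AnalyticOnNhd ℂ (h a C) (annulus a) := by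
        refine AnalyticOnNhd.congr (isOpen_annulus a) (hfan.sub (hfan.comp (fun z hz =>
          analyticAt_inv (ne_zero_of_mem_annulus ha hz)) fun z hz => inv_mem_annulus ha hz))
          fun z hz => (h_eq_f_sub_f_inv ha ha2 hC.le hz.1 hz.2).symm
      intro z hz
      refine AnalyticAt.aeval_mvPolynomial (fun i => ?_) P
      have h1 := hfan z hz
      have h2 := hhan z hz
      fin_cases i
      · exact h1.add (analyticAt_const.mul h2)
      all_goals exact analyticAt_const.mul h2
    have hI : (I : ℂ) ∈ annulus a := mem_annulus_of_norm_eq_one ha ha2 norm_I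
    refine han.eqOn_zero_of_preconnected_of_frequently_eq_zero
      (isPreconnected_annulus (convex_Ioo _ _) fun r hr => ha.trans hr.1) hI ?_
    have hd : HasDerivAt (fun θ : ℝ => Complex.exp (θ * I))
        (Complex.exp ((Real.pi / 2 : ℝ) * I) * (1 * I)) (Real.pi / 2) :=
      (Complex.ofRealCLM.hasDerivAt.mul_const I).cexp
    have ht := hd.tendsto_nhdsNE (by simp)
    have hexp : Complex.exp ((Real.pi / 2 : ℝ) * I) = I := by
      push_cast; exact Complex.exp_pi_div_two_mul_I
    rw [hexp] at ht
    refine ht.frequently (Filter.Eventually.frequently ?_)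
    have hmem : Set.Ioo 0 Real.pi ∈ nhds (Real.pi / 2) :=
      isOpen_Ioo.mem_nhds ⟨by positivity, by linarith [Real.pi_pos]⟩
    filter_upwards [mem_nhdsWithin_of_mem_nhds hmem] with θ hθ
    refine hbranch _ (Complex.norm_exp_ofReal_mul_I θ) ?_
    rw [Complex.exp_ofReal_mul_I_im]
    exact (Real.sin_pos_of_mem_Ioo hθ).le
  -- the horizontal line through a boundary point of the profile
  have hy : ∀ y : ℝ, ∀ z : ℂ, ‖z‖ = 1 → 0 < z.im → MvPolynomial.eval (fun i =>
      revolve ω ⟨y, (f a C z).im⟩ i) P = 0 := by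
    intro y z hz hz'
    have him := (im_f_pos_iff ha ha1 hC hz.le).2 hz'
    have hI := Complex.I_ne_zero
    have hne : h a C z ≠ 0 := by
      rw [hcirc z hz]
      have : ((f a C z).im : ℂ) ≠ 0 := by exact_mod_cast him.ne'
      exact mul_ne_zero (mul_ne_zero two_ne_zero hI) this
    have h1 := aeval_eq_zero_of_branch ha ha2 hC ω P hall
      (mem_annulus_of_norm_eq_one ha ha2 hz) hne y
    rw [← ofReal_eq_zero, ← hreal, ← h1]
    congr 2
    have h5 : ∀ r : ℝ, -I / 2 * r * (2 * I * (f a C z).im) = (f a C z).im * r := fun r => by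
      linear_combination (-(r : ℂ) * (f a C z).im) * I_mul_I
    ext i
    fin_cases i <;> simp [hcirc z hz, h5, revolve_apply, spaceEmb_apply]
  -- the heights `Im f` attained on the boundary curve fill an interval
  set g : ℝ → ℝ := fun θ => (f a C (Complex.exp (θ * I))).im with hg
  have hgc : ContinuousOn g (Set.Icc 0 (Real.pi / 2)) := by
    refine Complex.continuous_im.comp_continuousOn ((f_continuousOn ha ha1 hC).comp
      (Continuous.continuousOn (by fun_prop)) fun θ _ => ?_)
    simp [Complex.norm_exp_ofReal_mul_I]
  have hg0 : g 0 = 0 := by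
    have h1 := abs_im_f_sub_le ha ha1 hC (z := 1) (by simp)
    simpa [hg] using h1
  have hgpos : ∀ θ ∈ Set.Ioo 0 Real.pi, 0 < g θ := fun θ hθ => by
    refine (im_f_pos_iff ha ha1 hC (by simp [Complex.norm_exp_ofReal_mul_I])).2 ?_
    rw [Complex.exp_ofReal_mul_I_im]
    exact Real.sin_pos_of_mem_Ioo hθ
  have hp2 : 0 < g (Real.pi / 2) := hgpos _ ⟨by positivity, by linarith [Real.pi_pos]⟩
  have hIoc : ∀ t ∈ Set.Ioc 0 (g (Real.pi / 2)), ∀ y : ℝ,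
      MvPolynomial.eval (fun i => revolve ω ⟨y, t⟩ i) P = 0 := by
    intro t ht y
    obtain ⟨θ, hθ, hθt⟩ := intermediate_value_Icc (by positivity) hgc
      (show t ∈ Set.Icc (g 0) (g (Real.pi / 2)) from ⟨by rw [hg0]; exact ht.1.le, ht.2⟩)
    rw [← hθt]
    refine hy y _ (Complex.norm_exp_ofReal_mul_I θ) ?_
    rw [Complex.exp_ofReal_mul_I_im]
    refine Real.sin_pos_of_mem_Ioo ⟨lt_of_le_of_ne hθ.1 ?_, by linarith [hθ.2, Real.pi_pos]⟩
    rintro rfl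
    rw [hg0] at hθt
    linarith [ht.1]
  set w := toPlane (WithLp.toLp 2 x) with hw
  -- on a vertical line, a polynomial in one variable vanishing on an interval
  set p : Polynomial ℝ := MvPolynomial.aeval (![Polynomial.C w.re, Polynomial.X *
    Polynomial.C (ω 0), Polynomial.X * Polynomial.C (ω 1), Polynomial.X * Polynomial.C (ω 2)] :
      Fin 4 → Polynomial ℝ) P with hp
  have heval : ∀ t : ℝ, p.eval t = MvPolynomial.eval (fun i => revolve ω ⟨w.re, t⟩ i) P := by
    intro t
    have h1 := MvPolynomial.comp_aeval_apply (R := ℝ) (![Polynomial.C w.re, Polynomial.X *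
      Polynomial.C (ω 0), Polynomial.X * Polynomial.C (ω 1), Polynomial.X * Polynomial.C (ω 2)] :
      Fin 4 → Polynomial ℝ) (Polynomial.aeval t) P
    simp only [Polynomial.coe_aeval_eq_eval] at h1
    rw [hp, h1, MvPolynomial.aeval_eq_eval]
    congr 2
    ext i; fin_cases i <;> simp [revolve_apply, spaceEmb_apply] <;> ring
  have hx' : x = fun i => revolve ω ⟨w.re, w.im⟩ i := by
    ext i
    exact congrArg (fun v : EuclideanSpace ℝ (Fin 4) => v i) hx
  rw [hx', ← heval, Polynomial.eq_zero_of_infinite_isRoot p, Polynomial.eval_zero]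
  refine (Set.Ioc_infinite hp2).mono fun t ht => ?_
  rw [Set.mem_ofPred_eq, Polynomial.IsRoot, heval]
  exact hIoc t ht _

end

/-! ### Integration in cylindrical coordinates -/

/-- The surface measure on the unit sphere of `ℝ³`. -/
abbrev sphereMeasure : Measure (Metric.sphere (0 : EuclideanSpace ℝ (Fin 3)) 1) :=
  (volume : Measure (EuclideanSpace ℝ (Fin 3))).toSphere

lemma continuous_revolve :
    Continuous fun p : ℂ × EuclideanSpace ℝ (Fin 3) => revolve p.2 p.1 := by
  simp only [revolve_apply]
  fun_prop

lemma lintegral_polar {φ : EuclideanSpace ℝ (Fin 3) → ENNReal} (hφ : Measurable φ) :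
    ∫⁻ q, φ q = ∫⁻ r in Set.Ioi (0 : ℝ), ENNReal.ofReal (r ^ 2) *
      ∫⁻ σ, φ (r • (σ : EuclideanSpace ℝ (Fin 3))) ∂sphereMeasure := by
  calc ∫⁻ q, φ q = ∫⁻ q : ({(0)}ᶜ : Set (EuclideanSpace ℝ (Fin 3))), φ q
        ∂(Measure.comap Subtype.val volume) := by
        rw [lintegral_subtype_comap (measurableSet_singleton _).compl φ,
          restrict_compl_singleton]
    _ = ∫⁻ p : Metric.sphere (0 : EuclideanSpace ℝ (Fin 3)) 1 × Set.Ioi (0 : ℝ),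
        φ ((p.2 : ℝ) • (p.1 : EuclideanSpace ℝ (Fin 3)))
        ∂(sphereMeasure.prod (Measure.volumeIoiPow 2)) := by
        have h := (volume : Measure (EuclideanSpace ℝ (Fin 3)))
          |>.measurePreserving_homeomorphUnitSphereProd.symm
            (homeomorphUnitSphereProd _).toMeasurableEquiv
        rw [finrank_euclideanSpace_fin] at h
        rw [← h.lintegral_comp_emb (MeasurableEquiv.measurableEmbedding _)]
        rfl
    _ = ∫⁻ r : Set.Ioi (0 : ℝ), ∫⁻ σ, φ ((r : ℝ) • (σ : EuclideanSpace ℝ (Fin 3)))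
        ∂sphereMeasure ∂(Measure.volumeIoiPow 2) := by
        rw [lintegral_prod_symm _ (by fun_prop)]
    _ = _ := by
        have hm : Measurable fun r : ℝ => ∫⁻ σ, φ (r • (σ : EuclideanSpace ℝ (Fin 3)))
            ∂sphereMeasure :=
          Measurable.lintegral_prod_right' (f := fun p : ℝ × Metric.sphere
            (0 : EuclideanSpace ℝ (Fin 3)) 1 => φ (p.1 • (p.2 : EuclideanSpace ℝ (Fin 3))))
            (by fun_prop)
        rw [Measure.volumeIoiPow, ← lintegral_subtype_comap measurableSet_Ioi]
        exact lintegral_withDensity_eq_lintegral_mul _ (by fun_prop)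
          (hm.comp measurable_subtype_coe)

lemma lintegral_eq_lintegral_real_prod {g : EuclideanSpace ℝ (Fin 4) → ENNReal}
    (hg : Measurable g) : ∫⁻ x, g x = ∫⁻ t : ℝ, ∫⁻ q : EuclideanSpace ℝ (Fin 3),
      g (t • EuclideanSpace.single 0 1 + spaceEmb q) := by
  rw [← (PiLp.volume_preserving_toLp (Fin 4)).lintegral_comp hg,
    ← ((volume_preserving_piFinSuccAbove (fun _ : Fin 4 => ℝ) 0).symm _).lintegral_comp
      (by fun_prop), Measure.volume_eq_prod, lintegral_prod _ (by fun_prop)]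
  refine lintegral_congr fun t => ?_
  rw [← (PiLp.volume_preserving_toLp (Fin 3)).lintegral_comp (by fun_prop)]
  refine lintegral_congr fun q => ?_
  congr 1
  ext i
  refine Fin.cases ?_ (fun j => ?_) i
  · simp [spaceEmb_apply, MeasurableEquiv.piFinSuccAbove]
  · fin_cases j <;> simp [spaceEmb_apply, MeasurableEquiv.piFinSuccAbove] <;> rfl

/-- The measure `y² dx dy` on the upper half-plane. -/
def halfPlaneMeasure : Measure ℂ :=
  (volume.restrict {z : ℂ | 0 < z.im}).withDensity fun z => ENNReal.ofReal (z.im ^ 2)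

instance : SFinite halfPlaneMeasure := by unfold halfPlaneMeasure; infer_instance

lemma measurable_revolve_sphere : Measurable
    fun p : ℂ × Metric.sphere (0 : EuclideanSpace ℝ (Fin 3)) 1 => revolve p.2 p.1 :=
  (continuous_revolve.comp (by fun_prop : Continuous fun p : ℂ ×
    Metric.sphere (0 : EuclideanSpace ℝ (Fin 3)) 1 => (p.1, (p.2 : EuclideanSpace ℝ (Fin 3)))))
    |>.measurable

lemma measurableSet_upper : MeasurableSet {z : ℂ | 0 < z.im} :=
  measurableSet_lt measurable_const Complex.measurable_im

/-- Cylindrical coordinates in `ℝ⁴`. -/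
lemma measurePreserving_revolve : MeasurePreserving
    (fun p : ℂ × Metric.sphere (0 : EuclideanSpace ℝ (Fin 3)) 1 => revolve p.2 p.1)
    (halfPlaneMeasure.prod sphereMeasure) volume := by
  refine ⟨measurable_revolve_sphere, Measure.ext_of_lintegral _ fun g hg => ?_⟩
  have hm : Measurable fun p : ℂ × Metric.sphere (0 : EuclideanSpace ℝ (Fin 3)) 1 =>
      g (revolve p.2 p.1) := hg.comp measurable_revolve_sphere
  rw [lintegral_map hg measurable_revolve_sphere, lintegral_prod _ hm.aemeasurable,
    halfPlaneMeasure, lintegral_withDensity_eq_lintegral_mul _ (by fun_prop)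
      (Measurable.lintegral_prod_right' hm),
    lintegral_eq_lintegral_real_prod hg, ← lintegral_indicator measurableSet_upper,
    ← (Complex.volume_preserving_equiv_real_prod.symm).lintegral_comp
      (Measurable.indicator (Measurable.mul (by fun_prop)
        (Measurable.lintegral_prod_right' hm)) measurableSet_upper),
    Measure.volume_eq_prod, lintegral_prod]
  · refine lintegral_congr fun t => ?_
    rw [lintegral_polar (by fun_prop), ← lintegral_indicator measurableSet_Ioi]
    refine lintegral_congr fun r => ?_
    by_cases hr : 0 < r
    · rw [Set.indicator_of_mem (by exact hr), Set.indicator_of_mem (by exact hr)]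
      simp [revolve_apply, Complex.measurableEquivRealProd]
    · rw [Set.indicator_of_notMem (by exact hr), Set.indicator_of_notMem (by exact hr)]
  · exact ((Measurable.indicator (Measurable.mul (by fun_prop)
        (Measurable.lintegral_prod_right' hm)) measurableSet_upper).comp
        (MeasurableEquiv.measurable _)).aemeasurable

/-- Cylindrical coordinates for integrable functions. -/
lemma integral_eq_integral_upper {g : EuclideanSpace ℝ (Fin 4) → ℝ} (hg : Integrable g) :
    IntegrableOn (fun z : ℂ => z.im ^ 2 * ∫ σ, g (revolve σ z) ∂sphereMeasure)
      {z : ℂ | 0 < z.im} ∧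
    ∫ x, g x = ∫ z in {z : ℂ | 0 < z.im}, z.im ^ 2 * ∫ σ, g (revolve σ z) ∂sphereMeasure := by
  have hi : Integrable (fun p : ℂ × Metric.sphere (0 : EuclideanSpace ℝ (Fin 3)) 1 =>
      g (revolve p.2 p.1)) (halfPlaneMeasure.prod sphereMeasure) :=
    measurePreserving_revolve.integrable_comp_of_integrable hg
  have hd : Measurable fun z : ℂ => ENNReal.ofReal (z.im ^ 2) := by fun_prop
  have htr : ∀ z : ℂ, (ENNReal.ofReal (z.im ^ 2)).toReal = z.im ^ 2 := fun z =>
    ENNReal.toReal_ofReal (by positivity)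
  constructor
  · have h1 := hi.integral_prod_left
    rw [halfPlaneMeasure, integrable_withDensity_iff_integrable_smul' hd (by simp)] at h1
    simpa [htr, IntegrableOn] using h1
  · have h2 := integral_map (μ := halfPlaneMeasure.prod sphereMeasure) (f := g)
      measurable_revolve_sphere.aemeasurable (by
        rw [measurePreserving_revolve.map_eq]; exact hg.aestronglyMeasurable)
    rw [measurePreserving_revolve.map_eq] at h2
    rw [h2, integral_prod _ hi, halfPlaneMeasure,
      integral_withDensity_eq_integral_toReal_smul hd (by simp)]
    simp [htr]

/-! ### Spherical means -/

/-- A linear isometry of `ℝ³`, as a homeomorphism of the unit sphere. -/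
def sphereHomeo (R : EuclideanSpace ℝ (Fin 3) ≃ₗᵢ[ℝ] EuclideanSpace ℝ (Fin 3)) :
    Metric.sphere (0 : EuclideanSpace ℝ (Fin 3)) 1 ≃ₜ
      Metric.sphere (0 : EuclideanSpace ℝ (Fin 3)) 1 :=
  R.toHomeomorph.subtype fun x => by simp

lemma measurePreserving_sphereHomeo
    (R : EuclideanSpace ℝ (Fin 3) ≃ₗᵢ[ℝ] EuclideanSpace ℝ (Fin 3)) :
    MeasurePreserving (sphereHomeo R) sphereMeasure sphereMeasure := by
  refine ⟨(sphereHomeo R).measurable, Measure.ext fun s hs => ?_⟩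
  rw [Measure.map_apply (sphereHomeo R).measurable hs, Measure.toSphere_apply' _ hs,
    Measure.toSphere_apply' _ ((sphereHomeo R).measurable hs)]
  congr 1
  rw [eq_comm, ← R.measurePreserving.measure_preimage_emb R.toHomeomorph.measurableEmbedding]
  congr 1
  ext x
  simp only [Set.mem_smul, Set.mem_image, Set.mem_preimage]
  constructor
  · rintro ⟨r, hr, _, ⟨σ, hσ, rfl⟩, hx⟩
    refine ⟨r, hr, _, ⟨(sphereHomeo R).symm σ, by simpa using hσ, rfl⟩, ?_⟩
    apply R.injective
    rw [map_smul, ← hx]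
    congr 1
    exact congrArg Subtype.val ((sphereHomeo R).apply_symm_apply σ)
  · rintro ⟨r, hr, _, ⟨σ, hσ, rfl⟩, rfl⟩
    exact ⟨r, hr, _, ⟨_, hσ, rfl⟩, by rw [map_smul]; rfl⟩

lemma integral_sphere_comp {F : Type*} [NormedAddCommGroup F] [NormedSpace ℝ F]
    (R : EuclideanSpace ℝ (Fin 3) ≃ₗᵢ[ℝ] EuclideanSpace ℝ (Fin 3))
    (g : EuclideanSpace ℝ (Fin 3) → F) :
    ∫ σ, g (R σ) ∂sphereMeasure = ∫ σ, g σ ∂sphereMeasure :=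
  (measurePreserving_sphereHomeo R).integral_comp (sphereHomeo R).measurableEmbedding
    fun σ => g σ

/-- Differentiation under the integral over the sphere. -/
lemma hasFDerivAt_sphere_integral {H F : Type*} [NormedAddCommGroup H] [NormedSpace ℝ H]
    [FiniteDimensional ℝ H] [NormedAddCommGroup F] [NormedSpace ℝ F] [CompleteSpace F]
    {G : Set H} (hG : IsOpen G)
    {K : H → Metric.sphere (0 : EuclideanSpace ℝ (Fin 3)) 1 → F}
    {K' : H → Metric.sphere (0 : EuclideanSpace ℝ (Fin 3)) 1 → H →L[ℝ] F}
    (hK : ContinuousOn (Function.uncurry K) (G ×ˢ Set.univ))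
    (hK' : ContinuousOn (Function.uncurry K') (G ×ˢ Set.univ))
    (hd : ∀ p ∈ G, ∀ σ, HasFDerivAt (fun p => K p σ) (K' p σ) p) {p : H} (hp : p ∈ G) :
    HasFDerivAt (fun p => ∫ σ, K p σ ∂sphereMeasure) (∫ σ, K' p σ ∂sphereMeasure) p := by
  obtain ⟨ε, hε, hεG⟩ := Metric.nhds_basis_closedBall.mem_iff.1 (hG.mem_nhds hp)
  have hcont : ∀ q ∈ G, Continuous (K q) := fun q hq =>
    hK.comp_continuous (by fun_prop : Continuous fun σ => (q, σ)) fun σ => ⟨hq, trivial⟩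
  have hcont' : Continuous (K' p) :=
    hK'.comp_continuous (by fun_prop : Continuous fun σ => (p, σ)) fun σ => ⟨hp, trivial⟩
  obtain ⟨M, hM⟩ := ((isCompact_closedBall p ε).prod (isCompact_univ
    (X := Metric.sphere (0 : EuclideanSpace ℝ (Fin 3)) 1))).exists_bound_of_continuousOn
    (hK'.mono (Set.prod_mono hεG subset_rfl))
  refine hasFDerivAt_integral_of_dominated_of_fderiv_le (bound := fun _ => M)
    (Metric.closedBall_mem_nhds p hε) ?_ ?_ hcont'.aestronglyMeasurable ?_ (integrable_const _) ?_
  · filter_upwards [hG.mem_nhds hp] with q hq using (hcont q hq).aestronglyMeasurable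
  · exact (hcont p hp).integrable_of_hasCompactSupport (HasCompactSupport.of_compactSpace _)
  · exact .of_forall fun σ q hq => hM (q, σ) ⟨hq, trivial⟩
  · exact .of_forall fun σ q hq => hd q (hεG hq) σ

lemma continuousOn_sphere_integral {H F : Type*} [NormedAddCommGroup H] [NormedSpace ℝ H]
    [FiniteDimensional ℝ H] [NormedAddCommGroup F] [NormedSpace ℝ F] {G : Set H} (hG : IsOpen G)
    {K : H → Metric.sphere (0 : EuclideanSpace ℝ (Fin 3)) 1 → F}
    (hK : ContinuousOn (Function.uncurry K) (G ×ˢ Set.univ)) :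
    ContinuousOn (fun p => ∫ σ, K p σ ∂sphereMeasure) G := by
  rw [continuousOn_iff_continuous_domRestrict]
  have : ProperSpace H := FiniteDimensional.proper_real H
  have : LocallyCompactSpace G := hG.locallyCompactSpace
  have h := continuous_parametric_integral_of_continuous (μ := sphereMeasure)
    (f := fun (p : G) σ => K p σ) (s := Set.univ) (hK.comp_continuous (by fun_prop :
      Continuous fun q : G × Metric.sphere (0 : EuclideanSpace ℝ (Fin 3)) 1 => ((q.1 : H), q.2))
      fun q => ⟨q.1.2, trivial⟩) isCompact_univ
  simpa [Set.domRestrict_def] using h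

/-! ### Axially symmetric harmonic functions in `ℝ⁴` and harmonic functions in the plane -/

/-- The generator of the rotations in the plane of the `i`-th and `j`-th coordinates. -/
def rotGen (i j : Fin 3) : EuclideanSpace ℝ (Fin 3) →L[ℝ] EuclideanSpace ℝ (Fin 3) :=
  (EuclideanSpace.proj i).smulRight (EuclideanSpace.single j 1) -
    (EuclideanSpace.proj j).smulRight (EuclideanSpace.single i 1)

lemma rotGen_apply (i j : Fin 3) (x : EuclideanSpace ℝ (Fin 3)) :
    rotGen i j x = x i • EuclideanSpace.single j 1 - x j • EuclideanSpace.single i 1 := rfl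

lemma rotGen_cube {i j : Fin 3} (hij : i ≠ j) (x : EuclideanSpace ℝ (Fin 3)) :
    rotGen i j (rotGen i j (rotGen i j x)) = -rotGen i j x := by
  simp [rotGen_apply, hij, hij.symm]
  abel

lemma inner_rotGen (i j : Fin 3) (x y : EuclideanSpace ℝ (Fin 3)) :
    inner ℝ (rotGen i j x) y = -inner ℝ x (rotGen i j y) := by
  simp [rotGen_apply, inner_sub_left, inner_sub_right, inner_smul_left, inner_smul_right,
    EuclideanSpace.inner_single_left, EuclideanSpace.inner_single_right]
  ring

/-- The rotation `exp (θ J)`, where the generator `J` satisfies `J³ = -J`. -/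
def rotation (i j : Fin 3) (θ : ℝ) : EuclideanSpace ℝ (Fin 3) →L[ℝ] EuclideanSpace ℝ (Fin 3) :=
  .id ℝ _ + (1 - Real.cos θ) • (rotGen i j).comp (rotGen i j) + Real.sin θ • rotGen i j

lemma rotation_apply (i j : Fin 3) (θ : ℝ) (x : EuclideanSpace ℝ (Fin 3)) :
    rotation i j θ x = x + (1 - Real.cos θ) • rotGen i j (rotGen i j x) +
      Real.sin θ • rotGen i j x := rfl

lemma norm_rotation {i j : Fin 3} (hij : i ≠ j) (θ : ℝ) (x : EuclideanSpace ℝ (Fin 3)) :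
    ‖rotation i j θ x‖ = ‖x‖ := by
  set J := rotGen i j with hJ
  have h1 : inner ℝ x (J (J x)) = -inner ℝ (J x) (J x) := by
    rw [hJ, inner_rotGen i j x, neg_neg]
  have h2 : inner ℝ x (J x) = (0 : ℝ) := by
    have := inner_rotGen i j x x
    rw [real_inner_comm] at this
    rw [hJ]; linarith
  have h3 : inner ℝ (J (J x)) (J (J x)) = inner ℝ (J x) (J x) := by
    rw [hJ, inner_rotGen i j (rotGen i j x), rotGen_cube hij, inner_neg_right, neg_neg]
  have h4 : inner ℝ (J (J x)) (J x) = (0 : ℝ) := by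
    have := inner_rotGen i j (rotGen i j x) (rotGen i j x)
    rw [real_inner_comm] at this
    rw [hJ, real_inner_comm]; linarith
  rw [← sq_eq_sq₀ (norm_nonneg _) (norm_nonneg _), ← real_inner_self_eq_norm_sq,
    ← real_inner_self_eq_norm_sq, rotation_apply]
  have h5 : inner ℝ (J (J x)) x = -inner ℝ (J x) (J x) := by rw [real_inner_comm, h1]
  have h6 : inner ℝ (J x) x = (0 : ℝ) := by rw [real_inner_comm, h2]
  have h7 : inner ℝ (J x) (J (J x)) = (0 : ℝ) := by rw [real_inner_comm, h4]
  simp only [inner_add_left, inner_add_right, inner_smul_left, inner_smul_right, ← hJ, h5, h6, h7]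
  rw [h1, h2, h3, h4]
  simp only [conj_trivial]
  linear_combination inner ℝ (J x) (J x) * Real.sin_sq_add_cos_sq θ

/-- The rotation as an isometry. -/
def rotationIsometry {i j : Fin 3} (hij : i ≠ j) (θ : ℝ) :
    EuclideanSpace ℝ (Fin 3) ≃ₗᵢ[ℝ] EuclideanSpace ℝ (Fin 3) :=
  LinearIsometry.toLinearIsometryEquiv ⟨rotation i j θ, norm_rotation hij θ⟩ rfl

lemma hasDerivAt_rotation {i j : Fin 3} (hij : i ≠ j) (θ : ℝ) (x : EuclideanSpace ℝ (Fin 3)) :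
    HasDerivAt (fun θ => rotation i j θ x) (rotGen i j (rotation i j θ x)) θ := by
  simp only [rotation_apply]
  convert! ((((Real.hasDerivAt_cos θ).const_sub 1).smul_const
    (rotGen i j (rotGen i j x))).const_add x).add
      ((Real.hasDerivAt_sin θ).smul_const (rotGen i j x)) using 1
  simp only [map_add, map_smul, rotGen_cube hij]
  module

/-- The sum of the squares of the rotation generators is the spherical Laplacian: second order
part. -/
lemma sum_rotGen_bilin (B : EuclideanSpace ℝ (Fin 3) →L[ℝ] EuclideanSpace ℝ (Fin 3) →L[ℝ] ℝ)
    (hB : ∀ x y, B x y = B y x) {σ : EuclideanSpace ℝ (Fin 3)} (hσ : ‖σ‖ = 1) :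
    B (rotGen 0 1 σ) (rotGen 0 1 σ) + B (rotGen 0 2 σ) (rotGen 0 2 σ) +
      B (rotGen 1 2 σ) (rotGen 1 2 σ) =
      ∑ k : Fin 3, B (EuclideanSpace.single k 1) (EuclideanSpace.single k 1) - B σ σ := by
  have h : σ 0 ^ 2 + σ 1 ^ 2 + σ 2 ^ 2 = 1 := by
    have := EuclideanSpace.real_norm_sq_eq σ
    rw [hσ, Fin.sum_univ_three] at this
    linarith
  have hs : σ = σ 0 • EuclideanSpace.single 0 1 + σ 1 • EuclideanSpace.single 1 1 +
      σ 2 • EuclideanSpace.single 2 1 := by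
    ext i; fin_cases i <;> simp
  have hBs : B σ σ = B (σ 0 • EuclideanSpace.single 0 1 + σ 1 • EuclideanSpace.single 1 1 +
      σ 2 • EuclideanSpace.single 2 1) (σ 0 • EuclideanSpace.single 0 1 +
      σ 1 • EuclideanSpace.single 1 1 + σ 2 • EuclideanSpace.single 2 1) := by rw [← hs]
  rw [hBs, Fin.sum_univ_three]
  simp only [rotGen_apply, map_add, map_sub, map_smul, _root_.add_apply,
    _root_.sub_apply, _root_.smul_apply, smul_eq_mul,
    hB (EuclideanSpace.single 1 1) (EuclideanSpace.single 0 1),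
    hB (EuclideanSpace.single 2 1) (EuclideanSpace.single 0 1),
    hB (EuclideanSpace.single 2 1) (EuclideanSpace.single 1 1)]
  linear_combination (B (EuclideanSpace.single 0 1) (EuclideanSpace.single 0 1) +
    B (EuclideanSpace.single 1 1) (EuclideanSpace.single 1 1) +
    B (EuclideanSpace.single 2 1) (EuclideanSpace.single 2 1)) * h

lemma sum_rotGen_sq (σ : EuclideanSpace ℝ (Fin 3)) :
    rotGen 0 1 (rotGen 0 1 σ) + rotGen 0 2 (rotGen 0 2 σ) + rotGen 1 2 (rotGen 1 2 σ) =
      (-2 : ℝ) • σ := by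
  ext i
  fin_cases i <;> simp [rotGen_apply] <;> ring

attribute [irreducible] rotGen rotation

lemma continuous_revolve_clm : Continuous revolve := by
  rw [continuous_clm_apply]
  intro z
  simp only [revolve_apply]
  fun_prop

section

variable {Ω : Set (EuclideanSpace ℝ (Fin 4))} {u : EuclideanSpace ℝ (Fin 4) → ℝ} {G : Set ℂ}

/-- The (unnormalized) mean of `u` over the orbit of a point of the profile plane under the
rotations about the `x₁`-axis. -/
def orbitIntegral (u : EuclideanSpace ℝ (Fin 4) → ℝ) (z : ℂ) : ℝ :=
  ∫ σ, u (revolve σ z) ∂sphereMeasure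

/-- The first derivative of the orbit integral. -/
def orbitDeriv (u : EuclideanSpace ℝ (Fin 4) → ℝ) (z : ℂ) : ℂ →L[ℝ] ℝ :=
  ∫ σ, (fderiv ℝ u (revolve σ z)).comp (revolve σ) ∂sphereMeasure

/-- The second derivative of the orbit integral. -/
def orbitDerivTwo (u : EuclideanSpace ℝ (Fin 4) → ℝ) (z : ℂ) : ℂ →L[ℝ] ℂ →L[ℝ] ℝ :=
  ∫ σ, ((ContinuousLinearMap.compL ℝ ℂ (EuclideanSpace ℝ (Fin 4)) ℝ).flip (revolve σ)).comp
    ((fderiv ℝ (fderiv ℝ u) (revolve σ z)).comp (revolve σ)) ∂sphereMeasure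

lemma mapsTo_revolve (hGΩ : ∀ σ : EuclideanSpace ℝ (Fin 3), ‖σ‖ = 1 → ∀ z ∈ G, revolve σ z ∈ Ω) :
    Set.MapsTo (fun q : ℂ × Metric.sphere (0 : EuclideanSpace ℝ (Fin 3)) 1 => revolve q.2 q.1)
      (G ×ˢ Set.univ) Ω := fun q hq => hGΩ _ (mem_sphere_zero_iff_norm.1 q.2.2) _ hq.1

lemma continuous_revolve_sphere : Continuous
    fun q : ℂ × Metric.sphere (0 : EuclideanSpace ℝ (Fin 3)) 1 => revolve q.2 q.1 := by
  simp only [revolve_apply]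
  fun_prop

lemma continuousOn_fderiv_of_two (hΩ : IsOpen Ω) (hu : ContDiffOn ℝ 2 u Ω) :
    ContDiffOn ℝ 1 (fderiv ℝ u) Ω := hu.fderiv_of_isOpen hΩ (by norm_num)

lemma continuousOn_fderiv_fderiv_of_two (hΩ : IsOpen Ω) (hu : ContDiffOn ℝ 2 u Ω) :
    ContinuousOn (fderiv ℝ (fderiv ℝ u)) Ω :=
  (continuousOn_fderiv_of_two hΩ hu).continuousOn_fderiv_of_isOpen hΩ (by norm_num)

lemma continuousOn_orbit_fderiv (hΩ : IsOpen Ω) (hu : ContDiffOn ℝ 2 u Ω)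
    (hGΩ : ∀ σ : EuclideanSpace ℝ (Fin 3), ‖σ‖ = 1 → ∀ z ∈ G, revolve σ z ∈ Ω) :
    ContinuousOn (fun q : ℂ × Metric.sphere (0 : EuclideanSpace ℝ (Fin 3)) 1 =>
      fderiv ℝ u (revolve q.2 q.1)) (G ×ˢ Set.univ) :=
  (continuousOn_fderiv_of_two hΩ hu).continuousOn.comp continuous_revolve_sphere.continuousOn
    (mapsTo_revolve hGΩ)

lemma continuousOn_orbit_fderivTwo (hΩ : IsOpen Ω) (hu : ContDiffOn ℝ 2 u Ω)
    (hGΩ : ∀ σ : EuclideanSpace ℝ (Fin 3), ‖σ‖ = 1 → ∀ z ∈ G, revolve σ z ∈ Ω) :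
    ContinuousOn (fun q : ℂ × Metric.sphere (0 : EuclideanSpace ℝ (Fin 3)) 1 =>
      fderiv ℝ (fderiv ℝ u) (revolve q.2 q.1)) (G ×ˢ Set.univ) :=
  (continuousOn_fderiv_fderiv_of_two hΩ hu).comp continuous_revolve_sphere.continuousOn
    (mapsTo_revolve hGΩ)

lemma continuous_revolve_clm_sphere : Continuous
    fun q : ℂ × Metric.sphere (0 : EuclideanSpace ℝ (Fin 3)) 1 => revolve q.2 :=
  continuous_revolve_clm.comp (by fun_prop)

lemma continuousOn_orbitDeriv_integrand (hΩ : IsOpen Ω) (hu : ContDiffOn ℝ 2 u Ω)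
    (hGΩ : ∀ σ : EuclideanSpace ℝ (Fin 3), ‖σ‖ = 1 → ∀ z ∈ G, revolve σ z ∈ Ω) :
    ContinuousOn (Function.uncurry fun (z : ℂ)
      (σ : Metric.sphere (0 : EuclideanSpace ℝ (Fin 3)) 1) =>
      (fderiv ℝ u (revolve σ z)).comp (revolve σ)) (G ×ˢ Set.univ) :=
  (continuousOn_orbit_fderiv hΩ hu hGΩ).clm_comp continuous_revolve_clm_sphere.continuousOn

lemma continuousOn_orbitDerivTwo_integrand (hΩ : IsOpen Ω) (hu : ContDiffOn ℝ 2 u Ω)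
    (hGΩ : ∀ σ : EuclideanSpace ℝ (Fin 3), ‖σ‖ = 1 → ∀ z ∈ G, revolve σ z ∈ Ω) :
    ContinuousOn (Function.uncurry fun (z : ℂ)
      (σ : Metric.sphere (0 : EuclideanSpace ℝ (Fin 3)) 1) =>
      ((ContinuousLinearMap.compL ℝ ℂ (EuclideanSpace ℝ (Fin 4)) ℝ).flip (revolve σ)).comp
        ((fderiv ℝ (fderiv ℝ u) (revolve σ z)).comp (revolve σ))) (G ×ˢ Set.univ) :=
  (((ContinuousLinearMap.continuous _).comp
    continuous_revolve_clm_sphere).continuousOn).clm_comp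
    ((continuousOn_orbit_fderivTwo hΩ hu hGΩ).clm_comp continuous_revolve_clm_sphere.continuousOn)

lemma hasFDerivAt_orbitIntegral (hΩ : IsOpen Ω) (hu : ContDiffOn ℝ 2 u Ω) (hG : IsOpen G)
    (hGΩ : ∀ σ : EuclideanSpace ℝ (Fin 3), ‖σ‖ = 1 → ∀ z ∈ G, revolve σ z ∈ Ω) {z : ℂ}
    (hz : z ∈ G) : HasFDerivAt (orbitIntegral u) (orbitDeriv u z) z := by
  refine hasFDerivAt_sphere_integral (K := fun z σ => u (revolve σ z)) hG
    (hu.continuousOn.comp continuous_revolve_sphere.continuousOn (mapsTo_revolve hGΩ))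
    (continuousOn_orbitDeriv_integrand hΩ hu hGΩ) (fun p hp σ => ?_) hz
  have h1 : DifferentiableAt ℝ u (revolve σ p) :=
    (hu.differentiableOn (by norm_num)).differentiableAt
      (hΩ.mem_nhds (hGΩ _ (mem_sphere_zero_iff_norm.1 σ.2) _ hp))
  exact h1.hasFDerivAt.comp p (revolve σ).hasFDerivAt

lemma hasFDerivAt_orbitDeriv (hΩ : IsOpen Ω) (hu : ContDiffOn ℝ 2 u Ω) (hG : IsOpen G)
    (hGΩ : ∀ σ : EuclideanSpace ℝ (Fin 3), ‖σ‖ = 1 → ∀ z ∈ G, revolve σ z ∈ Ω) {z : ℂ}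
    (hz : z ∈ G) : HasFDerivAt (orbitDeriv u) (orbitDerivTwo u z) z := by
  refine hasFDerivAt_sphere_integral (K := fun z σ => (fderiv ℝ u (revolve σ z)).comp (revolve σ))
    hG (continuousOn_orbitDeriv_integrand hΩ hu hGΩ)
    (continuousOn_orbitDerivTwo_integrand hΩ hu hGΩ) (fun p hp σ => ?_) hz
  have h1 : DifferentiableAt ℝ (fderiv ℝ u) (revolve σ p) :=
    ((continuousOn_fderiv_of_two hΩ hu).differentiableOn (by norm_num)).differentiableAt
      (hΩ.mem_nhds (hGΩ _ (mem_sphere_zero_iff_norm.1 σ.2) _ hp))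
  exact ((ContinuousLinearMap.compL ℝ ℂ (EuclideanSpace ℝ (Fin 4)) ℝ).flip
    (revolve σ)).hasFDerivAt.comp p (h1.hasFDerivAt.comp p (revolve σ).hasFDerivAt)

lemma contDiffOn_orbitIntegral (hΩ : IsOpen Ω) (hu : ContDiffOn ℝ 2 u Ω) (hG : IsOpen G)
    (hGΩ : ∀ σ : EuclideanSpace ℝ (Fin 3), ‖σ‖ = 1 → ∀ z ∈ G, revolve σ z ∈ Ω) :
    ContDiffOn ℝ 2 (orbitIntegral u) G := by
  have h2 : ContDiffOn ℝ (1 + 1) (orbitIntegral u) G := by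
    rw [contDiffOn_succ_iff_fderiv_of_isOpen hG]
    refine ⟨fun z hz => (hasFDerivAt_orbitIntegral hΩ hu hG hGΩ hz).differentiableAt
      |>.differentiableWithinAt, by simp, ?_⟩
    refine ContDiffOn.congr (f := orbitDeriv u) ?_ fun z hz =>
      (hasFDerivAt_orbitIntegral hΩ hu hG hGΩ hz).fderiv
    rw [← zero_add (1 : WithTop ℕ∞), contDiffOn_succ_iff_fderiv_of_isOpen hG]
    refine ⟨fun z hz => (hasFDerivAt_orbitDeriv hΩ hu hG hGΩ hz).differentiableAt
      |>.differentiableWithinAt, by simp, ?_⟩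
    refine ContDiffOn.congr (f := orbitDerivTwo u) ?_ fun z hz =>
      (hasFDerivAt_orbitDeriv hΩ hu hG hGΩ hz).fderiv
    rw [contDiffOn_zero]
    exact continuousOn_sphere_integral hG (continuousOn_orbitDerivTwo_integrand hΩ hu hGΩ)
  rwa [one_add_one_eq_two] at h2

lemma integrable_sphere_of_continuousOn {F : Type*} [NormedAddCommGroup F]
    {K : ℂ → Metric.sphere (0 : EuclideanSpace ℝ (Fin 3)) 1 → F}
    (hK : ContinuousOn (Function.uncurry K) (G ×ˢ Set.univ)) {z : ℂ} (hz : z ∈ G) :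
    Integrable (K z) sphereMeasure :=
  (hK.comp_continuous (by fun_prop : Continuous fun σ => (z, σ)) fun σ =>
    ⟨hz, trivial⟩).integrable_of_hasCompactSupport (HasCompactSupport.of_compactSpace _)

lemma orbitDeriv_apply (hΩ : IsOpen Ω) (hu : ContDiffOn ℝ 2 u Ω)
    (hGΩ : ∀ σ : EuclideanSpace ℝ (Fin 3), ‖σ‖ = 1 → ∀ z ∈ G, revolve σ z ∈ Ω) {z : ℂ}
    (hz : z ∈ G) (w : ℂ) :
    orbitDeriv u z w = ∫ σ, fderiv ℝ u (revolve σ z) (revolve σ w) ∂sphereMeasure := by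
  rw [orbitDeriv, ContinuousLinearMap.integral_apply
    (integrable_sphere_of_continuousOn (continuousOn_orbitDeriv_integrand hΩ hu hGΩ) hz)]
  rfl

lemma orbitDerivTwo_apply (hΩ : IsOpen Ω) (hu : ContDiffOn ℝ 2 u Ω)
    (hGΩ : ∀ σ : EuclideanSpace ℝ (Fin 3), ‖σ‖ = 1 → ∀ z ∈ G, revolve σ z ∈ Ω) {z : ℂ}
    (hz : z ∈ G) (w w' : ℂ) :
    orbitDerivTwo u z w w' = ∫ σ, fderiv ℝ (fderiv ℝ u) (revolve σ z) (revolve σ w)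
      (revolve σ w') ∂sphereMeasure := by
  have hi := integrable_sphere_of_continuousOn (F := ℂ →L[ℝ] ℂ →L[ℝ] ℝ)
    (K := fun z σ => ((ContinuousLinearMap.compL ℝ ℂ (EuclideanSpace ℝ (Fin 4)) ℝ).flip
      (revolve σ)).comp ((fderiv ℝ (fderiv ℝ u) (revolve σ z)).comp (revolve σ)))
    (continuousOn_orbitDerivTwo_integrand hΩ hu hGΩ) hz
  rw [orbitDerivTwo, ContinuousLinearMap.integral_apply hi,
    ContinuousLinearMap.integral_apply (hi.apply_continuousLinearMap w)]
  rfl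

set_option maxHeartbeats 400000 in
/-- The integral of the derivative of a function along a rotation field vanishes on orbits. Here
the function is itself the derivative of `u` along the rotation field (divided by `Im z`). -/
lemma integral_rotGen_eq_zero (hΩ : IsOpen Ω) (hu : ContDiffOn ℝ 2 u Ω) {z : ℂ}
    (hz : ∀ σ : EuclideanSpace ℝ (Fin 3), ‖σ‖ = 1 → revolve σ z ∈ Ω) {i j : Fin 3} (hij : i ≠ j) :
    ∫ σ, (z.im * fderiv ℝ (fderiv ℝ u) (revolve σ z) (spaceEmb (rotGen i j σ))
      (spaceEmb (rotGen i j σ)) + fderiv ℝ u (revolve σ z)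
        (spaceEmb (rotGen i j (rotGen i j σ)))) ∂sphereMeasure = 0 := by
  have hrot : Continuous fun q : ℝ × Metric.sphere (0 : EuclideanSpace ℝ (Fin 3)) 1 =>
      rotation i j q.1 q.2 := by
    simp only [rotation_apply]
    fun_prop
  have hmaps : ∀ q : ℝ × Metric.sphere (0 : EuclideanSpace ℝ (Fin 3)) 1,
      revolve (rotation i j q.1 q.2) z ∈ Ω := fun q =>
    hz _ ((norm_rotation hij _ _).trans (mem_sphere_zero_iff_norm.1 q.2.2))
  have hrev : Continuous fun q : ℝ × Metric.sphere (0 : EuclideanSpace ℝ (Fin 3)) 1 =>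
      revolve (rotation i j q.1 q.2) z :=
    (continuous_revolve_clm.comp hrot).clm_apply continuous_const
  have hc1 : Continuous fun q : ℝ × Metric.sphere (0 : EuclideanSpace ℝ (Fin 3)) 1 =>
      fderiv ℝ u (revolve (rotation i j q.1 q.2) z) :=
    (continuousOn_fderiv_of_two hΩ hu).continuousOn.comp_continuous hrev hmaps
  have hc2 : Continuous fun q : ℝ × Metric.sphere (0 : EuclideanSpace ℝ (Fin 3)) 1 =>
      fderiv ℝ (fderiv ℝ u) (revolve (rotation i j q.1 q.2) z) :=
    (continuousOn_fderiv_fderiv_of_two hΩ hu).comp_continuous hrev hmaps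
  have hg1 : Continuous fun q : ℝ × Metric.sphere (0 : EuclideanSpace ℝ (Fin 3)) 1 =>
      spaceEmb (rotGen i j (rotation i j q.1 q.2)) := by fun_prop
  have hg2 : Continuous fun q : ℝ × Metric.sphere (0 : EuclideanSpace ℝ (Fin 3)) 1 =>
      spaceEmb (rotGen i j (rotGen i j (rotation i j q.1 q.2))) := by fun_prop
  set D : ℝ → Metric.sphere (0 : EuclideanSpace ℝ (Fin 3)) 1 → ℝ := fun θ σ =>
    z.im * fderiv ℝ (fderiv ℝ u) (revolve (rotation i j θ σ) z)
      (spaceEmb (rotGen i j (rotation i j θ σ))) (spaceEmb (rotGen i j (rotation i j θ σ))) +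
    fderiv ℝ u (revolve (rotation i j θ σ) z)
      (spaceEmb (rotGen i j (rotGen i j (rotation i j θ σ)))) with hD
  have hDc : Continuous (Function.uncurry D) :=
    (continuous_const.mul ((hc2.clm_apply hg1).clm_apply hg1)).add (hc1.clm_apply hg2)
  have hderiv := hasFDerivAt_sphere_integral (G := Set.univ) isOpen_univ
    (K := fun (θ : ℝ) σ => fderiv ℝ u (revolve (rotation i j θ σ) z)
      (spaceEmb (rotGen i j (rotation i j θ σ))))
    (K' := fun θ σ => (1 : ℝ →L[ℝ] ℝ).smulRight (D θ σ))
    (hc1.clm_apply hg1).continuousOn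
    (((ContinuousLinearMap.smulRightL ℝ ℝ ℝ (1 : ℝ →L[ℝ] ℝ)).continuous.comp hDc).continuousOn)
    (fun θ _ σ => by
      have hmem := hmaps (θ, σ)
      have h1 : HasDerivAt (fun θ => rotation i j θ (σ : EuclideanSpace ℝ (Fin 3)))
        (rotGen i j (rotation i j θ σ)) θ := hasDerivAt_rotation hij θ σ
      have h2 : HasDerivAt (fun θ => revolve (rotation i j θ σ) z)
          (z.im • spaceEmb (rotGen i j (rotation i j θ σ))) θ := by
        simp only [revolve_apply]
        exact (((spaceEmb.hasFDerivAt.comp_hasDerivAt θ h1).const_smul z.im).const_add _)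
      have h3 : DifferentiableAt ℝ (fderiv ℝ u) (revolve (rotation i j θ σ) z) :=
        ((continuousOn_fderiv_of_two hΩ hu).differentiableOn (by norm_num)).differentiableAt
          (hΩ.mem_nhds hmem)
      have h4 := h3.hasFDerivAt.comp_hasDerivAt θ h2
      have h5 := h4.clm_apply
        ((spaceEmb.comp (rotGen i j)).hasFDerivAt.comp_hasDerivAt θ h1)
      convert! h5.hasFDerivAt using 1
      ext
      simp [hD]) (Set.mem_univ (0 : ℝ))
  have hconst : (fun θ : ℝ => ∫ σ, fderiv ℝ u (revolve (rotation i j θ σ) z)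
      (spaceEmb (rotGen i j (rotation i j θ σ))) ∂sphereMeasure) =
      fun _ => ∫ σ, fderiv ℝ u (revolve σ z) (spaceEmb (rotGen i j σ)) ∂sphereMeasure := by
    ext θ
    exact integral_sphere_comp (rotationIsometry hij θ)
      (fun σ => fderiv ℝ u (revolve σ z) (spaceEmb (rotGen i j σ)))
  rw [hconst] at hderiv
  have h0 := hderiv.unique (hasFDerivAt_const _ _)
  have hcD : Continuous (D 0) := hDc.uncurry_left 0
  have hint : Integrable (fun σ => (1 : ℝ →L[ℝ] ℝ).smulRight (D 0 σ)) sphereMeasure :=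
    Continuous.integrable_of_hasCompactSupport
      ((ContinuousLinearMap.smulRightL ℝ ℝ ℝ (1 : ℝ →L[ℝ] ℝ)).continuous.comp hcD)
      (HasCompactSupport.of_compactSpace _)
  have h1 : ∫ σ, (1 : ℝ →L[ℝ] ℝ).smulRight (D 0 σ) 1 ∂sphereMeasure = 0 := by
    rw [← ContinuousLinearMap.integral_apply hint, h0]
    rfl
  simpa [hD, rotation_apply] using h1

end

section

variable {Ω : Set (EuclideanSpace ℝ (Fin 4))} {u : EuclideanSpace ℝ (Fin 4) → ℝ} {G : Set ℂ}

lemma revolve_one (σ : EuclideanSpace ℝ (Fin 3)) : revolve σ 1 = EuclideanSpace.single 0 1 := by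
  simp [revolve_apply]

lemma revolve_I (σ : EuclideanSpace ℝ (Fin 3)) : revolve σ I = spaceEmb σ := by
  simp [revolve_apply]

lemma revolve_ofReal (σ : EuclideanSpace ℝ (Fin 3)) (x : ℝ) :
    revolve σ x = x • EuclideanSpace.single 0 1 := by
  simp [revolve_apply]

lemma spaceEmb_single (k : Fin 3) :
    spaceEmb (EuclideanSpace.single k 1) = EuclideanSpace.single k.succ 1 := by
  rw [spaceEmb_apply]
  ext i
  fin_cases k <;> fin_cases i <;> simp

lemma sphereMeasure_real_univ : sphereMeasure.real Set.univ = 4 * Real.pi := by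
  rw [Measure.toSphere_real_apply_univ, measureReal_def, EuclideanSpace.volume_ball_fin_three]
  rw [ENNReal.toReal_mul, ENNReal.toReal_pow, ENNReal.toReal_ofReal one_pos.le,
    ENNReal.toReal_ofReal (by positivity)]
  simp
  ring

lemma orbitIntegral_ofReal (u : EuclideanSpace ℝ (Fin 4) → ℝ) (x : ℝ) :
    orbitIntegral u x = 4 * Real.pi * u (x • EuclideanSpace.single 0 1) := by
  simp only [orbitIntegral, revolve_ofReal, integral_const, sphereMeasure_real_univ, smul_eq_mul]

/-- The Laplace equation in `ℝ⁴`, split into the axial, radial and spherical parts. -/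
lemma sum_fderiv_fderiv_eq_zero (hu : InnerProductSpace.HarmonicOnNhd u Ω)
    {x : EuclideanSpace ℝ (Fin 4)} (hx : x ∈ Ω) :
    fderiv ℝ (fderiv ℝ u) x (EuclideanSpace.single 0 1) (EuclideanSpace.single 0 1) +
      ∑ k : Fin 3, fderiv ℝ (fderiv ℝ u) x (spaceEmb (EuclideanSpace.single k 1))
        (spaceEmb (EuclideanSpace.single k 1)) = 0 := by
  have h := (hu x hx).2.eq_of_nhds
  rw [congrFun (InnerProductSpace.laplacian_eq_iteratedFDeriv_orthonormalBasis u
    (EuclideanSpace.basisFun (Fin 4) ℝ)) x] at h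
  simp only [iteratedFDeriv_two_apply, EuclideanSpace.basisFun_apply, Fin.sum_univ_succ (n := 3),
    Matrix.cons_val_zero, Matrix.cons_val_one] at h
  simpa only [spaceEmb_single, Pi.zero_apply] using h

/-- The Darboux-type equation satisfied by orbit integrals of harmonic functions. -/
lemma orbitIntegral_darboux (hΩ : IsOpen Ω) (hu : InnerProductSpace.HarmonicOnNhd u Ω)
    (hGΩ : ∀ σ : EuclideanSpace ℝ (Fin 3), ‖σ‖ = 1 → ∀ z ∈ G, revolve σ z ∈ Ω) {z : ℂ}
    (hz : z ∈ G) :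
    z.im * (orbitDerivTwo u z 1 1 + orbitDerivTwo u z I I) + 2 * orbitDeriv u z I = 0 := by
  have hu2 : ContDiffOn ℝ 2 u Ω := hu.contDiffOn
  have hzΩ : ∀ σ : EuclideanSpace ℝ (Fin 3), ‖σ‖ = 1 → revolve σ z ∈ Ω := fun σ hσ => hGΩ σ hσ z hz
  have hrev : Continuous fun σ : Metric.sphere (0 : EuclideanSpace ℝ (Fin 3)) 1 => revolve σ z :=
    (continuous_revolve_clm.comp continuous_subtype_val).clm_apply continuous_const
  have hc1 : Continuous fun σ : Metric.sphere (0 : EuclideanSpace ℝ (Fin 3)) 1 =>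
      fderiv ℝ u (revolve σ z) :=
    (continuousOn_fderiv_of_two hΩ hu2).continuousOn.comp_continuous hrev fun σ =>
      hzΩ σ (mem_sphere_zero_iff_norm.1 σ.2)
  have hc2 : Continuous fun σ : Metric.sphere (0 : EuclideanSpace ℝ (Fin 3)) 1 =>
      fderiv ℝ (fderiv ℝ u) (revolve σ z) :=
    (continuousOn_fderiv_fderiv_of_two hΩ hu2).comp_continuous hrev fun σ =>
      hzΩ σ (mem_sphere_zero_iff_norm.1 σ.2)
  have hJ : ∀ J : EuclideanSpace ℝ (Fin 3) →L[ℝ] EuclideanSpace ℝ (Fin 3),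
      Continuous fun σ : Metric.sphere (0 : EuclideanSpace ℝ (Fin 3)) 1 => spaceEmb (J σ) :=
    fun J => (spaceEmb.continuous.comp J.continuous).comp continuous_subtype_val
  have hint : ∀ {g : Metric.sphere (0 : EuclideanSpace ℝ (Fin 3)) 1 → ℝ}, Continuous g →
      Integrable g sphereMeasure := fun hg =>
    hg.integrable_of_hasCompactSupport (HasCompactSupport.of_compactSpace _)
  have hi : ∀ i j : Fin 3, Integrable (fun σ : Metric.sphere (0 : EuclideanSpace ℝ (Fin 3)) 1 =>
      z.im * fderiv ℝ (fderiv ℝ u) (revolve σ z) (spaceEmb (rotGen i j σ))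
      (spaceEmb (rotGen i j σ)) + fderiv ℝ u (revolve σ z)
        (spaceEmb (rotGen i j (rotGen i j σ)))) sphereMeasure := fun i j =>
    hint ((continuous_const.mul ((hc2.clm_apply (hJ _)).clm_apply (hJ _))).add
      (hc1.clm_apply (hJ ((rotGen i j).comp (rotGen i j)))))
  have e1 := integral_rotGen_eq_zero hΩ hu2 hzΩ (i := 0) (j := 1) (by decide)
  have e2 := integral_rotGen_eq_zero hΩ hu2 hzΩ (i := 0) (j := 2) (by decide)
  have e3 := integral_rotGen_eq_zero hΩ hu2 hzΩ (i := 1) (j := 2) (by decide)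
  have hsum : ∫ σ, (z.im * (fderiv ℝ (fderiv ℝ u) (revolve σ z) (revolve σ 1) (revolve σ 1) +
      fderiv ℝ (fderiv ℝ u) (revolve σ z) (revolve σ I) (revolve σ I)) +
      2 * fderiv ℝ u (revolve σ z) (revolve σ I)) ∂sphereMeasure = 0 := by
    have e4 := integral_add ((hi 0 1).add (hi 0 2)) (hi 1 2)
    rw [integral_add' (hi 0 1) (hi 0 2), e1, e2, e3, add_zero, add_zero] at e4
    rw [← neg_eq_zero, ← integral_neg, ← e4]
    congr 1
    ext σ
    have hσ : ‖(σ : EuclideanSpace ℝ (Fin 3))‖ = 1 := mem_sphere_zero_iff_norm.1 σ.2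
    have hsymm : ∀ x y, fderiv ℝ (fderiv ℝ u) (revolve σ z) x y =
        fderiv ℝ (fderiv ℝ u) (revolve σ z) y x :=
      (hu _ (hzΩ σ hσ)).1.isSymmSndFDerivAt (by simp)
    have hB := sum_rotGen_bilin (((fderiv ℝ (fderiv ℝ u) (revolve σ z)).bilinearComp
      spaceEmb spaceEmb)) (fun x y => hsymm _ _) hσ
    simp only [ContinuousLinearMap.bilinearComp_apply] at hB
    have hL := sum_fderiv_fderiv_eq_zero hu (hzΩ σ hσ)
    have hS := congrArg (fun w => fderiv ℝ u (revolve σ z) (spaceEmb w)) (sum_rotGen_sq σ)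
    simp only [map_add, map_smul, smul_eq_mul] at hS
    simp only [revolve_one, revolve_I, Pi.add_apply]
    linear_combination -z.im * hB - hS - z.im * hL
  have hcr : ∀ w : ℂ, Continuous fun σ : Metric.sphere (0 : EuclideanSpace ℝ (Fin 3)) 1 =>
      revolve σ w := fun w =>
    (continuous_revolve_clm.comp continuous_subtype_val).clm_apply continuous_const
  have hI : ∀ w : ℂ, Integrable (fun σ : Metric.sphere (0 : EuclideanSpace ℝ (Fin 3)) 1 =>
      fderiv ℝ (fderiv ℝ u) (revolve σ z) (revolve σ w) (revolve σ w)) sphereMeasure := fun w =>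
    hint ((hc2.clm_apply (hcr w)).clm_apply (hcr w))
  have hI' : Integrable (fun σ : Metric.sphere (0 : EuclideanSpace ℝ (Fin 3)) 1 =>
      fderiv ℝ u (revolve σ z) (revolve σ I)) sphereMeasure := hint (hc1.clm_apply (hcr I))
  rw [integral_add (((hI 1).fun_add (hI I)).const_mul _) (hI'.const_mul 2), integral_const_mul,
    integral_const_mul, integral_add (hI 1) (hI I)] at hsum
  rw [orbitDeriv_apply hΩ hu2 hGΩ hz, orbitDerivTwo_apply hΩ hu2 hGΩ hz,
    orbitDerivTwo_apply hΩ hu2 hGΩ hz, hsum]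

/-- The function `Im z` times the orbit integral at `z`, which is harmonic if `u` is. -/
def orbitPotential (u : EuclideanSpace ℝ (Fin 4) → ℝ) (z : ℂ) : ℝ := z.im * orbitIntegral u z

lemma hasFDerivAt_orbitPotential (hΩ : IsOpen Ω) (hu : ContDiffOn ℝ 2 u Ω) (hG : IsOpen G)
    (hGΩ : ∀ σ : EuclideanSpace ℝ (Fin 3), ‖σ‖ = 1 → ∀ z ∈ G, revolve σ z ∈ Ω) {z : ℂ}
    (hz : z ∈ G) : HasFDerivAt (orbitPotential u)
      (z.im • orbitDeriv u z + orbitIntegral u z • imCLM) z :=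
  imCLM.hasFDerivAt.mul (hasFDerivAt_orbitIntegral hΩ hu hG hGΩ hz)

theorem harmonicOnNhd_orbitPotential (hΩ : IsOpen Ω) (hu : InnerProductSpace.HarmonicOnNhd u Ω)
    (hG : IsOpen G)
    (hGΩ : ∀ σ : EuclideanSpace ℝ (Fin 3), ‖σ‖ = 1 → ∀ z ∈ G, revolve σ z ∈ Ω) :
    InnerProductSpace.HarmonicOnNhd (orbitPotential u) G := by
  intro z hz
  have hu2 : ContDiffOn ℝ 2 u Ω := hu.contDiffOn
  refine ⟨(imCLM.contDiff.contDiffAt).mul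
    ((contDiffOn_orbitIntegral hΩ hu2 hG hGΩ).contDiffAt (hG.mem_nhds hz)), ?_⟩
  filter_upwards [hG.mem_nhds hz] with w hw
  have h1 : fderiv ℝ (orbitPotential u) =ᶠ[nhds w]
      fun z => z.im • orbitDeriv u z + orbitIntegral u z • imCLM := by
    filter_upwards [hG.mem_nhds hw] with y hy
    exact (hasFDerivAt_orbitPotential hΩ hu2 hG hGΩ hy).fderiv
  have h2 : HasFDerivAt (fun z => z.im • orbitDeriv u z + orbitIntegral u z • imCLM)
      (w.im • orbitDerivTwo u w + imCLM.smulRight (orbitDeriv u w) +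
        (orbitDeriv u w).smulRight imCLM) w :=
    (imCLM.hasFDerivAt.smul (hasFDerivAt_orbitDeriv hΩ hu2 hG hGΩ hw)).add
      ((hasFDerivAt_orbitIntegral hΩ hu2 hG hGΩ hw).smul_const imCLM)
  rw [congrFun (InnerProductSpace.laplacian_eq_iteratedFDeriv_complexPlane _) w]
  simp only [iteratedFDeriv_two_apply, h1.fderiv_eq, h2.fderiv]
  have h3 := orbitIntegral_darboux hΩ hu hGΩ hw
  simp
  linear_combination h3

end

/-! ### Green's formula for analytic functions in the unit disk -/

lemma integral_exp_int_mul_I (k : ℤ) :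
    ∫ θ in Set.Ioo (-Real.pi) Real.pi, exp (k * θ * I) =
      if k = 0 then (2 * Real.pi : ℂ) else 0 := by
  rw [← integral_Ioc_eq_integral_Ioo,
    ← intervalIntegral.integral_of_le (by linarith [Real.pi_pos])]
  split_ifs with hk
  · subst hk
    simp
    ring
  · have hk' : (k : ℂ) * I ≠ 0 := mul_ne_zero (by exact_mod_cast hk) I_ne_zero
    have h : ∀ θ : ℝ, exp (k * θ * I) = exp (k * I * θ) := fun θ => by ring_nf
    simp_rw [h]
    rw [integral_exp_mul_complex hk', div_eq_zero_iff, sub_eq_zero]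
    left
    rw [exp_eq_exp_iff_exists_int]
    exact ⟨k, by push_cast; ring⟩

lemma setIntegral_ball_pow_mul_conj_pow (n m : ℕ) :
    ∫ z in Metric.ball (0 : ℂ) 1, z ^ n * (starRingEnd ℂ) z ^ m =
      if n = m then (Real.pi / (n + 1) : ℂ) else 0 := by
  rw [← integral_indicator measurableSet_ball, ← Complex.integral_comp_polarCoord_symm]
  have h1 : ∀ p ∈ polarCoord.target, p.1 • (Metric.ball (0 : ℂ) 1).indicator
      (fun z => z ^ n * (starRingEnd ℂ) z ^ m) (Complex.polarCoord.symm p) =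
      (Set.Ioo (0 : ℝ) 1).indicator (fun r => ((r ^ (n + m + 1) : ℝ) : ℂ)) p.1 *
        exp (((n - m : ℤ) : ℂ) * p.2 * I) := by
    rintro ⟨r, θ⟩ ⟨hr, hθ⟩
    simp only [Set.mem_Ioi] at hr
    have hs : Complex.polarCoord.symm (r, θ) = r * exp (θ * I) := by
      rw [Complex.polarCoord_symm_apply, exp_mul_I]
      push_cast
      ring
    by_cases hr1 : r < 1
    · rw [Set.indicator_of_mem (by simpa [abs_of_pos hr] using hr1),
        Set.indicator_of_mem (Set.mem_Ioo.2 ⟨hr, hr1⟩), hs, map_mul, conj_ofReal, ← exp_conj,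
        map_mul, conj_ofReal, conj_I, mul_pow, mul_pow, ← exp_nat_mul, ← exp_nat_mul, real_smul]
      rw [show (((n - m : ℤ) : ℂ) * θ * I) = n * (θ * I) + m * (θ * -I) by push_cast; ring, exp_add]
      push_cast
      ring
    · rw [Set.indicator_of_notMem (by simpa [abs_of_pos hr] using hr1),
        Set.indicator_of_notMem (fun h => hr1 h.2)]
      simp
  rw [setIntegral_congr_fun polarCoord.open_target.measurableSet h1, polarCoord_target,
    Measure.volume_eq_prod, setIntegral_prod_mul
    ((Set.Ioo (0 : ℝ) 1).indicator fun r => ((r ^ (n + m + 1) : ℝ) : ℂ))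
    (fun θ : ℝ => exp (((n - m : ℤ) : ℂ) * θ * I)), integral_exp_int_mul_I,
    setIntegral_indicator measurableSet_Ioo, Set.inter_eq_right.2 Set.Ioo_subset_Ioi_self,
    ← integral_Ioc_eq_integral_Ioo, ← intervalIntegral.integral_of_le zero_le_one,
    intervalIntegral.integral_ofReal, integral_pow]
  by_cases h : n = m
  · subst h
    have : (n : ℂ) + 1 ≠ 0 := by exact_mod_cast n.succ_ne_zero
    simp
    rw [show (n : ℂ) + n + 1 + 1 = 2 * (n + 1) by ring]
    field_simp
  · rw [if_neg h, if_neg (by omega), mul_zero]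

lemma circleIntegral_pow_mul_conj_pow (n m : ℕ) :
    (∮ z in C(0, 1), z ^ n * (starRingEnd ℂ) z ^ (m + 1)) =
      if n = m then 2 * Real.pi * I else 0 := by
  have h : Set.EqOn (fun z : ℂ => z ^ n * (starRingEnd ℂ) z ^ (m + 1))
      (fun z => z ^ ((n : ℤ) - m - 1)) (Metric.sphere 0 1) := fun z hz => by
    have hz1 : ‖z‖ = 1 := by simpa using hz
    have hz0 : z ≠ 0 := by rintro rfl; simp at hz1
    have hc : (starRingEnd ℂ) z = z⁻¹ := by
      rw [inv_def, normSq_eq_norm_sq, hz1]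
      simp
    simp only [hc]
    rw [show (n : ℤ) - m - 1 = n - ((m + 1 : ℕ) : ℤ) by push_cast; ring, zpow_sub₀ hz0, inv_pow,
      zpow_natCast, zpow_natCast, div_eq_mul_inv]
  rw [circleIntegral.integral_congr zero_le_one h, circleIntegral_zpow]
  exact if_congr (by omega) rfl rfl

lemma hasSum_integral_of_norm_le {α ι E : Type*} [MeasurableSpace α] {μ : Measure α}
    [IsFiniteMeasure μ] [Countable ι] [NormedAddCommGroup E] [NormedSpace ℝ E]
    {F : ι → α → E} {g : α → E} {B : ι → ℝ} (hF : ∀ i, AEStronglyMeasurable (F i) μ)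
    (hB : ∀ i, ∀ᵐ x ∂μ, ‖F i x‖ ≤ B i) (hs : Summable B)
    (hg : ∀ᵐ x ∂μ, HasSum (fun i => F i x) (g x)) :
    HasSum (fun i => ∫ x, F i x ∂μ) (∫ x, g x ∂μ) :=
  hasSum_integral_of_dominated_convergence (fun i _ => B i) hF hB (.of_forall fun _ => hs)
    (integrable_const _) hg

/-- Taylor coefficients at the origin. -/
def taylorCoeff (A : ℂ → ℂ) (n : ℕ) : ℂ := (n.factorial : ℂ)⁻¹ * iteratedDeriv n A 0

lemma hasSum_taylorCoeff {A : ℂ → ℂ} {R : ℝ} (hA : DifferentiableOn ℂ A (Metric.ball 0 R)) {z : ℂ}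
    (hz : ‖z‖ < R) : HasSum (fun n => taylorCoeff A n * z ^ n) (A z) := by
  convert! hasSum_taylorSeries_on_ball hA (z := z) (by simpa using hz) using 2 with n
  simp [taylorCoeff]
  ring

lemma summable_norm_taylorCoeff {A : ℂ → ℂ} {R : ℝ} (hR : 1 < R)
    (hA : DifferentiableOn ℂ A (Metric.ball 0 R)) : Summable fun n => ‖taylorCoeff A n‖ := by
  simpa using (hasSum_taylorCoeff hA (z := 1) (by simpa using hR)).summable.norm

lemma taylorCoeff_deriv (B : ℂ → ℂ) (n : ℕ) :
    taylorCoeff (deriv B) n = (n + 1) * taylorCoeff B (n + 1) := by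
  have h1 : ((n : ℂ) + 1) ≠ 0 := by exact_mod_cast n.succ_ne_zero
  have h2 : (n.factorial : ℂ) ≠ 0 := by exact_mod_cast n.factorial_ne_zero
  rw [taylorCoeff, taylorCoeff, ← iteratedDeriv_succ', Nat.factorial_succ]
  push_cast
  field_simp

lemma summable_norm_mul_norm {c d : ℕ → ℂ} (hc : Summable fun n => ‖c n‖)
    (hd : Summable fun n => ‖d n‖) : Summable fun q : ℕ × ℕ => ‖c q.1‖ * ‖d q.2‖ :=
  Summable.mul_of_nonneg (f := fun n => ‖c n‖) (g := fun n => ‖d n‖) hc hd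
    (fun _ => norm_nonneg _) fun _ => norm_nonneg _

lemma hasSum_mul_conj {c d : ℕ → ℂ} (hc : Summable fun n => ‖c n‖) (hd : Summable fun n => ‖d n‖)
    {z x y : ℂ} (hz : ‖z‖ ≤ 1) (e : ℕ → ℕ) (hx : HasSum (fun n => c n * z ^ n) x)
    (hy : HasSum (fun n => d n * z ^ e n) y) :
    HasSum (fun q : ℕ × ℕ => c q.1 * (starRingEnd ℂ) (d q.2) *
      (z ^ q.1 * (starRingEnd ℂ) z ^ e q.2)) (x * (starRingEnd ℂ) y) := by
  have h1 : ∀ q : ℕ × ℕ, c q.1 * (starRingEnd ℂ) (d q.2) *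
      (z ^ q.1 * (starRingEnd ℂ) z ^ e q.2) =
      c q.1 * z ^ q.1 * (starRingEnd ℂ) (d q.2 * z ^ e q.2) := fun q => by
    rw [map_mul, map_pow]; ring
  have h2 : ∀ (c : ℂ) (n : ℕ), ‖c * z ^ n‖ ≤ ‖c‖ := fun c n => by
    rw [norm_mul, norm_pow]
    exact mul_le_of_le_one_right (norm_nonneg _) (pow_le_one₀ (norm_nonneg _) hz)
  have h3 : HasSum (fun n => (starRingEnd ℂ) (d n * z ^ e n)) ((starRingEnd ℂ) y) := by
    rw [hasSum_conj, conj_conj]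
    simpa only [conj_conj] using hy
  have h4 := summable_norm_mul_norm hc hd
  have h5 : Summable fun q : ℕ × ℕ => c q.1 * z ^ q.1 * (starRingEnd ℂ) (d q.2 * z ^ e q.2) := by
    refine Summable.of_norm_bounded h4 fun q => ?_
    rw [norm_mul, RCLike.norm_conj]
    exact mul_le_mul (h2 _ _) (h2 _ _) (norm_nonneg _) (norm_nonneg _)
  have h6 := hx.mul h3 h5
  rw [funext h1]
  exact h6

lemma norm_mul_conj_le (c d : ℂ) {z : ℂ} (hz : ‖z‖ ≤ 1) (n m : ℕ) :
    ‖c * (starRingEnd ℂ) d * (z ^ n * (starRingEnd ℂ) z ^ m)‖ ≤ ‖c‖ * ‖d‖ := by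
  simp only [norm_mul, norm_pow, RCLike.norm_conj]
  exact mul_le_of_le_one_right (by positivity) (mul_le_one₀ (pow_le_one₀ (norm_nonneg _) hz)
    (by positivity) (pow_le_one₀ (norm_nonneg _) hz))

lemma hasSum_setIntegral_ball {c d : ℕ → ℂ} (hc : Summable fun n => ‖c n‖)
    (hd : Summable fun n => ‖d n‖) {A B : ℂ → ℂ}
    (hA : ∀ z : ℂ, ‖z‖ ≤ 1 → HasSum (fun n => c n * z ^ n) (A z))
    (hB : ∀ z : ℂ, ‖z‖ ≤ 1 → HasSum (fun n => d n * z ^ n) (B z)) :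
    HasSum (fun q : ℕ × ℕ => c q.1 * (starRingEnd ℂ) (d q.2) *
      if q.1 = q.2 then (Real.pi / (q.1 + 1) : ℂ) else 0)
      (∫ z in Metric.ball (0 : ℂ) 1, A z * (starRingEnd ℂ) (B z)) := by
  have hfin : IsFiniteMeasure (volume.restrict (Metric.ball (0 : ℂ) 1)) :=
    ⟨by simp⟩
  have h := hasSum_integral_of_norm_le (μ := volume.restrict (Metric.ball (0 : ℂ) 1))
    (F := fun (q : ℕ × ℕ) (z : ℂ) => c q.1 * (starRingEnd ℂ) (d q.2) *
      (z ^ q.1 * (starRingEnd ℂ) z ^ q.2)) (g := fun z => A z * (starRingEnd ℂ) (B z))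
    (B := fun q => ‖c q.1‖ * ‖d q.2‖) (fun q => Continuous.aestronglyMeasurable (by fun_prop))
    (fun q => ?_) (summable_norm_mul_norm hc hd) ?_
  · simpa only [integral_const_mul, setIntegral_ball_pow_mul_conj_pow] using h
  all_goals
    filter_upwards [ae_restrict_mem measurableSet_ball] with z hz
    have hz1 : ‖z‖ ≤ 1 := by simpa using (Metric.mem_ball.1 hz).le
  · exact norm_mul_conj_le _ _ hz1 _ _
  · exact hasSum_mul_conj hc hd hz1 (fun n => n) (hA z hz1) (hB z hz1)

lemma hasSum_circleIntegral_mul_conj {c d : ℕ → ℂ} (hc : Summable fun n => ‖c n‖)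
    (hd : Summable fun n => ‖d n‖) {A B : ℂ → ℂ}
    (hA : ∀ z : ℂ, ‖z‖ ≤ 1 → HasSum (fun n => c n * z ^ n) (A z))
    (hB : ∀ z : ℂ, ‖z‖ ≤ 1 → HasSum (fun n => d n * z ^ (n + 1)) (B z)) :
    HasSum (fun q : ℕ × ℕ => c q.1 * (starRingEnd ℂ) (d q.2) *
      if q.1 = q.2 then (2 * Real.pi * I : ℂ) else 0)
      (∮ z in C(0, 1), A z * (starRingEnd ℂ) (B z)) := by
  have hz1 : ∀ θ, ‖circleMap 0 1 θ‖ ≤ 1 := by simp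
  have h := hasSum_intervalIntegral_of_le (F := fun (q : ℕ × ℕ) (θ : ℝ) =>
      deriv (circleMap 0 1) θ • (c q.1 * (starRingEnd ℂ) (d q.2) *
      (circleMap 0 1 θ ^ q.1 * (starRingEnd ℂ) (circleMap 0 1 θ) ^ (q.2 + 1))))
    (B := fun q => ‖c q.1‖ * ‖d q.2‖) 0 (2 * Real.pi) (fun q => ?_) (fun q θ => ?_)
    (summable_norm_mul_norm hc hd)
    (fun θ => (hasSum_mul_conj hc hd (hz1 θ) (fun n => n + 1) (hA _ (hz1 θ))
      (hB _ (hz1 θ))).const_smul (deriv (circleMap 0 1) θ))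
  · convert! h using 2 with q
    change _ = ∮ z in C(0, 1), _ * (z ^ q.1 * (starRingEnd ℂ) z ^ (q.2 + 1))
    rw [circleIntegral.integral_const_mul, circleIntegral_pow_mul_conj_pow]
  · simp only [deriv_circleMap]
    fun_prop
  · rw [norm_smul]
    simp

/-- Green's formula `∫ A conj(B') = (1/2i) ∮ A conj(B) dz` in the unit disk, for functions analytic
in a larger disk. By expansion into power series it reduces to monomials. -/
theorem setIntegral_ball_mul_conj_deriv {A B : ℂ → ℂ} {R : ℝ} (hR : 1 < R)
    (hA : DifferentiableOn ℂ A (Metric.ball 0 R)) (hB : DifferentiableOn ℂ B (Metric.ball 0 R))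
    (hB0 : B 0 = 0) :
    2 * I * ∫ z in Metric.ball (0 : ℂ) 1, A z * (starRingEnd ℂ) (deriv B z) =
      ∮ z in C(0, 1), A z * (starRingEnd ℂ) (B z) := by
  have hB' : DifferentiableOn ℂ (deriv B) (Metric.ball 0 R) := hB.deriv Metric.isOpen_ball
  have hsA := summable_norm_taylorCoeff hR hA
  have h1 := hasSum_setIntegral_ball hsA (summable_norm_taylorCoeff hR hB')
    (fun z hz => hasSum_taylorCoeff hA (hz.trans_lt hR))
    (fun z hz => hasSum_taylorCoeff hB' (hz.trans_lt hR))
  have h2 := hasSum_circleIntegral_mul_conj hsA (d := fun n => taylorCoeff B (n + 1))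
    ((summable_nat_add_iff 1).2 (summable_norm_taylorCoeff hR hB))
    (fun z hz => hasSum_taylorCoeff hA (hz.trans_lt hR))
    (fun z hz => by
      have := (hasSum_nat_add_iff' 1).2 (hasSum_taylorCoeff hB (hz.trans_lt hR))
      simpa [taylorCoeff, hB0] using this)
  refine (h1.mul_left (2 * I)).unique ?_
  convert! h2 using 2 with q
  split_ifs with hq
  · have : (q.2 : ℂ) + 1 ≠ 0 := by exact_mod_cast q.2.succ_ne_zero
    rw [taylorCoeff_deriv, hq, map_mul, map_add, map_one, map_natCast]
    field_simp
  · simp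

/-! ### Moments of the weight `Im f |f'|²` over the unit disk -/

section

lemma deriv_zero_of_hasSum {c : ℕ → ℂ} {A : ℂ → ℂ} {r : ℝ} (hr : 0 < r)
    (hA : ∀ z : ℂ, ‖z‖ < r → HasSum (fun n => c n * z ^ n) (A z)) : deriv A 0 = c 1 := by
  have h : HasFPowerSeriesAt A (FormalMultilinearSeries.ofScalars ℂ c) 0 := by
    rw [hasFPowerSeriesAt_iff]
    filter_upwards [Metric.ball_mem_nhds (0 : ℂ) hr] with z hz
    simpa [FormalMultilinearSeries.coeff_ofScalars, mul_comm] using hA z (by simpa using hz)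
  rw [h.deriv]
  simp

variable {a C : ℝ}

/-- The density `Im f |f'|²`, which is the pull-back of the measure `y dx dy` under `f`. -/
def pullbackWeight (a C : ℝ) (z : ℂ) : ℝ := (f a C z).im * ‖fDeriv a C z‖ ^ 2

lemma differentiableOn_f (ha : 0 < a) (ha1 : a ≤ 1 / 2) (hC : 0 ≤ C) :
    DifferentiableOn ℂ (f a C) (Metric.ball 0 a⁻¹) :=
  (f_analyticOnNhd ha ha1 hC).differentiableOn

lemma deriv_f (ha : 0 < a) (ha1 : a ≤ 1 / 2) (hC : 0 ≤ C) {z : ℂ} (hz : ‖z‖ < a⁻¹) :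
    deriv (f a C) z = fDeriv a C z := (hasDerivAt_f ha ha1 hC hz).deriv

lemma differentiableOn_fDeriv (ha : 0 < a) (ha1 : a ≤ 1 / 2) (hC : 0 ≤ C) :
    DifferentiableOn ℂ (fDeriv a C) (Metric.ball 0 a⁻¹) :=
  ((differentiableOn_f ha ha1 hC).deriv Metric.isOpen_ball).congr fun _ hz =>
    (deriv_f ha ha1 hC (by simpa using hz)).symm

lemma fDeriv_zero (ha : 0 < a) (ha1 : a ≤ 1 / 2) (hC : 0 ≤ C) :
    fDeriv a C 0 = mapCoeff a C 1 := by
  rw [← deriv_f ha ha1 hC (by simpa using ha)]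
  exact deriv_zero_of_hasSum (inv_pos.2 ha) (c := fun n => (mapCoeff a C n : ℂ))
    fun z hz => hasSum_f ha ha1 hC hz

lemma deriv_fDeriv_zero (ha : 0 < a) (ha1 : a ≤ 1 / 2) (hC : 0 ≤ C) :
    deriv (fDeriv a C) 0 = 2 * mapCoeff a C 2 := by
  rw [deriv_zero_of_hasSum (inv_pos.2 ha)
    (c := fun n : ℕ => ((n + 1) * mapCoeff a C (n + 1) : ℂ)) fun z hz => hasSum_fDeriv ha ha1 hC hz]
  norm_num

/-- The moments of the weight as contour integrals, by Green's formula: on the unit circle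
`h = f - conj f`. -/
lemma setIntegral_pullbackWeight_mul (ha : 0 < a) (ha1 : a ≤ 1 / 2) (hC : 0 ≤ C) {G : ℂ → ℂ}
    {R : ℝ} (hR : 1 < R) (hRa : R ≤ a⁻¹) (hG : DifferentiableOn ℂ G (Metric.ball 0 R)) :
    8 * ∫ z in Metric.ball (0 : ℂ) 1, (pullbackWeight a C z : ℂ) * G z =
      ∮ z in C(0, 1), G z * fDeriv a C z * h a C z ^ 2 := by
  have hsub : Metric.ball (0 : ℂ) R ⊆ Metric.ball 0 a⁻¹ := Metric.ball_subset_ball hRa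
  have hf := (differentiableOn_f ha ha1 hC).mono hsub
  have hf' := (differentiableOn_fDeriv ha ha1 hC).mono hsub
  have hball : Metric.closedBall (0 : ℂ) 1 ⊆ Metric.ball 0 R := Metric.closedBall_subset_ball hR
  have h1 := setIntegral_ball_mul_conj_deriv hR ((hG.fun_mul hf).fun_mul hf') hf (f_zero ha ha1 hC)
  have h2 := setIntegral_ball_mul_conj_deriv hR (hG.fun_mul hf') (hf.fun_pow 2)
    (by simp [f_zero ha ha1 hC])
  have hcG := hG.continuousOn.mono hball
  have hcf := hf.continuousOn.mono hball
  have hcf' := hf'.continuousOn.mono hball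
  have hcc : ∀ {A : ℂ → ℂ} {s : Set ℂ}, ContinuousOn A s →
      ContinuousOn (fun z => (starRingEnd ℂ) (A z)) s := fun h =>
    continuous_conj.comp_continuousOn h
  have hint : ∀ {A : ℂ → ℂ}, ContinuousOn A (Metric.closedBall 0 1) →
      IntegrableOn A (Metric.ball 0 1) := fun h =>
    (h.integrableOn_compact (isCompact_closedBall _ _)).mono_set Metric.ball_subset_closedBall
  -- `Im f |f'|² = (f f' conj f' - f' conj f conj f') / 2i`, and `2 f f'` is the derivative of `f²`
  have h3 : ∫ z in Metric.ball (0 : ℂ) 1, (pullbackWeight a C z : ℂ) * G z =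
      (2 * I)⁻¹ * ((∫ z in Metric.ball (0 : ℂ) 1, G z * f a C z * fDeriv a C z *
        (starRingEnd ℂ) (fDeriv a C z)) - 1 / 2 * ∫ z in Metric.ball (0 : ℂ) 1,
        G z * fDeriv a C z * (starRingEnd ℂ) (2 * f a C z * fDeriv a C z)) := by
    rw [← integral_const_mul, ← integral_sub
      (hint (((hcG.fun_mul hcf).fun_mul hcf').fun_mul (hcc hcf')))
      ((hint ((hcG.fun_mul hcf').fun_mul
        (hcc ((continuousOn_const.fun_mul hcf).fun_mul hcf')))).const_mul _),
      ← integral_const_mul]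
    congr 1
    ext z
    have e1 : ((f a C z).im : ℂ) = (f a C z - (starRingEnd ℂ) (f a C z)) / (2 * I) := by
      rw [sub_conj]
      push_cast
      field_simp
    have e2 : ((‖fDeriv a C z‖ ^ 2 : ℝ) : ℂ) = fDeriv a C z * (starRingEnd ℂ) (fDeriv a C z) := by
      rw [mul_conj, normSq_eq_norm_sq]
    rw [pullbackWeight, ofReal_mul, e1, e2, map_mul, map_mul, Complex.conj_ofNat]
    field_simp
  have h4 : ∫ z in Metric.ball (0 : ℂ) 1, G z * f a C z * fDeriv a C z *
        (starRingEnd ℂ) (fDeriv a C z) = (2 * I)⁻¹ *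
        ∮ z in C(0, 1), G z * f a C z * fDeriv a C z * (starRingEnd ℂ) (f a C z) := by
    rw [eq_inv_mul_iff_mul_eq₀ (by simp), ← h1]
    congr 1
    refine setIntegral_congr_fun measurableSet_ball fun z hz => ?_
    have : ‖z‖ < a⁻¹ := by simpa using hsub (hball (Metric.ball_subset_closedBall hz))
    simp only [deriv_f ha ha1 hC this]
  have h5 : ∫ z in Metric.ball (0 : ℂ) 1, G z * fDeriv a C z *
        (starRingEnd ℂ) (2 * f a C z * fDeriv a C z) = (2 * I)⁻¹ *
        ∮ z in C(0, 1), G z * fDeriv a C z * (starRingEnd ℂ) (f a C z ^ 2) := by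
    rw [eq_inv_mul_iff_mul_eq₀ (by simp), ← h2]
    congr 1
    refine setIntegral_congr_fun measurableSet_ball fun z hz => ?_
    have : ‖z‖ < a⁻¹ := by simpa using hsub (hball (Metric.ball_subset_closedBall hz))
    simp only [((hasDerivAt_f ha ha1 hC this).fun_pow 2).deriv]
    simp
  have h6 : (∮ z in C(0, 1), G z * fDeriv a C z * f a C z ^ 2) = 0 :=
    (((hG.fun_mul hf').fun_mul (hf.fun_pow 2)).mono
      (hball.trans' (by rw [closure_ball _ one_ne_zero]))).diffContOnCl
      |>.circleIntegral_eq_zero zero_le_one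
  have hsph : Metric.sphere (0 : ℂ) 1 ⊆ Metric.closedBall 0 1 := Metric.sphere_subset_closedBall
  have hcG' := hcG.mono hsph
  have hcs := hcf.mono hsph
  have hcs' := hcf'.mono hsph
  have h7 : (∮ z in C(0, 1), G z * fDeriv a C z * h a C z ^ 2) =
      (∮ z in C(0, 1), G z * fDeriv a C z * f a C z ^ 2) +
      (∮ z in C(0, 1), G z * fDeriv a C z * (starRingEnd ℂ) (f a C z ^ 2)) -
      2 * ∮ z in C(0, 1), G z * f a C z * fDeriv a C z * (starRingEnd ℂ) (f a C z) := by
    rw [← circleIntegral.integral_const_mul, ← circleIntegral.integral_add,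
      ← circleIntegral.integral_sub]
    · refine circleIntegral.integral_congr zero_le_one fun z hz => ?_
      have hz1 : ‖z‖ = 1 := by simpa using hz
      have hai : 1 < a⁻¹ := hR.trans_le hRa
      have hc : (starRingEnd ℂ) z = z⁻¹ := by
        rw [inv_def, normSq_eq_norm_sq, hz1]
        simp
      have e1 : h a C z = f a C z - (starRingEnd ℂ) (f a C z) := by
        rw [h_eq_f_sub_f_inv ha ha1 hC (by linarith) (by linarith), ← hc,
          f_conj ha ha1 hC (by linarith)]
      simp only [e1, map_pow]
      ring
    · exact (ContinuousOn.fun_add ((hcG'.fun_mul hcs').fun_mul (hcs.fun_pow 2))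
        ((hcG'.fun_mul hcs').fun_mul (hcc (hcs.fun_pow 2)))).circleIntegrable zero_le_one
    · exact (continuousOn_const.fun_mul (((hcG'.fun_mul hcs).fun_mul hcs').fun_mul
        (hcc hcs))).circleIntegrable zero_le_one
    · exact ((hcG'.fun_mul hcs').fun_mul (hcs.fun_pow 2)).circleIntegrable zero_le_one
    · exact ((hcG'.fun_mul hcs').fun_mul (hcc (hcs.fun_pow 2))).circleIntegrable zero_le_one
  rw [h3, h4, h5, h7, h6]
  have hI : (2 * I)⁻¹ * (2 * I)⁻¹ = (-1 / 4 : ℂ) := by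
    rw [← mul_inv, show 2 * I * (2 * I) = 4 * (I * I) by ring, I_mul_I]
    norm_num
  linear_combination (8 * (∮ z in C(0, 1), G z * f a C z * fDeriv a C z *
    (starRingEnd ℂ) (f a C z)) - 4 * ∮ z in C(0, 1), G z * fDeriv a C z *
      (starRingEnd ℂ) (f a C z ^ 2)) * hI

/-- Only the derivatives of order one and two of `G` at the origin enter, since `z³ h²` is a
polynomial. -/
theorem setIntegral_pullbackWeight_mul_eq (ha : 0 < a) (ha1 : a ≤ 1 / 2) (hC : 0 ≤ C)
    {G : ℂ → ℂ} {R : ℝ} (hR : 1 < R) (hRa : R ≤ a⁻¹) (hG : DifferentiableOn ℂ G (Metric.ball 0 R))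
    (hG0 : G 0 = 0) :
    ∫ z in Metric.ball (0 : ℂ) 1, (pullbackWeight a C z : ℂ) * G z =
      Real.pi * I * C ^ 2 / 8 * (2 * ((1 + a ^ 2) * mapCoeff a C 1 + 2 * a * mapCoeff a C 2) *
        deriv G 0 + a * mapCoeff a C 1 * deriv (deriv G) 0) := by
  have hsub : Metric.ball (0 : ℂ) R ⊆ Metric.ball 0 a⁻¹ := Metric.ball_subset_ball hRa
  have hf' := (differentiableOn_fDeriv ha ha1 hC).mono hsub
  have hball : Metric.closedBall (0 : ℂ) 1 ⊆ Metric.ball 0 R := Metric.closedBall_subset_ball hR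
  have h0R : (0 : ℂ) ∈ Metric.ball 0 R := Metric.mem_ball_self (by linarith)
  set p : ℂ → ℂ := fun z => (z ^ 2 - 1) ^ 2 * ((z + a) * (1 + a * z)) with hp
  have hpd : Differentiable ℂ p := by fun_prop
  have hQ : DifferentiableOn ℂ (fun z => p z * fDeriv a C z) (Metric.ball 0 R) :=
    hpd.differentiableOn.mul hf'
  have h1 := setIntegral_pullbackWeight_mul ha ha1 hC hR hRa hG
  have h2 : (∮ z in C(0, 1), G z * fDeriv a C z * h a C z ^ 2) = C ^ 2 *
      ∮ z in C(0, 1), (1 / (z - 0) ^ (2 + 1)) • ((fun z => p z * fDeriv a C z) * G) z := by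
    rw [← circleIntegral.integral_const_mul]
    refine circleIntegral.integral_congr zero_le_one fun z hz => ?_
    have hz0 : z ≠ 0 := by rintro rfl; simp at hz
    have h3 := pow_three_mul_h_sq a C hz0
    have h4 : h a C z ^ 2 = C ^ 2 * (z ^ 2 - 1) ^ 2 * (z + a) * (1 + a * z) / z ^ 3 := by
      rw [← h3]; field_simp
    simp only [h4, hp, Pi.mul_apply, smul_eq_mul, sub_zero]
    field_simp
    ring
  rw [h2, ((hQ.mul hG).mono hball).circleIntegral_one_div_sub_center_pow_smul one_pos,
    iteratedDeriv_mul ((hQ.analyticAt (Metric.isOpen_ball.mem_nhds h0R)).contDiffAt)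
      ((hG.analyticAt (Metric.isOpen_ball.mem_nhds h0R)).contDiffAt)] at h1
  have hq0 : p 0 * fDeriv a C 0 = a * mapCoeff a C 1 := by
    rw [fDeriv_zero ha ha1 hC]
    simp [hp]
  have hq1 : deriv (fun z => p z * fDeriv a C z) 0 =
      (1 + a ^ 2) * mapCoeff a C 1 + 2 * a * mapCoeff a C 2 := by
    have hd := (hf'.differentiableAt (Metric.isOpen_ball.mem_nhds h0R)).hasDerivAt
    have e1 : HasDerivAt p (1 + a ^ 2) 0 := by
      convert! ((((hasDerivAt_id (0 : ℂ)).pow 2).sub_const 1).pow 2).mul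
        (((hasDerivAt_id (0 : ℂ)).add_const (a : ℂ)).mul
          (((hasDerivAt_id (0 : ℂ)).const_mul (a : ℂ)).const_add 1)) using 1
      simp
      ring
    rw [(e1.fun_mul hd).deriv, fDeriv_zero ha ha1 hC, deriv_fDeriv_zero ha ha1 hC]
    simp [hp]
    ring
  simp only [Finset.sum_range_succ, Finset.sum_range_zero, iteratedDeriv_zero,
    iteratedDeriv_succ, hq0, hq1] at h1
  norm_num at h1
  rw [hG0] at h1
  linear_combination h1 / 8

end

/-! ### Transplantation to the unit disk -/

section

lemma det_mul_left (w : ℂ) : (ContinuousLinearMap.mul ℝ ℂ w).det = ‖w‖ ^ 2 := by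
  rw [← normSq_eq_norm_sq, ← Algebra.norm_complex_apply, Algebra.norm_apply]
  rfl

lemma _root_.HasDerivAt.hasFDerivAt_mul_left {A : ℂ → ℂ} {A' z : ℂ} (hA : HasDerivAt A A' z) :
    HasFDerivAt A (ContinuousLinearMap.mul ℝ ℂ A') z := by
  convert! hA.hasFDerivAt.restrictScalars ℝ using 1
  ext
  simp [mul_comm]

variable {a C : ℝ} {u : EuclideanSpace ℝ (Fin 4) → ℝ}

lemma closedBall_subset_ball_inv (ha : 0 < a) (ha1 : a ≤ 1 / 100) :
    Metric.closedBall (0 : ℂ) 1 ⊆ Metric.ball 0 a⁻¹ :=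
  Metric.closedBall_subset_ball (lt_inv_of_le_one ha ha1 le_rfl)

lemma hasFDerivWithinAt_f_ball (ha : 0 < a) (ha1 : a ≤ 1 / 100) (hC : 0 < C) {z : ℂ}
    (hz : z ∈ Metric.ball (0 : ℂ) 1) :
    HasFDerivWithinAt (f a C) (ContinuousLinearMap.mul ℝ ℂ (fDeriv a C z)) (Metric.ball 0 1) z :=
  (hasDerivAt_f ha (by linarith) hC.le (lt_inv_of_le_one ha ha1 (mem_ball_zero_iff.1 hz).le)
    ).hasFDerivAt_mul_left.hasFDerivWithinAt

lemma setIntegral_planarDomain (ha : 0 < a) (ha1 : a ≤ 1 / 100) (hC : 0 < C) (v : ℂ → ℝ) :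
    ∫ z in planarDomain a C, z.im * v z =
      ∫ z in Metric.ball (0 : ℂ) 1, pullbackWeight a C z * v (f a C z) := by
  rw [planarDomain, integral_image_eq_integral_abs_det_fderiv_smul volume measurableSet_ball
    (fun z hz => hasFDerivWithinAt_f_ball ha ha1 hC hz)
    ((f_injOn ha ha1 hC).mono Metric.ball_subset_closedBall)]
  congr 1
  ext z
  rw [det_mul_left, abs_of_nonneg (by positivity), pullbackWeight, smul_eq_mul]
  ring

lemma integrableOn_planarDomain_iff (ha : 0 < a) (ha1 : a ≤ 1 / 100) (hC : 0 < C) (v : ℂ → ℝ) :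
    IntegrableOn (fun z => z.im * v z) (planarDomain a C) ↔
      IntegrableOn (fun z => pullbackWeight a C z * v (f a C z)) (Metric.ball (0 : ℂ) 1) := by
  rw [planarDomain, integrableOn_image_iff_integrableOn_abs_det_fderiv_smul volume
    measurableSet_ball (fun z hz => hasFDerivWithinAt_f_ball ha ha1 hC hz)
    ((f_injOn ha ha1 hC).mono Metric.ball_subset_closedBall)]
  refine iff_of_eq (congrArg (fun g => IntegrableOn g (Metric.ball (0 : ℂ) 1) volume) ?_)
  ext z
  rw [det_mul_left, abs_of_nonneg (by positivity), pullbackWeight, smul_eq_mul]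
  ring

lemma orbitIntegral_conj (u : EuclideanSpace ℝ (Fin 4) → ℝ) (z : ℂ) :
    orbitIntegral u ((starRingEnd ℂ) z) = orbitIntegral u z := by
  rw [orbitIntegral, orbitIntegral,
    ← integral_sphere_comp (LinearIsometryEquiv.neg ℝ) (fun σ => u (revolve σ z))]
  simp [revolve_apply]

/-- A conjugation invariant integral over the plane is twice that over the upper half-plane, if
the integrand vanishes on the real axis. -/
lemma integral_eq_two_mul_integral_upper {g : ℂ → ℝ} (hg : ∀ z, g ((starRingEnd ℂ) z) = g z)
    (hg0 : ∀ z : ℂ, z.im = 0 → g z = 0) (hi : IntegrableOn g {z : ℂ | 0 < z.im}) :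
    Integrable g ∧ ∫ z, g z = 2 * ∫ z in {z : ℂ | 0 < z.im}, g z := by
  have hmp : MeasurePreserving (starRingEnd ℂ) (volume : Measure ℂ) volume :=
    conjLIE.measurePreserving
  have hemb : MeasurableEmbedding (starRingEnd ℂ : ℂ → ℂ) :=
    conjLIE.toHomeomorph.measurableEmbedding
  have hpre : (starRingEnd ℂ : ℂ → ℂ) ⁻¹' {z : ℂ | 0 < z.im} = {z : ℂ | z.im < 0} := by
    ext z; simp
  have hi' : IntegrableOn g {z : ℂ | z.im < 0} := by
    have := (hmp.integrableOn_comp_preimage hemb).2 hi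
    rw [hpre] at this
    exact this.congr_fun (fun z _ => hg z) (measurableSet_lt Complex.measurable_im measurable_const)
  have he : ∫ z in {z : ℂ | z.im < 0}, g z = ∫ z in {z : ℂ | 0 < z.im}, g z := by
    rw [← hmp.setIntegral_preimage_emb hemb g {z : ℂ | 0 < z.im}, hpre]
    simp only [hg]
  have hdisj : Disjoint {z : ℂ | 0 < z.im} {z : ℂ | z.im < 0} :=
    Set.disjoint_left.2 fun z (h1 : 0 < z.im) (h2 : z.im < 0) => absurd h1 h2.not_gt
  have hmeas : MeasurableSet {z : ℂ | z.im < 0} :=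
    measurableSet_lt Complex.measurable_im measurable_const
  have hsupp : ∀ z ∉ {z : ℂ | 0 < z.im} ∪ {z : ℂ | z.im < 0}, g z = 0 := fun z hz => by
    simp only [Set.mem_union, Set.mem_ofPred_eq, not_or, not_lt] at hz
    exact hg0 z (le_antisymm hz.1 hz.2)
  refine ⟨(integrableOn_iff_integrable_of_support_subset fun z hz => ?_).1 (hi.union hi'), ?_⟩
  · by_contra h
    exact hz (hsupp z h)
  · rw [← setIntegral_eq_integral_of_forall_compl_eq_zero hsupp,
      setIntegral_union hdisj hmeas hi hi', he]
    ring

/-- The integral over the rotated domain as an integral over the planar domain. The factor `2`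
occurs since every orbit meets the planar domain in two conjugate points. -/
lemma integral_Omega_eq (ha : 0 < a) (ha1 : a ≤ 1 / 100) (hC : 0 < C)
    (hu : IntegrableOn u (Omega a C)) :
    IntegrableOn (fun z => z.im * orbitPotential u z) (planarDomain a C) ∧
      2 * ∫ x in Omega a C, u x = ∫ z in planarDomain a C, z.im * orbitPotential u z := by
  have hΩ := (isOpen_Omega ha ha1 hC).measurableSet
  have hP := (isOpen_planarDomain ha ha1 hC).measurableSet
  obtain ⟨h1, h2⟩ := integral_eq_integral_upper ((integrable_indicator_iff hΩ).2 hu)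
  set g : ℂ → ℝ := (planarDomain a C).indicator fun z => z.im * orbitPotential u z with hg
  have h3 : ∀ z : ℂ,
      z.im ^ 2 * ∫ σ, (Omega a C).indicator u (revolve σ z) ∂sphereMeasure = g z := by
    intro z
    have hσ : ∀ σ : Metric.sphere (0 : EuclideanSpace ℝ (Fin 3)) 1, revolve σ z ∈ Omega a C ↔
      z ∈ planarDomain a C := fun σ =>
      revolve_mem_Omega ha ha1 hC (mem_sphere_zero_iff_norm.1 σ.2)
    by_cases hz : z ∈ planarDomain a C
    · rw [hg, Set.indicator_of_mem hz, orbitPotential, orbitIntegral]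
      simp_rw [Set.indicator_of_mem ((hσ _).2 hz)]
      ring
    · rw [hg, Set.indicator_of_notMem hz]
      simp_rw [Set.indicator_of_notMem (mt (hσ _).1 hz)]
      simp
  simp_rw [h3] at h1 h2
  have hgc : ∀ z, g ((starRingEnd ℂ) z) = g z := fun z => by
    have hmem : (starRingEnd ℂ) z ∈ planarDomain a C ↔ z ∈ planarDomain a C := by
      refine ⟨fun h => ?_, fun h => conj_mem_planarDomain ha ha1 hC h⟩
      simpa using conj_mem_planarDomain ha ha1 hC h
    by_cases hz : z ∈ planarDomain a C
    · rw [hg, Set.indicator_of_mem hz, Set.indicator_of_mem (hmem.2 hz), orbitPotential,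
        orbitPotential, orbitIntegral_conj, conj_im]
      ring
    · rw [hg, Set.indicator_of_notMem hz, Set.indicator_of_notMem (mt hmem.1 hz)]
  have hg0 : ∀ z : ℂ, z.im = 0 → g z = 0 := fun z hz => by simp [hg, hz]
  obtain ⟨h4, h5⟩ := integral_eq_two_mul_integral_upper hgc hg0 h1
  rw [integral_indicator hΩ] at h2
  rw [hg, integrable_indicator_iff hP] at h4
  refine ⟨h4, ?_⟩
  rw [h2, ← h5, hg, integral_indicator hP]

/-- The orbit potential, transplanted to the disk, is the real part of an analytic function. -/
lemma exists_analytic_orbitPotential (ha : 0 < a) (ha1 : a ≤ 1 / 100) (hC : 0 < C)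
    (hu : InnerProductSpace.HarmonicOnNhd u (Omega a C)) :
    ∃ F : ℂ → ℂ, DifferentiableOn ℂ F (Metric.ball 0 1) ∧ F 0 = 0 ∧
      ∀ z ∈ Metric.ball (0 : ℂ) 1, (F z).re = orbitPotential u (f a C z) := by
  have hopen := isOpen_planarDomain ha ha1 hC
  have hv := harmonicOnNhd_orbitPotential (isOpen_Omega ha ha1 hC) hu hopen
    (fun σ hσ z hz => (revolve_mem_Omega ha ha1 hC hσ).2 hz)
  have hV : InnerProductSpace.HarmonicOnNhd (fun z => orbitPotential u (f a C z))
      (Metric.ball 0 1) := by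
    intro z hz
    have hfz : f a C z ∈ planarDomain a C := ⟨z, hz, rfl⟩
    obtain ⟨r, hr, hrP⟩ := Metric.isOpen_iff.1 hopen _ hfz
    obtain ⟨H, hH, hHv⟩ :=
      InnerProductSpace.HarmonicOnNhd.exists_analyticOnNhd_ball_re_eq (hv.mono hrP)
    have hfan : AnalyticAt ℂ (f a C) z := f_analyticOnNhd ha (by linarith) hC.le z
      (closedBall_subset_ball_inv ha ha1 (Metric.ball_subset_closedBall hz))
    have hre := ((hH _ (Metric.mem_ball_self hr)).comp hfan).harmonicAt_re
    refine (InnerProductSpace.harmonicAt_congr_nhds ?_).1 hre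
    filter_upwards [hfan.continuousAt.preimage_mem_nhds (Metric.ball_mem_nhds _ hr)] with w hw
    exact hHv hw
  obtain ⟨F, hF, hFV⟩ := InnerProductSpace.HarmonicOnNhd.exists_analyticOnNhd_ball_re_eq hV
  refine ⟨fun z => F z - F 0, hF.differentiableOn.sub_const _, sub_self _, fun z hz => ?_⟩
  have h0 : (F 0).re = orbitPotential u (f a C 0) := hFV (Metric.mem_ball_self one_pos)
  rw [f_zero ha (by linarith) hC.le] at h0
  have h1 : (F z).re = orbitPotential u (f a C z) := hFV hz
  rw [sub_re, h1, h0]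
  simp [orbitPotential]

/-- The normal derivative of the transplanted orbit potential on the real axis gives the values of
`u` on the axis of rotation. -/
lemma im_deriv_eq (ha : 0 < a) (ha1 : a ≤ 1 / 100) (hC : 0 < C)
    (hu : InnerProductSpace.HarmonicOnNhd u (Omega a C)) {F : ℂ → ℂ}
    (hF : DifferentiableOn ℂ F (Metric.ball 0 1))
    (hFV : ∀ z ∈ Metric.ball (0 : ℂ) 1, (F z).re = orbitPotential u (f a C z)) {x : ℝ}
    (hx : (x : ℂ) ∈ Metric.ball (0 : ℂ) 1) :
    (deriv F x).im = -(4 * Real.pi * u ((f a C x).re • EuclideanSpace.single 0 1) *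
      (fDeriv a C x).re) := by
  have hxa := closedBall_subset_ball_inv ha ha1 (Metric.ball_subset_closedBall hx)
  have hline : HasDerivAt (fun t : ℝ => (x : ℂ) + t * I) I 0 := by
    simpa using ((hasDerivAt_id (0 : ℝ)).ofReal_comp.mul_const I).const_add (x : ℂ)
  have hl0 : (x : ℂ) + ((0 : ℝ) : ℂ) * I = x := by simp
  have hFd : HasDerivAt F (deriv F x) ((x : ℂ) + ((0 : ℝ) : ℂ) * I) := by
    rw [hl0]
    exact (hF.differentiableAt (Metric.isOpen_ball.mem_nhds hx)).hasDerivAt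
  have hfd : HasDerivAt (f a C) (fDeriv a C x) ((x : ℂ) + ((0 : ℝ) : ℂ) * I) := by
    rw [hl0]
    exact hasDerivAt_f ha (by linarith) hC.le (by simpa using hxa)
  have h1 : HasDerivAt (fun t : ℝ => (F (x + t * I)).re) (deriv F x * I).re 0 :=
    reCLM.hasFDerivAt.comp_hasDerivAt (0 : ℝ) (hFd.comp (0 : ℝ) hline)
  have hfx : (f a C x).im = 0 := by
    have := f_conj ha (by linarith) hC.le (z := (x : ℂ)) (by simpa using hxa)
    rw [conj_ofReal] at this
    exact conj_eq_iff_im.1 this.symm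
  have hfx' : f a C x = ((f a C x).re : ℂ) := Complex.ext (by simp) (by simpa using hfx)
  have hpot := hasFDerivAt_orbitPotential (isOpen_Omega ha ha1 hC) hu.contDiffOn
    (isOpen_planarDomain ha ha1 hC) (fun σ hσ z hz => (revolve_mem_Omega ha ha1 hC hσ).2 hz)
    (z := f a C (x + ((0 : ℝ) : ℂ) * I)) (by rw [hl0]; exact ⟨x, hx, rfl⟩)
  have h2 := hpot.comp_hasDerivAt (0 : ℝ) (hfd.comp (0 : ℝ) hline)
  have h3 : (fun t : ℝ => (F (x + t * I)).re) =ᶠ[nhds 0]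
      (orbitPotential u ∘ (f a C ∘ fun t : ℝ => (x : ℂ) + t * I)) := by
    have hc : ContinuousAt (fun t : ℝ => (x : ℂ) + t * I) 0 := hline.continuousAt
    filter_upwards [hc.preimage_mem_nhds (Metric.isOpen_ball.mem_nhds (x := (x : ℂ) +
      ((0 : ℝ) : ℂ) * I) (by rwa [hl0] : _ ∈ Metric.ball (0 : ℂ) 1))] with t ht
    exact hFV _ ht
  have h4 := (h1.congr_of_eventuallyEq h3.symm).unique h2
  rw [hl0, hfx', orbitIntegral_ofReal] at h4
  simp at h4
  linarith

lemma im_deriv_zero (ha : 0 < a) (ha1 : a ≤ 1 / 100) (hC : 0 < C)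
    (hu : InnerProductSpace.HarmonicOnNhd u (Omega a C)) {F : ℂ → ℂ}
    (hF : DifferentiableOn ℂ F (Metric.ball 0 1))
    (hFV : ∀ z ∈ Metric.ball (0 : ℂ) 1, (F z).re = orbitPotential u (f a C z)) :
    (deriv F 0).im = -(4 * Real.pi * mapCoeff a C 1 * u 0) := by
  have h := im_deriv_eq ha ha1 hC hu hF hFV (x := 0) (by simp)
  rw [ofReal_zero, f_zero ha (by linarith) hC.le, fDeriv_zero ha (by linarith) hC.le] at h
  simp at h
  rw [h]
  ring

lemma im_deriv_deriv_zero (ha : 0 < a) (ha1 : a ≤ 1 / 100) (hC : 0 < C)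
    (hu : InnerProductSpace.HarmonicOnNhd u (Omega a C)) {F : ℂ → ℂ}
    (hF : DifferentiableOn ℂ F (Metric.ball 0 1))
    (hFV : ∀ z ∈ Metric.ball (0 : ℂ) 1, (F z).re = orbitPotential u (f a C z)) :
    (deriv (deriv F) 0).im = -(4 * Real.pi * (mapCoeff a C 1 ^ 2 * partialDeriv 0 u 0 +
      2 * mapCoeff a C 2 * u 0)) := by
  have h0 : (0 : ℂ) ∈ Metric.ball (0 : ℂ) 1 := Metric.mem_ball_self one_pos
  have h0a : ‖((0 : ℝ) : ℂ)‖ < a⁻¹ := by simpa using ha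
  have hfd : HasDerivAt (fun x : ℝ => (f a C x).re) (mapCoeff a C 1) 0 := by
    have := (hasDerivAt_f ha (by linarith) hC.le h0a).real_of_complex
    rw [ofReal_zero, fDeriv_zero ha (by linarith) hC.le] at this
    exact this
  have hfd' : HasDerivAt (fun x : ℝ => (fDeriv a C x).re) (2 * mapCoeff a C 2) 0 := by
    have hd : HasDerivAt (fDeriv a C) (2 * mapCoeff a C 2) ((0 : ℝ) : ℂ) := by
      rw [ofReal_zero, ← deriv_fDeriv_zero ha (by linarith) hC.le]
      exact ((differentiableOn_fDeriv ha (by linarith) hC.le).differentiableAt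
        (Metric.isOpen_ball.mem_nhds (by simpa using ha))).hasDerivAt
    simpa using hd.real_of_complex
  have hud : HasFDerivAt u (fderiv ℝ u 0)
      ((f a C ((0 : ℝ) : ℂ)).re • (EuclideanSpace.single 0 1 : EuclideanSpace ℝ (Fin 4))) := by
    rw [ofReal_zero, f_zero ha (by linarith) hC.le]
    simpa using (((hu 0 (zero_mem_Omega ha ha1 hC)).1).differentiableAt (by norm_num)).hasFDerivAt
  have h1 := ((hud.comp_hasDerivAt (0 : ℝ) (hfd.smul_const _)).const_mul (4 * Real.pi)).mul hfd'
    |>.neg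
  have h2 : HasDerivAt (fun x : ℝ => (deriv F x).im) (deriv (deriv F) 0).im 0 := by
    have hd : HasDerivAt (deriv F) (deriv (deriv F) 0) ((0 : ℝ) : ℂ) := by
      rw [ofReal_zero]
      exact ((hF.deriv Metric.isOpen_ball).differentiableAt
        (Metric.isOpen_ball.mem_nhds h0)).hasDerivAt
    exact imCLM.hasFDerivAt.comp_hasDerivAt (0 : ℝ) hd.comp_ofReal
  have h3 : (fun x : ℝ => (deriv F x).im) =ᶠ[nhds 0] fun x : ℝ =>
      -(4 * Real.pi * u ((f a C x).re • EuclideanSpace.single 0 1) * (fDeriv a C x).re) := by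
    have hc : ContinuousAt (fun x : ℝ => (x : ℂ)) 0 := continuous_ofReal.continuousAt
    filter_upwards [hc.preimage_mem_nhds (Metric.isOpen_ball.mem_nhds (by simp :
      ((0 : ℝ) : ℂ) ∈ Metric.ball (0 : ℂ) 1))] with x hx
    exact im_deriv_eq ha ha1 hC hu hF hFV hx
  rw [(h2.congr_of_eventuallyEq h3.symm).unique h1]
  simp [partialDeriv, f_zero ha (by linarith : a ≤ 1 / 2) hC.le,
    fDeriv_zero ha (by linarith : a ≤ 1 / 2) hC.le]
  ring

end

/-! ### The quadrature identity -/

section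

/-- Dilating one factor of an integral over the unit disk. After the substitution `z ↦ z / ρ` the
other factor is dilated, for which a bound is available. -/
lemma tendsto_setIntegral_dilation {W V : ℂ → ℝ} {K : ℝ} (hK0 : 0 ≤ K)
    (hW : ContinuousOn W (Metric.ball 0 1))
    (hV : ContinuousOn V (Metric.ball 0 1))
    (hK : ∀ ρ : ℝ, 1 / 2 < ρ → ρ < 1 → ∀ z ∈ Metric.ball (0 : ℂ) ρ, |W (ρ⁻¹ • z)| ≤ K * |W z|)
    (hi : IntegrableOn (fun z => W z * V z) (Metric.ball 0 1)) :
    Filter.Tendsto (fun ρ : ℝ => ∫ z in Metric.ball (0 : ℂ) 1, W z * V (ρ • z))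
      (nhdsWithin 1 (Set.Iio 1)) (nhds (∫ z in Metric.ball (0 : ℂ) 1, W z * V z)) := by
  have hev : ∀ᶠ ρ : ℝ in nhdsWithin 1 (Set.Iio 1), 1 / 2 < ρ ∧ ρ < 1 :=
    (Filter.Eventually.and (nhdsWithin_le_nhds (lt_mem_nhds (by norm_num)))
      self_mem_nhdsWithin)
  have hsub : ∀ ρ : ℝ, 1 / 2 < ρ ∧ ρ < 1 → ∫ z in Metric.ball (0 : ℂ) 1, W z * V (ρ • z) =
      (ρ ^ 2)⁻¹ * ∫ z in Metric.ball (0 : ℂ) 1,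
        (Metric.ball (0 : ℂ) ρ).indicator (fun z => W (ρ⁻¹ • z) * V z) z := fun ρ hρ => by
    have hρ0 : 0 < ρ := by linarith [hρ.1]
    have h := Measure.setIntegral_comp_smul_of_pos volume (fun z : ℂ => W (ρ⁻¹ • z) * V z)
      (Metric.ball (0 : ℂ) 1) hρ0
    simp only [smul_smul, inv_mul_cancel₀ hρ0.ne', one_smul, Complex.finrank_real_complex,
      smul_unitBall_of_pos hρ0, smul_eq_mul] at h
    rw [h, setIntegral_indicator measurableSet_ball, Set.inter_eq_right.2
      (Metric.ball_subset_ball hρ.2.le)]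
  have hlim : Filter.Tendsto (fun ρ : ℝ => ∫ z in Metric.ball (0 : ℂ) 1,
      (Metric.ball (0 : ℂ) ρ).indicator (fun z => W (ρ⁻¹ • z) * V z) z)
      (nhdsWithin 1 (Set.Iio 1)) (nhds (∫ z in Metric.ball (0 : ℂ) 1, W z * V z)) := by
    refine tendsto_integral_filter_of_dominated_convergence (fun z => K * ‖W z * V z‖) ?_ ?_
      (hi.norm.const_mul K) ?_
    · filter_upwards [hev] with ρ hρ
      have hρ0 : 0 < ρ := by linarith [hρ.1]
      have hmaps : Set.MapsTo (fun z : ℂ => ρ⁻¹ • z) (Metric.ball 0 ρ) (Metric.ball 0 1) :=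
        fun z hz => by
          rw [mem_ball_zero_iff] at hz ⊢
          rw [norm_smul, norm_inv, Real.norm_of_nonneg hρ0.le, inv_mul_lt_one₀ hρ0]
          exact hz
      have hc : ContinuousOn (fun z => W (ρ⁻¹ • z) * V z) (Metric.ball 0 ρ) :=
        (hW.comp (by fun_prop) hmaps).mul (hV.mono (Metric.ball_subset_ball hρ.2.le))
      exact ((aestronglyMeasurable_indicator_iff measurableSet_ball).2
        (hc.aestronglyMeasurable measurableSet_ball)).restrict
    · filter_upwards [hev] with ρ hρ
      refine .of_forall fun z => ?_
      by_cases hz : z ∈ Metric.ball (0 : ℂ) ρ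
      · rw [Set.indicator_of_mem hz, norm_mul, norm_mul, ← mul_assoc]
        exact mul_le_mul_of_nonneg_right (hK ρ hρ.1 hρ.2 z hz) (norm_nonneg _)
      · rw [Set.indicator_of_notMem hz, norm_zero]
        exact mul_nonneg hK0 (norm_nonneg _)
    · filter_upwards [ae_restrict_mem measurableSet_ball] with z hz
      have hz1 : ‖z‖ < 1 := mem_ball_zero_iff.1 hz
      have h1 : Filter.Tendsto (fun ρ : ℝ => ρ⁻¹ • z) (nhdsWithin 1 (Set.Iio 1)) (nhds z) := by
        have : ContinuousAt (fun ρ : ℝ => ρ⁻¹ • z) 1 :=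
          (continuousAt_inv₀ one_ne_zero).smul continuousAt_const
        simpa using this.tendsto.mono_left nhdsWithin_le_nhds
      have h2 : Filter.Tendsto (fun ρ : ℝ => W (ρ⁻¹ • z) * V z) (nhdsWithin 1 (Set.Iio 1))
          (nhds (W z * V z)) :=
        (((hW.continuousAt (Metric.isOpen_ball.mem_nhds hz)).tendsto.comp h1).mul_const _)
      refine h2.congr' ?_
      filter_upwards [nhdsWithin_le_nhds (lt_mem_nhds hz1)] with ρ hρ
      rw [Set.indicator_of_mem (mem_ball_zero_iff.2 hρ)]
  have hinv : Filter.Tendsto (fun ρ : ℝ => (ρ ^ 2)⁻¹) (nhdsWithin 1 (Set.Iio 1)) (nhds 1) := by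
    have : ContinuousAt (fun ρ : ℝ => (ρ ^ 2)⁻¹) 1 := by
      refine ContinuousAt.inv₀ (by fun_prop) (by norm_num)
    simpa using this.tendsto.mono_left nhdsWithin_le_nhds
  have h := hinv.mul hlim
  rw [one_mul] at h
  refine h.congr' ?_
  filter_upwards [hev] with ρ hρ
  exact (hsub ρ hρ).symm

variable {a C : ℝ} {u : EuclideanSpace ℝ (Fin 4) → ℝ}

/-- The weight is comparable with `c₁³ |Im z|`, and so are its dilates: dilation changes `Im f` by
a factor of at most `6` and `|f'|²` by a factor of at most `9`. -/
lemma abs_pullbackWeight_dilation_le (ha : 0 < a) (ha1 : a ≤ 1 / 100) (hC : 0 < C) {ρ : ℝ}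
    (hρ : 1 / 2 < ρ) (hρ1 : ρ < 1) {z : ℂ} (hz : z ∈ Metric.ball (0 : ℂ) ρ) :
    |pullbackWeight a C (ρ⁻¹ • z)| ≤ 54 * |pullbackWeight a C z| := by
  have hρ0 : 0 < ρ := by linarith
  have hz1 : ‖z‖ ≤ 1 := by linarith [mem_ball_zero_iff.1 hz]
  have hw1 : ‖ρ⁻¹ • z‖ ≤ 1 := by
    rw [norm_smul, norm_inv, Real.norm_of_nonneg hρ0.le, inv_mul_le_one₀ hρ0]
    exact (mem_ball_zero_iff.1 hz).le
  have hc := mapCoeff_one_pos ha ha1 hC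
  set c := mapCoeff a C 1
  have h1 : |(f a C (ρ⁻¹ • z)).im| ≤ 6 * |(f a C z).im| := by
    have e1 := abs_im_f_sub_le ha ha1 hC hw1
    have e2 := abs_im_f_sub_le ha ha1 hC hz1
    have e3 : |(ρ⁻¹ • z).im| ≤ 2 * |z.im| := by
      rw [smul_im, smul_eq_mul, abs_mul, abs_inv, abs_of_pos hρ0]
      refine mul_le_mul_of_nonneg_right ?_ (abs_nonneg _)
      rw [inv_le_comm₀ hρ0 two_pos]
      linarith
    have e4 := abs_sub_abs_le_abs_sub (f a C (ρ⁻¹ • z)).im (c * (ρ⁻¹ • z).im)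
    have e5 := abs_sub_abs_le_abs_sub (c * z.im) (f a C z).im
    rw [abs_sub_comm] at e5
    rw [abs_mul, abs_of_pos hc] at e4 e5
    nlinarith [mul_le_mul_of_nonneg_left e3 hc.le]
  have h2 : ‖fDeriv a C (ρ⁻¹ • z)‖ ^ 2 ≤ 9 * ‖fDeriv a C z‖ ^ 2 := by
    have e1 := norm_fDeriv_sub_le ha ha1 hC hw1
    have e2 := norm_fDeriv_sub_le ha ha1 hC hz1
    have e4 := norm_sub_norm_le (fDeriv a C (ρ⁻¹ • z)) (c : ℂ)
    have e5 := norm_sub_norm_le (c : ℂ) (fDeriv a C z)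
    rw [norm_sub_rev] at e5
    rw [norm_real, Real.norm_of_nonneg hc.le] at e4 e5
    have : ‖fDeriv a C (ρ⁻¹ • z)‖ ≤ 3 * ‖fDeriv a C z‖ := by linarith
    calc ‖fDeriv a C (ρ⁻¹ • z)‖ ^ 2 ≤ (3 * ‖fDeriv a C z‖) ^ 2 := by gcongr
      _ = _ := by ring
  rw [pullbackWeight, pullbackWeight, abs_mul, abs_mul, abs_pow, abs_pow, abs_norm, abs_norm]
  calc _ ≤ (6 * |(f a C z).im|) * (9 * ‖fDeriv a C z‖ ^ 2) := by gcongr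
    _ = _ := by ring

lemma continuousOn_pullbackWeight (ha : 0 < a) (ha1 : a ≤ 1 / 100) (hC : 0 < C) :
    ContinuousOn (pullbackWeight a C) (Metric.closedBall 0 1) :=
  (continuous_im.comp_continuousOn (f_continuousOn ha ha1 hC)).mul
    (((differentiableOn_fDeriv ha (by linarith) hC.le).continuousOn.mono
      (closedBall_subset_ball_inv ha ha1)).norm.pow 2)

/-- The integral of the transplanted orbit potential, computed through its analytic completion `F`:
only the derivatives of `F` of order one and two at the origin matter. -/
lemma setIntegral_pullbackWeight_mul_re (ha : 0 < a) (ha1 : a ≤ 1 / 100) (hC : 0 < C) {F : ℂ → ℂ}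
    (hF : DifferentiableOn ℂ F (Metric.ball 0 1)) (hF0 : F 0 = 0)
    (hi : IntegrableOn (fun z => pullbackWeight a C z * (F z).re) (Metric.ball 0 1)) :
    ∫ z in Metric.ball (0 : ℂ) 1, pullbackWeight a C z * (F z).re =
      -(Real.pi * C ^ 2 / 8) * (2 * ((1 + a ^ 2) * mapCoeff a C 1 + 2 * a * mapCoeff a C 2) *
        (deriv F 0).im + a * mapCoeff a C 1 * (deriv (deriv F) 0).im) := by
  have hlim := tendsto_setIntegral_dilation (K := 54) (by norm_num)
    ((continuousOn_pullbackWeight ha ha1 hC).mono Metric.ball_subset_closedBall)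
    (continuous_re.comp_continuousOn hF.continuousOn)
    (fun ρ h1 h2 z hz => abs_pullbackWeight_dilation_le ha ha1 hC h1 h2 hz) hi
  refine tendsto_nhds_unique hlim ?_
  have hval : ∀ᶠ ρ : ℝ in nhdsWithin 1 (Set.Iio 1),
      -(Real.pi * C ^ 2 / 8) * (2 * ((1 + a ^ 2) * mapCoeff a C 1 + 2 * a * mapCoeff a C 2) *
        (ρ * (deriv F 0).im) + a * mapCoeff a C 1 * (ρ ^ 2 * (deriv (deriv F) 0).im)) =
      ∫ z in Metric.ball (0 : ℂ) 1, pullbackWeight a C z * (re ∘ F) (ρ • z) := by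
    filter_upwards [nhdsWithin_le_nhds (lt_mem_nhds (zero_lt_one (α := ℝ))),
      self_mem_nhdsWithin] with ρ hρ0 (hρ1 : ρ < 1)
    have hρi : 1 < ρ⁻¹ := (one_lt_inv₀ hρ0).2 hρ1
    have hmaps : Set.MapsTo (fun z : ℂ => (ρ : ℂ) * z) (Metric.ball 0 ρ⁻¹) (Metric.ball 0 1) :=
      fun z hz => by
        rw [mem_ball_zero_iff] at hz ⊢
        rwa [norm_mul, norm_real, Real.norm_of_nonneg hρ0.le, mul_comm, ← lt_div_iff₀ hρ0, one_div]
    have hG : DifferentiableOn ℂ (fun z => F (ρ * z)) (Metric.ball 0 ρ⁻¹) :=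
      hF.comp (by fun_prop) hmaps
    have hG' := hG.mono (Metric.ball_subset_ball (min_le_left ρ⁻¹ a⁻¹))
    have h := setIntegral_pullbackWeight_mul_eq ha (by linarith) hC.le
      (lt_min hρi (lt_inv_of_le_one ha ha1 le_rfl)) (min_le_right _ _) hG' (by simp [hF0])
    have hd : deriv (fun z => F (ρ * z)) = fun z => (ρ : ℂ) * deriv F (ρ * z) := by
      ext z
      rw [deriv_comp_mul_left, smul_eq_mul]
    have hd' : deriv (deriv (fun z => F (ρ * z))) 0 = (ρ : ℂ) ^ 2 * deriv (deriv F) 0 := by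
      rw [hd, deriv_const_mul_field, deriv_comp_mul_left, smul_eq_mul, mul_zero]
      ring
    have hd0 : deriv (fun z => F (ρ * z)) 0 = ρ * deriv F 0 := by
      simp only [hd, mul_zero]
    rw [hd', hd0] at h
    have hint : IntegrableOn (fun z => (pullbackWeight a C z : ℂ) * F (ρ * z))
        (Metric.ball 0 1) := by
      refine (ContinuousOn.integrableOn_compact (isCompact_closedBall _ _) ?_).mono_set
        Metric.ball_subset_closedBall
      exact (continuous_ofReal.comp_continuousOn (continuousOn_pullbackWeight ha ha1 hC)).mul
        (hG.continuousOn.mono (Metric.closedBall_subset_ball hρi))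
    have hre := reCLM.integral_comp_comm hint
    rw [h] at hre
    simp only [reCLM_apply, re_ofReal_mul] at hre
    simp only [Function.comp_apply, real_smul]
    rw [hre]
    rw [show (Real.pi : ℂ) * I * C ^ 2 / 8 * (2 * ((1 + a ^ 2) * mapCoeff a C 1 +
      2 * a * mapCoeff a C 2) * (ρ * deriv F 0) + a * mapCoeff a C 1 *
        (ρ ^ 2 * deriv (deriv F) 0)) = I * (((Real.pi * C ^ 2 / 8 * (2 * ((1 + a ^ 2) *
        mapCoeff a C 1 + 2 * a * mapCoeff a C 2) * ρ) : ℝ) : ℂ) * deriv F 0 +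
        ((Real.pi * C ^ 2 / 8 * (a * mapCoeff a C 1 * ρ ^ 2) : ℝ) : ℂ) * deriv (deriv F) 0) by
      push_cast; ring]
    rw [I_mul_re, add_im, im_ofReal_mul, im_ofReal_mul]
    ring
  refine Filter.Tendsto.congr' hval ?_
  have hcont : ContinuousAt (fun ρ : ℝ => -(Real.pi * C ^ 2 / 8) * (2 * ((1 + a ^ 2) *
      mapCoeff a C 1 + 2 * a * mapCoeff a C 2) * (ρ * (deriv F 0).im) + a * mapCoeff a C 1 *
        (ρ ^ 2 * (deriv (deriv F) 0).im))) 1 := by fun_prop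
  simpa using hcont.tendsto.mono_left nhdsWithin_le_nhds

/-- The weight of the value at the origin in the quadrature identity. -/
def valueWeight (a C : ℝ) : ℝ :=
  Real.pi ^ 2 / 2 * C ^ 2 * mapCoeff a C 1 * ((1 + a ^ 2) * mapCoeff a C 1 + 3 * a * mapCoeff a C 2)

/-- The weight of the axial derivative at the origin in the quadrature identity. -/
def derivWeight (a C : ℝ) : ℝ := Real.pi ^ 2 / 4 * C ^ 2 * a * mapCoeff a C 1 ^ 3

/-- The integral over `Ω` is half the integral of the weight against `Re F`, which depends on `F' 0`
and `F'' 0` only; their imaginary parts are known in terms of `u 0` and `∂u/∂x₁ 0`. -/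
theorem hasQuadratureIdentity_Omega (ha : 0 < a) (ha1 : a ≤ 1 / 100) (hC : 0 < C) :
    HasQuadratureIdentity (Omega a C)
      fun u => valueWeight a C * u 0 + derivWeight a C * partialDeriv 0 u 0 := by
  intro u hu hint
  obtain ⟨h1, h2⟩ := integral_Omega_eq ha ha1 hC hint
  rw [integrableOn_planarDomain_iff ha ha1 hC] at h1
  rw [setIntegral_planarDomain ha ha1 hC] at h2
  obtain ⟨F, hF, hF0, hFV⟩ := exists_analytic_orbitPotential ha ha1 hC hu
  have h3 : Set.EqOn (fun z => pullbackWeight a C z * orbitPotential u (f a C z))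
      (fun z => pullbackWeight a C z * (F z).re) (Metric.ball 0 1) := fun z hz => by
    simp only [hFV z hz]
  rw [setIntegral_congr_fun measurableSet_ball h3, setIntegral_pullbackWeight_mul_re ha ha1 hC hF
    hF0 (h1.congr_fun h3 measurableSet_ball), im_deriv_zero ha ha1 hC hu hF hFV,
    im_deriv_deriv_zero ha ha1 hC hu hF hFV] at h2
  rw [valueWeight, derivWeight]
  linear_combination h2 / 2

end

/-! ### Sizes of the two weights -/

section

variable {a C : ℝ}

lemma pow_four_le_valueWeight (ha : 0 < a) (ha1 : a ≤ 1 / 100) (hC : 0 < C) :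
    C ^ 4 ≤ valueWeight a C := by
  have h1 := mapCoeff_one_ge ha ha1 hC
  have h2 := (abs_le.1 (abs_mapCoeff_succ_le ha.le (by linarith : a ≤ 1 / 2) hC.le 1)).1
  rw [pow_one] at h2
  have h3 : 8 / 10 * C ≤ (1 + a ^ 2) * mapCoeff a C 1 + 3 * a * mapCoeff a C 2 := by
    have e1 : 0 ≤ a ^ 2 * mapCoeff a C 1 := by
      have : 0 ≤ mapCoeff a C 1 := by linarith
      positivity
    have e2 := mul_le_mul_of_nonneg_left h2 (by linarith : 0 ≤ 3 * a)
    have e3 : a * a ≤ 1 / 100 * (1 / 100) := mul_self_le_mul_self ha.le ha1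
    have e4 := mul_le_mul_of_nonneg_right e3 hC.le
    nlinarith
  have hpi : 4 ≤ Real.pi ^ 2 / 2 := by nlinarith [Real.pi_gt_three]
  have h4 : 9 / 10 * C * (8 / 10 * C) ≤
      mapCoeff a C 1 * ((1 + a ^ 2) * mapCoeff a C 1 + 3 * a * mapCoeff a C 2) :=
    mul_le_mul h1 h3 (by positivity) (by linarith)
  calc C ^ 4 ≤ 4 * C ^ 2 * (9 / 10 * C * (8 / 10 * C)) := by nlinarith [pow_pos hC 4]
    _ ≤ Real.pi ^ 2 / 2 * C ^ 2 * (mapCoeff a C 1 *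
        ((1 + a ^ 2) * mapCoeff a C 1 + 3 * a * mapCoeff a C 2)) := by gcongr
    _ = valueWeight a C := by rw [valueWeight]; ring

lemma derivWeight_pos (ha : 0 < a) (ha1 : a ≤ 1 / 100) (hC : 0 < C) : 0 < derivWeight a C := by
  have := mapCoeff_one_pos ha ha1 hC
  rw [derivWeight]
  positivity

lemma derivWeight_le (ha : 0 < a) (ha1 : a ≤ 1 / 100) (hC : 0 < C) :
    derivWeight a C ≤ 256 * a * C ^ 5 := by
  have h1 := (abs_le.1 (abs_mapCoeff_succ_le ha.le (by linarith : a ≤ 1 / 2) hC.le 0)).2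
  rw [pow_zero, mul_one] at h1
  have h0 := mapCoeff_one_pos ha ha1 hC
  calc derivWeight a C ≤ 4 ^ 2 / 4 * C ^ 2 * a * (4 * C) ^ 3 := by
        rw [derivWeight]
        gcongr
        exact Real.pi_le_four
    _ = 256 * a * C ^ 5 := by ring

lemma derivWeight_lt {ε : ℝ} (ha : 0 < a) (ha1 : a ≤ 1 / 100) (hC : 0 < C)
    (hε : 256 ^ 4 * a < ε) : derivWeight a C < ε * C * valueWeight a C := by
  have hε0 : 0 < ε := lt_of_le_of_lt (by positivity) hε
  calc derivWeight a C ≤ 256 * a * C ^ 5 := derivWeight_le ha ha1 hC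
    _ < ε * C ^ 5 := by
      gcongr
      linarith
    _ = ε * C * C ^ 4 := by ring
    _ ≤ ε * C * valueWeight a C := by
      gcongr
      exact pow_four_le_valueWeight ha ha1 hC

lemma derivWeight_pow_four_lt {ε : ℝ} (ha : 0 < a) (ha1 : a ≤ 1 / 100) (hC : 0 < C)
    (hε : 256 ^ 4 * a < ε) : derivWeight a C ^ 4 < ε * valueWeight a C ^ 5 := by
  have hε0 : 0 < ε := lt_of_le_of_lt (by positivity) hε
  have h0 := derivWeight_pos ha ha1 hC
  calc derivWeight a C ^ 4 ≤ (256 * a * C ^ 5) ^ 4 := by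
        gcongr
        exact derivWeight_le ha ha1 hC
    _ = 256 ^ 4 * a ^ 4 * C ^ 20 := by ring
    _ ≤ 256 ^ 4 * a * C ^ 20 := by
      gcongr
      exact pow_le_of_le_one ha.le (by linarith) (by norm_num)
    _ < ε * C ^ 20 := by gcongr
    _ = ε * (C ^ 4) ^ 5 := by ring
    _ ≤ ε * valueWeight a C ^ 5 := by
      gcongr
      exact pow_four_le_valueWeight ha ha1 hC

lemma multiPartial_zero {n : ℕ} (u : EuclideanSpace ℝ (Fin n) → ℝ) : multiPartial 0 u = u := by
  simp [multiPartial]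

lemma multiPartial_single_zero (u : EuclideanSpace ℝ (Fin 4) → ℝ) :
    multiPartial (Pi.single 0 1) u = partialDeriv 0 u := by
  simp [multiPartial, List.finRange_succ]

theorem isQuadratureDomain_Omega (ha : 0 < a) (ha1 : a ≤ 1 / 100) (hC : 0 < C) :
    IsQuadratureDomain (Omega a C) := by
  have hne : (Pi.single 0 1 : Fin 4 → ℕ) ≠ 0 := by simp
  refine ⟨isOpen_Omega ha ha1 hC, isConnected_Omega ha ha1 hC, isBounded_Omega ha ha1 hC, {0},
    {0, Pi.single 0 1}, fun _ α => if α = 0 then valueWeight a C else derivWeight a C, ?_, ?_⟩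
  · simpa using zero_mem_Omega ha ha1 hC
  · intro u hu hi
    refine (hasQuadratureIdentity_Omega ha ha1 hC u hu hi).trans ?_
    beta_reduce
    rw [Finset.sum_singleton, Finset.sum_pair hne.symm, if_pos rfl, if_neg hne, multiPartial_zero,
      multiPartial_single_zero]

end

end

end NonalgQD

theorem theorem3 :
    ∀ ε : ℝ, 0 < ε → ∃ α : ℝ, 0 < α ∧ α < 1 ∧ ∀ a C : ℝ, 0 < a → a < α → 0 < C →
      -- the planar map: Laurent splitting of `h`, univalent on the closed unit disk
      (AnalyticOnNhd ℂ (NonalgQD.f a C) (Metric.ball 0 a⁻¹) ∧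
        (∀ z : ℂ, a < ‖z‖ → ‖z‖ < a⁻¹ →
          NonalgQD.h a C z = NonalgQD.f a C z - NonalgQD.f a C z⁻¹) ∧
        Set.InjOn (NonalgQD.f a C) (Metric.closedBall 0 1)) ∧
      -- the rotated domain is a quadrature domain that is not algebraic
      NonalgQD.IsQuadratureDomain (NonalgQD.Omega a C) ∧
      ¬ NonalgQD.IsAlgebraicDomain (NonalgQD.Omega a C) ∧
      -- its one-point quadrature formula
      (0 : EuclideanSpace ℝ (Fin 4)) ∈ NonalgQD.Omega a C ∧
      (∃ a₀ a₁ : ℝ, 0 < a₀ ∧ 0 < a₁ ∧ a₁ < ε * C * a₀ ∧ a₁ ^ 4 < ε * a₀ ^ 5 ∧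
        NonalgQD.HasQuadratureIdentity (NonalgQD.Omega a C)
          (fun u => a₀ * u 0 + a₁ * NonalgQD.partialDeriv 0 u 0)) ∧
      -- its boundary through complete elliptic integrals
      frontier (NonalgQD.Omega a C) =
        NonalgQD.rotate (NonalgQD.profile a C '' Metric.sphere 0 1) := by
  intro ε hε
  refine ⟨min (1 / 100) (ε / 256 ^ 4), by positivity, (min_le_left _ _).trans_lt (by norm_num),
    fun a C ha hα hC => ?_⟩
  have ha1 : a ≤ 1 / 100 := hα.le.trans (min_le_left _ _)
  have ha2 : a ≤ 1 / 2 := by linarith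
  have haε : 256 ^ 4 * a < ε := by
    rw [← lt_div_iff₀' (by norm_num)]
    exact hα.trans_le (min_le_right _ _)
  exact ⟨⟨NonalgQD.f_analyticOnNhd ha ha2 hC.le,
      fun _ h1 h2 => NonalgQD.h_eq_f_sub_f_inv ha ha2 hC.le h1 h2,
      NonalgQD.f_injOn ha ha1 hC⟩,
    NonalgQD.isQuadratureDomain_Omega ha ha1 hC, NonalgQD.not_isAlgebraicDomain_Omega ha ha1 hC,
    NonalgQD.zero_mem_Omega ha ha1 hC,
    ⟨NonalgQD.valueWeight a C, NonalgQD.derivWeight a C,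
      (pow_pos hC 4).trans_le (NonalgQD.pow_four_le_valueWeight ha ha1 hC),
      NonalgQD.derivWeight_pos ha ha1 hC, NonalgQD.derivWeight_lt ha ha1 hC haε,
      NonalgQD.derivWeight_pow_four_lt ha ha1 hC haε,
      NonalgQD.hasQuadratureIdentity_Omega ha ha1 hC⟩,
    NonalgQD.frontier_Omega_eq_profile ha ha1 hC⟩
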